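/- **Setting.** Let $T,q_{\max},\mathcal C_\Gamma,\mathcal C_{\mathcal V},\mathcal C_{\mathcal Q},\bar R,\varepsilon>0$. Let - $\mathcal Q$ be a compact subset of $L^1(\mathbb R)$ such that every $q_0\in\mathcal Q$ satisfies $0\le q_0\le q_{\max}$ a.e. and $|q_0|_{TV(\mathbb R)}\le\mathcal C_{\mathcal Q}$; put $\mathcal C_{\mathcal Q_{1,0}}:=\sup_{q_0\in\mathcal Q}\|q_0\|_{L^1(\mathbb R)}$; - $\mathcal V:=\{V\in W^{2,\infty}([0,q_{\max}];\mathbb R_{\ge0}) : V'\le 0,\ \|V\|_{W^{2,\infty}([0,q_{\max}])}\le\mathcal C_{\mathcal V}\}$; - $\Gamma$ be the set of $\gamma\in L^1(\mathbb R_{\ge0};\mathbb R_{\ge 0})$ that are nonincreasing a.e. and satisfy $\|\gamma\|_{L^\infty(\mathbb R_{\ge0})}\le\mathcal C_\Gamma$, $\|\gamma\|_{L^1(\mathbb R_{\ge0})}=1$ and $\gamma(x)\le x^{-(1+\varepsilon)}$ for a.e. $x>\bar R$. Here $\|V\|_{W^{k,\infty}}:=\max_{0\le j\le k}\|V^{(j)}\|_{L^\infty([0,q_{\max}])}$,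 and $|\cdot|_{TV(\mathbb R)}$ is the (essential) total variation. For $(q_0,V,\gamma)\in\mathcal Q\times\mathcal V\times\Gamma$, a weak solution is a function $q\in C([0,T];L^1_{\rm loc}(\mathbb R)\cap L^2(\mathbb R))\cap L^\infty((0,T);L^\infty(\mathbb R))$ that solves, in the sense of distributions and with the initial datum included in the weak formulation, $$\partial_t q+\partial_x\big(V(W[q])\,q\big)=0 \text{ on }(0,T)\times\mathbb R,\qquad q(0,\cdot)=q_0,\qquad W[q](t,x):=\int_x^\infty\gamma(y-x)\,q(t,y)\,\mathrm dy,$$ where $W[q]$ takes values in $[0,q_{\max}]$, so that $V(W[q])$ is defined. For $V\in\mathcal V$ and $t\ge 0$ put $$\mathcal C_{TV}(t):=\Big(\mathcal C_{\mathcal Q}+t\,\|V''\|_{L^\infty([0,q_{\max}])}\,\mathcal C_{\mathcal Q_{1,0}}\,q_{\max}^2\,\mathcal C_\Gamma^2\Big)\,\mathrm e^{2t\|V'\|_{L^\infty([0,q_{\max}])}q_{\max}\mathcal C_\Gamma}.$$ **Theorem (strong stability of the nonlocal conservation law).** 1. Let $q$ be a weak solution for $(q_0,V,\gamma)\in\mathcal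 Q\times\mathcal V\times\Gamma$. Then $|q(t,\cdot)|_{TV(\mathbb R)}\le\mathcal C_{TV}(t)$ for every $t\in[0,T]$. In particular this holds, uniformly over $\mathcal Q\times\mathcal V\times\Gamma$, with $\|V'\|_{L^\infty}$ and $\|V''\|_{L^\infty}$ in $\mathcal C_{TV}(t)$ replaced by $\mathcal C_{\mathcal V}$. 2. Let $q$ and $\hat q$ be weak solutions for $(q_0,V,\gamma)$ and $(\hat q_0,\hat V,\hat\gamma)$ in $\mathcal Q\times\mathcal V\times\Gamma$, respectively, and let $\mathcal C_{TV}$ be formed with $V$. Then, for every $t\in[0,T]$, $$\begin{aligned}\|q(t,\cdot)-\hat q(t,\cdot)\|_{L^1(\mathbb R)}\le\bigg(&\|q_0-\hat q_0\|_{L^1(\mathbb R)}+\Big(t\,q_{\max}\,\mathcal C_\Gamma\,\mathcal C_{\mathcal Q_{1,0}}+\int_0^t\mathcal C_{TV}(s)\,\mathrm ds\Big)\|V-\hat V\|_{W^{1,\infty}([0,q_{\max}])}\\&+\Big(2\,\mathcal C_{\mathcal V}\,q_{\max}\int_0^t\mathcal C_{TV}(s)\,\mathrm ds+t\,\mathcal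 C_{\mathcal V}\,\mathcal C_{\mathcal Q_{1,0}}\,\mathcal C_\Gamma\,q_{\max}^2\Big)\|\gamma-\hat\gamma\|_{L^1(\mathbb R_{\ge0})}\bigg)\\&\cdot\mathrm e^{\mathcal C_{\mathcal V}\mathcal C_\Gamma t\,\big(\mathcal C_{TV}(T)+q_{\max}(1+q_{\max})\big)}.\end{aligned}$$ -/

import Mathlib

open MeasureTheory Set
open scoped ENNReal Topology ContDiff

noncomputable section

namespace NonlocalCL

/-- The total variation `|u|_{TV(ℝ)}` of a locally integrable function (invariant under changes of
`u` on null sets): the supremum of `∫ u φ'` over all `φ ∈ C¹_c(ℝ)` with `|φ| ≤ 1`. -/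
def totalVariation (u : ℝ → ℝ) : ℝ≥0∞ :=
  ⨆ (φ : ℝ → ℝ) (_ : ContDiff ℝ 1 φ ∧ HasCompactSupport φ ∧ ∀ x, |φ x| ≤ 1),
    ENNReal.ofReal (∫ x, u x * deriv φ x)

/-- `g` is a weak derivative of `f` on the open interval `(a, b)`. -/
def HasWeakDerivOn (a b : ℝ) (f g : ℝ → ℝ) : Prop :=
  ∀ φ : ℝ → ℝ, ContDiff ℝ ∞ φ → HasCompactSupport φ → tsupport φ ⊆ Ioo a b →
    ∫ x in Ioo a b, f x * deriv φ x = -∫ x in Ioo a b, g x * φ x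

/-- The norm of `L^∞([0, m])`, for essentially bounded functions. -/
def linftyNorm (m : ℝ) (f : ℝ → ℝ) : ℝ :=
  (eLpNorm f ∞ (volume.restrict (Ioo 0 m))).toReal

/-- The set of velocities: `V ∈ W^{2,∞}([0, m]; ℝ≥0)` (the continuous representative) with weak
derivatives `V' = V₁` and `V'' = V₂`, such that `V' ≤ 0` and
`‖V‖_{W^{2,∞}} = max (‖V‖_∞, ‖V'‖_∞, ‖V''‖_∞) ≤ CV`. Values of `V` outside `[0, m]` play no role. -/
structure IsVelocity (m CV : ℝ) (V V₁ V₂ : ℝ → ℝ) : Prop where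
  continuousOn : ContinuousOn V (Icc 0 m)
  nonneg : ∀ s ∈ Icc 0 m, 0 ≤ V s
  memLp : MemLp V ∞ (volume.restrict (Ioo 0 m))
  memLp_one : MemLp V₁ ∞ (volume.restrict (Ioo 0 m))
  memLp_two : MemLp V₂ ∞ (volume.restrict (Ioo 0 m))
  weakDeriv_one : HasWeakDerivOn 0 m V V₁
  weakDeriv_two : HasWeakDerivOn 0 m V₁ V₂
  nonpos : ∀ᵐ s ∂(volume.restrict (Ioo 0 m)), V₁ s ≤ 0
  norm_le : max (linftyNorm m V) (max (linftyNorm m V₁) (linftyNorm m V₂)) ≤ CV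

/-- The set of kernels: `γ ∈ L¹(ℝ≥0; ℝ≥0)`, a.e. equal to a nonincreasing function, bounded by
`CΓ`, of unit mass, with `γ(x) ≤ x^{-(1+ε)}` for a.e. `x > R`. Values of `γ` on the negative
half-line play no role. -/
structure IsKernel (CΓ R ε : ℝ) (γ : ℝ → ℝ) : Prop where
  integrableOn : IntegrableOn γ (Ici 0)
  nonneg : ∀ᵐ x ∂(volume.restrict (Ici 0)), 0 ≤ γ x
  antitone : ∃ g : ℝ → ℝ, AntitoneOn g (Ici 0) ∧ γ =ᵐ[volume.restrict (Ici 0)] g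
  le_bound : ∀ᵐ x ∂(volume.restrict (Ici 0)), γ x ≤ CΓ
  integral_eq_one : ∫ x in Ici 0, γ x = 1
  tail : ∀ᵐ x ∂(volume.restrict (Ioi R)), γ x ≤ x ^ (-(1 + ε))

/-- The set of initial data: a compact subset of `L¹(ℝ)` that consists of functions with values
in `[0, m]` and total variation at most `CQ`. -/
structure IsDataSet (m CQ : ℝ) (Q : Set (Lp ℝ 1 (volume : Measure ℝ))) : Prop where
  isCompact : IsCompact Q
  bounds : ∀ u ∈ Q, ∀ᵐ x, 0 ≤ u x ∧ u x ≤ m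
  totalVariation_le : ∀ u ∈ Q, totalVariation u ≤ ENNReal.ofReal CQ

/-- The supremum of the `L¹` norms of the initial data. -/
def supL1 (Q : Set (Lp ℝ 1 (volume : Measure ℝ))) : ℝ :=
  sSup ((fun u => ‖u‖) '' Q)

/-- The nonlocal operator `W[u](x) = ∫_x^∞ γ(y - x) u(y) dy`. -/
def nonlocalTerm (γ u : ℝ → ℝ) (x : ℝ) : ℝ :=
  ∫ y in Ioi x, γ (y - x) * u y

/-- Weak solutions `q ∈ C([0,T]; L²(ℝ)) ∩ L^∞((0,T); L^∞(ℝ))` of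
`∂ₜ q + ∂ₓ (V(W[q]) q) = 0` on `(0,T) × ℝ`, `q(0,·) = q₀`. (Continuity with values in `L²(ℝ)`
contains continuity with values in `L¹_loc(ℝ)`.) As `V` lives on `[0, m]`, the equation has a
meaning only if `W[q]` takes its values in `[0, m]`. Test functions are `C¹` with compact support
in `(-∞, T) × ℝ`. -/
structure IsWeakSolution (T m : ℝ) (V γ q₀ : ℝ → ℝ)
    (q : ℝ → Lp ℝ 2 (volume : Measure ℝ)) : Prop where
  continuousOn : ContinuousOn q (Icc 0 T)
  bounded : ∃ M : ℝ, ∀ t ∈ Icc 0 T, ∀ᵐ x, |q t x| ≤ M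
  range_nonlocal : ∀ t ∈ Icc 0 T, ∀ x, nonlocalTerm γ (q t) x ∈ Icc 0 m
  weak_form : ∀ φ : ℝ × ℝ → ℝ, ContDiff ℝ 1 φ → HasCompactSupport φ →
    tsupport φ ⊆ Iio T ×ˢ univ →
    (∫ t in (0 : ℝ)..T, ∫ x, q t x *
        (deriv (fun s => φ (s, x)) t
          + V (nonlocalTerm γ (q t) x) * deriv (fun y => φ (t, y)) x))
      + ∫ x, q₀ x * φ (0, x) = 0

/-- The constant
`C_TV(t) = (C_Q + t a₂ C_{Q,1} m² C_Γ²) exp (2 t a₁ m C_Γ)`,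
where `a₁`, `a₂` stand for (bounds of) `‖V'‖_∞`, `‖V''‖_∞`. -/
def tvConst (CQ CQ1 m CΓ a₁ a₂ t : ℝ) : ℝ :=
  (CQ + t * a₂ * CQ1 * m ^ 2 * CΓ ^ 2) * Real.exp (2 * t * a₁ * m * CΓ)

end NonlocalCL

end

/-! Both parts rest on one estimate. If `q`, `q'` are solutions with velocities `V`, `V'` and
nonlocal terms `W`, `W'`, then `r = q - q'` solves `∂ₜ r + ∂ₓ (V'(W') r) = -∂ₓ ((V(W) - V'(W')) q)`.
The transporting velocity `V'(W')` is Lipschitz in space, so transport does not increase the `L¹`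
norm, and only the right-hand side has to be bounded in `L¹`. With `q = u (· + h)` and `q' = u` for
a single solution `u`, this bounds difference quotients and hence the total variation
(`Sol.shiftBd_tvConst`); with two different solutions it gives stability (`Sol.stability`).

The `L¹` statement is obtained by duality in `transport_comparison`. A test function is carried
backwards by explicit Euler steps of the dual equation. Composition with `x + τ b(x)` keeps the
range of the test function and multiplies the bound on its derivative by at most `1 + L τ`, so
neither bound is lost as the step tends to zero.

The source is bounded in `stability_source_le`. As the kernel is nonincreasing on the half-line, `k
(· + h) - k` is a nonnegative function supported in `(-h, 0]` minus a nonnegative function of the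
same mass, and that mass is at most `h CΓ`. The increment of the nonlocal term of `r` is therefore a
local multiple of `r`, up to a small error, minus an average of `r`. The velocity is nonincreasing
and `q` is nonnegative, so the local part acts as damping. For a fixed test function `φ` this reads
`2 C ∫ |r| - C ∫ r φ` with `C = A₁' m CΓ`; the last term is absorbed by the weight `exp (C t)`, so
that these terms contribute the rate `C` and not `2 C`. The same sign yields the maximum principle
`BddSol.ae_le`, hence values in `[0, m]`.

Two obstacles remain. The source estimate presupposes finite variation, which is not part of the
notion of weak solution. `Sol.scaleBd` therefore tests only with functions whose derivative is at
most `Λ`: this restricted variation is finite a priori, and its growth rate does not depend on `Λ`.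
Dropping the restriction gives a crude finite bound, and a second pass gives the sharp constant.
Moreover, `L¹` norms and suprema over test functions come without regularity in time;
`gronwall_family` only ever integrates continuous upper bounds and improves them iteratively. -/

noncomputable section

namespace NonlocalCL

open Filter

/-! ### Test functions and duality for `L¹` norms -/

/-- Test functions: `C¹`, compactly supported, with Lipschitz derivative. -/
structure TestFn (φ : ℝ → ℝ) : Prop where
  contDiff : ContDiff ℝ 1 φ
  hasCompactSupport : HasCompactSupport φ
  lipschitz_deriv : ∃ K : ℝ, ∀ x y, |deriv φ x - deriv φ y| ≤ K * |x - y|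

theorem exists_lipschitz_of_contDiff {f : ℝ → ℝ} (hf : ContDiff ℝ 1 f)
    (hc : HasCompactSupport f) : ∃ K : ℝ, ∀ x y, |f x - f y| ≤ K * |x - y| := by
  obtain ⟨K, hK⟩ := ContDiff.lipschitzWith_of_hasCompactSupport hc hf one_ne_zero
  exact ⟨K, fun x y => by simpa [Real.dist_eq] using hK.dist_le_mul x y⟩

theorem continuous_of_abs_sub_le {f : ℝ → ℝ} {K : ℝ} (h : ∀ x y, |f x - f y| ≤ K * |x - y|) :
    Continuous f :=
  (LipschitzWith.of_dist_le_mul (K := K.toNNReal) fun x y => by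
    rw [Real.dist_eq, Real.dist_eq]
    exact (h x y).trans (mul_le_mul_of_nonneg_right (Real.le_coe_toNNReal K)
      (abs_nonneg _))).continuous

theorem TestFn.of_contDiff {φ : ℝ → ℝ} (h : ContDiff ℝ ∞ φ) (hc : HasCompactSupport φ) :
    TestFn φ where
  contDiff := h.of_le (by exact_mod_cast le_top)
  hasCompactSupport := hc
  lipschitz_deriv := by
    apply exists_lipschitz_of_contDiff _ hc.deriv
    exact (contDiff_infty_iff_deriv.1 h).2.of_le (by exact_mod_cast le_top)

theorem exists_support_bound {φ : ℝ → ℝ} (hc : HasCompactSupport φ) :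
    ∃ R > 0, ∀ x, R < |x| → φ x = 0 := by
  obtain ⟨R, hR, h⟩ := hc.exists_pos_le_norm
  exact ⟨R, hR, fun x hx => h x (by simpa using hx.le)⟩

theorem exists_abs_le {φ : ℝ → ℝ} (hφ : Continuous φ) (hc : HasCompactSupport φ) :
    ∃ C > 0, ∀ x, |φ x| ≤ C := by
  obtain ⟨C, hC⟩ := hc.exists_bound_of_continuous hφ
  exact ⟨max C 1, by positivity, fun x => (hC x).trans (le_max_left _ _)⟩

theorem TestFn.continuous {φ : ℝ → ℝ} (h : TestFn φ) : Continuous φ := h.contDiff.continuous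

theorem TestFn.continuous_deriv {φ : ℝ → ℝ} (h : TestFn φ) : Continuous (deriv φ) :=
  h.contDiff.continuous_deriv le_rfl

theorem TestFn.hasDerivAt {φ : ℝ → ℝ} (h : TestFn φ) (x : ℝ) : HasDerivAt φ (deriv φ x) x :=
  (h.contDiff.differentiable one_ne_zero x).hasDerivAt

theorem deriv_eq_zero_of_bound {φ : ℝ → ℝ} {R : ℝ} (h : ∀ x, R < |x| → φ x = 0) {x : ℝ}
    (hx : R < |x|) : deriv φ x = 0 := by
  have : φ =ᶠ[𝓝 x] fun _ => 0 := by
    filter_upwards [(isOpen_lt continuous_const continuous_abs).mem_nhds hx] with y hy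
    exact h y hy
  rw [this.deriv_eq]; simp

/-- Bounded measurable functions with bounded support are a.e. limits of smooth functions with
the same bounds. -/
theorem exists_smooth_tendsto {χ : ℝ → ℝ} (hm : Measurable χ) {a b R : ℝ}
    (hab : ∀ x, a ≤ χ x ∧ χ x ≤ b) (hR : ∀ x, R < |x| → χ x = 0) :
    ∃ f : ℕ → ℝ → ℝ, (∀ n, ContDiff ℝ ∞ (f n)) ∧ (∀ n, HasCompactSupport (f n)) ∧
      (∀ n x, a ≤ f n x ∧ f n x ≤ b) ∧ (∀ n x, R + 1 < |x| → f n x = 0) ∧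
      ∀ᵐ x, Tendsto (fun n => f n x) atTop (𝓝 (χ x)) := by
  have hbd : ∀ x, ‖χ x‖ ≤ max (-a) b := fun x => by
    rw [Real.norm_eq_abs, abs_le]
    constructor
    · have := le_max_left (-a) b; linarith [hab x]
    · exact (hab x).2.trans (le_max_right _ _)
  have hli : LocallyIntegrable χ := by
    refine (memLp_top_of_bound (μ := volume) hm.aestronglyMeasurable _
      (Eventually.of_forall hbd)).locallyIntegrable le_top
  -- The inner radius is half the outer one: almost everywhere convergence of mollifications needs a
  -- bounded ratio of the radii.
  let ρ : ℕ → ContDiffBump (0 : ℝ) := fun n =>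
    ⟨1 / (2 * ((n : ℝ) + 1)), 1 / ((n : ℝ) + 1), by positivity, by
      apply one_div_lt_one_div_of_lt <;> [positivity; linarith [(Nat.cast_nonneg n : (0:ℝ) ≤ n)]]⟩
  have hρ1 : ∀ n, (ρ n).rOut ≤ 1 := fun n => by
    change 1 / ((n : ℝ) + 1) ≤ 1
    rw [div_le_one (by positivity)]; linarith [(Nat.cast_nonneg n : (0:ℝ) ≤ n)]
  let L := ContinuousLinearMap.lsmul ℝ ℝ (E := ℝ)
  let f : ℕ → ℝ → ℝ := fun n => convolution ((ρ n).normed volume) χ L volume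
  have hf : ∀ n x, f n x = ∫ t, (ρ n).normed volume t * χ (x - t) := fun n x => rfl
  have hint : ∀ n x, Integrable (fun t => (ρ n).normed volume t * χ (x - t)) := fun n x => by
    refine ((ρ n).integrable_normed (μ := volume)).mul_bdd (c := max (-a) b)
      (hm.comp (measurable_const.sub measurable_id)).aestronglyMeasurable
      (Eventually.of_forall fun t => hbd _)
  have hfz : ∀ n x, R + 1 < |x| → f n x = 0 := fun n x hx => by
    rw [hf]
    refine integral_eq_zero_of_ae (Eventually.of_forall fun t => ?_)
    by_cases ht : |t| < (ρ n).rOut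
    · have : R < |x - t| := by
        have := abs_sub_abs_le_abs_sub x t
        linarith [hρ1 n]
      simp [hR _ this]
    · have : t ∉ Function.support ((ρ n).normed volume) := by
        rw [ContDiffBump.support_normed_eq]; simpa using ht
      simp [Function.notMem_support.1 this]
  refine ⟨f, fun n => ?_, fun n => ?_, fun n x => ?_, hfz, ?_⟩
  · exact (ρ n).hasCompactSupport_normed.contDiff_convolution_left L
      (ρ n).contDiff_normed hli
  · refine HasCompactSupport.of_support_subset_isCompact
      (isCompact_closedBall (0 : ℝ) (R + 1)) fun x hx => ?_
    by_contra h
    exact hx (hfz n x (by simpa using h))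
  · rw [hf]
    have h1 : ∀ c : ℝ, ∫ t, (ρ n).normed volume t * c = c := fun c => by
      rw [integral_mul_const, (ρ n).integral_normed, one_mul]
    constructor
    · rw [← h1 a]
      exact integral_mono ((ρ n).integrable_normed.mul_const _) (hint n x) fun t =>
        mul_le_mul_of_nonneg_left (hab _).1 ((ρ n).nonneg_normed t)
    · rw [← h1 b]
      exact integral_mono (hint n x) ((ρ n).integrable_normed.mul_const _) fun t =>
        mul_le_mul_of_nonneg_left (hab _).2 ((ρ n).nonneg_normed t)
  · refine ContDiffBump.ae_convolution_tendsto_right_of_locallyIntegrable (K := 2)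
      ?_ (Eventually.of_forall fun n => ?_) hli
    · exact tendsto_one_div_add_atTop_nhds_zero_nat
    · change 1 / ((n : ℝ) + 1) ≤ 2 * (1 / (2 * ((n : ℝ) + 1)))
      apply le_of_eq; field_simp

/-- A bounded measurable function times a bounded function vanishing outside an interval. -/
theorem integrable_mul_of_bound {w χ : ℝ → ℝ} (hw : Measurable w) {M : ℝ} (hM : ∀ x, |w x| ≤ M)
    (hχ : Measurable χ) {C R : ℝ} (hC : ∀ x, |χ x| ≤ C) (hR : ∀ x, R < |x| → χ x = 0) :
    Integrable (fun x => w x * χ x) := by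
  have h1 : Integrable ((Icc (-R) R).indicator fun _ : ℝ => M * C) := by
    rw [integrable_indicator_iff measurableSet_Icc]
    exact integrableOn_const (by simp)
  refine h1.mono' (hw.mul hχ).aestronglyMeasurable (Eventually.of_forall fun x => ?_)
  have hM0 : 0 ≤ M := (abs_nonneg _).trans (hM x)
  by_cases hx : x ∈ Icc (-R) R
  · rw [indicator_of_mem hx, Real.norm_eq_abs, abs_mul]
    exact mul_le_mul (hM x) (hC x) (abs_nonneg _) hM0
  · rw [indicator_of_notMem hx, hR x]
    · simp
    · by_contra h
      exact hx (abs_le.1 (not_lt.1 h))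

/-- Mollification preserves the bounds, keeps the supports in a common interval and converges almost
everywhere. Dominated convergence thus admits discontinuous tests such as signs. -/
theorem integral_mul_le_of_smooth {w : ℝ → ℝ} (hw : Measurable w) {M : ℝ} (hM : ∀ x, |w x| ≤ M)
    {κ B : ℝ}
    (H : ∀ φ, ContDiff ℝ ∞ φ → HasCompactSupport φ → (∀ x, -κ ≤ φ x ∧ φ x ≤ 1) →
      ∫ x, w x * φ x ≤ B)
    {χ : ℝ → ℝ} (hχ : Measurable χ) (hb : ∀ x, -κ ≤ χ x ∧ χ x ≤ 1) {R : ℝ}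
    (hR : ∀ x, R < |x| → χ x = 0) : ∫ x, w x * χ x ≤ B := by
  obtain ⟨f, hf, hfc, hfb, hfR, hft⟩ := exists_smooth_tendsto hχ hb hR
  have hM0 : 0 ≤ M := (abs_nonneg _).trans (hM 0)
  have hlim : Tendsto (fun n => ∫ x, w x * f n x) atTop (𝓝 (∫ x, w x * χ x)) := by
    have h1 : Integrable ((Icc (-(R + 1)) (R + 1)).indicator fun _ : ℝ => M * max κ 1) := by
      rw [integrable_indicator_iff measurableSet_Icc]
      exact integrableOn_const (by simp)
    refine tendsto_integral_of_dominated_convergence _ (fun n =>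
      (hw.mul (hf n).continuous.measurable).aestronglyMeasurable) h1 (fun n => ?_) ?_
    · refine Eventually.of_forall fun x => ?_
      by_cases hx : x ∈ Icc (-(R + 1)) (R + 1)
      · rw [indicator_of_mem hx, Real.norm_eq_abs, abs_mul]
        refine mul_le_mul (hM x) (abs_le.2 ⟨?_, ?_⟩) (abs_nonneg _) hM0
        · linarith [hfb n x, le_max_left κ 1]
        · exact (hfb n x).2.trans (le_max_right _ _)
      · rw [indicator_of_notMem hx, hfR n x]
        · simp
        · by_contra h
          exact hx (abs_le.1 (not_lt.1 h))
    · filter_upwards [hft] with x hx using hx.const_mul _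
  exact le_of_tendsto' hlim fun n => H _ (hf n) (hfc n) (hfb n)

/-- Truncations to bounded intervals control the integral of a nonnegative function. -/
theorem integrable_of_truncation_le {f : ℝ → ℝ} (h0 : ∀ x, 0 ≤ f x) {B : ℝ}
    (hint : ∀ n : ℕ, IntegrableOn f (Icc (-(n : ℝ)) n))
    (hB : ∀ n : ℕ, ∫ x in Icc (-(n : ℝ)) n, f x ≤ B) :
    Integrable f ∧ ∫ x, f x ≤ B := by
  have hcov : AECover volume atTop (fun n : ℕ => Icc (-(n : ℝ)) n) :=
    aecover_Icc (tendsto_neg_atTop_atBot.comp tendsto_natCast_atTop_atTop)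
      tendsto_natCast_atTop_atTop
  have hi : Integrable f := hcov.integrable_of_integral_norm_bounded B hint
    (Eventually.of_forall fun n => by
      simpa [Real.norm_eq_abs, abs_of_nonneg (h0 _)] using hB n)
  exact ⟨hi, le_of_tendsto' (hcov.integral_tendsto_of_countably_generated hi) hB⟩

/-- The optimal test is the sign of `w`, cut off to `[-n, n]`. Integrability is a conclusion,
because the truncated integrals are bounded uniformly in `n`. -/
theorem integrable_abs_of_smooth {w : ℝ → ℝ} (hw : Measurable w) {M : ℝ} (hM : ∀ x, |w x| ≤ M)
    {B : ℝ}
    (H : ∀ φ, ContDiff ℝ ∞ φ → HasCompactSupport φ → (∀ x, |φ x| ≤ 1) →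
      ∫ x, w x * φ x ≤ B) :
    Integrable w ∧ ∫ x, |w x| ≤ B := by
  have key : Integrable (fun x => |w x|) ∧ ∫ x, |w x| ≤ B := by
    refine integrable_of_truncation_le (fun x => abs_nonneg _) (fun n => ?_) (fun n => ?_)
    · exact Measure.integrableOn_of_bounded (by simp) hw.abs.aestronglyMeasurable (M := M)
        (Eventually.of_forall fun x => by simpa using hM x)
    · have hs : Measurable (fun x => (Icc (-(n : ℝ)) n).indicator
          (fun x => if 0 ≤ w x then (1 : ℝ) else -1) x) :=
        (Measurable.ite (measurableSet_le measurable_const hw) measurable_const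
          measurable_const).indicator measurableSet_Icc
      have := integral_mul_le_of_smooth hw hM (κ := 1)
        (fun φ h1 h2 h3 => H φ h1 h2 fun x => abs_le.2 (h3 x)) hs (R := n) (fun x => ?_)
        (fun x hx => ?_)
      · rw [← integral_indicator measurableSet_Icc]
        refine le_trans (le_of_eq (integral_congr_ae (Eventually.of_forall fun x => ?_))) this
        by_cases hx : x ∈ Icc (-(n : ℝ)) n
        · simp only [indicator_of_mem hx]
          split_ifs with h
          · rw [abs_of_nonneg h, mul_one]
          · rw [abs_of_neg (not_le.1 h)]; ring
        · simp [indicator_of_notMem hx]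
      · by_cases hx : x ∈ Icc (-(n : ℝ)) n
        · simp only [indicator_of_mem hx]
          split_ifs <;> norm_num
        · simp [indicator_of_notMem hx]
      · rw [indicator_of_notMem (s := Icc (-(n : ℝ)) n) fun h => not_le.2 hx (abs_le.2 h)]
  exact ⟨(integrable_norm_iff hw.aestronglyMeasurable).1 key.1, key.2⟩

/-- The optimal test is now the indicator of `0 ≤ w`, so tests with values in `[0, 1]` suffice. This
is the one-sided form behind the sign and the maximum principle. -/
theorem integrable_posPart_of_smooth {w : ℝ → ℝ} (hw : Measurable w) {M : ℝ}
    (hM : ∀ x, |w x| ≤ M) {B : ℝ}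
    (H : ∀ φ, ContDiff ℝ ∞ φ → HasCompactSupport φ → (∀ x, 0 ≤ φ x ∧ φ x ≤ 1) →
      ∫ x, w x * φ x ≤ B) :
    Integrable (fun x => max (w x) 0) ∧ ∫ x, max (w x) 0 ≤ B := by
  refine integrable_of_truncation_le (fun x => le_max_right _ _)
    (fun n => ?_) (fun n => ?_)
  · refine Measure.integrableOn_of_bounded (by simp)
      (hw.max measurable_const).aestronglyMeasurable (M := M)
      (Eventually.of_forall fun x => ?_)
    rw [Real.norm_of_nonneg (le_max_right _ _)]
    exact max_le ((le_abs_self _).trans (hM x)) ((abs_nonneg _).trans (hM x))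
  · have hs : Measurable (fun x => (Icc (-(n : ℝ)) n).indicator
        (fun x => if 0 ≤ w x then (1 : ℝ) else 0) x) :=
      (Measurable.ite (measurableSet_le measurable_const hw) measurable_const
        measurable_const).indicator measurableSet_Icc
    have := integral_mul_le_of_smooth hw hM (κ := 0)
      (fun φ h1 h2 h3 => H φ h1 h2 fun x => by simpa using h3 x) hs (R := n) (fun x => ?_)
      (fun x hx => ?_)
    · rw [← integral_indicator measurableSet_Icc]
      refine le_trans (le_of_eq (integral_congr_ae (Eventually.of_forall fun x => ?_))) this
      by_cases hx : x ∈ Icc (-(n : ℝ)) n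
      · simp only [indicator_of_mem hx]
        split_ifs with h
        · rw [max_eq_left h, mul_one]
        · rw [max_eq_right (not_le.1 h).le]; ring
      · simp [indicator_of_notMem hx]
    · by_cases hx : x ∈ Icc (-(n : ℝ)) n
      · simp only [indicator_of_mem hx]
        split_ifs <;> norm_num
      · simp [indicator_of_notMem hx]
    · rw [indicator_of_notMem (s := Icc (-(n : ℝ)) n) fun h => not_le.2 hx (abs_le.2 h)]

/-! ### Linear transport equations: comparison by backward Euler steps -/

/-- Uniform continuity in time on `[0, T]` with values in `L¹_loc(ℝ)`. -/
def LocCont (T : ℝ) (f : ℝ → ℝ → ℝ) : Prop :=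
  ∀ R : ℝ, ∀ ε > 0, ∃ η > 0, ∀ s ∈ Icc 0 T, ∀ t ∈ Icc 0 T, |s - t| ≤ η →
    ∫ x in Icc (-R) R, |f s x - f t x| ≤ ε

theorem abs_integral_mul_le {w χ : ℝ → ℝ} (hw : Measurable w) {M : ℝ} (hM : ∀ x, |w x| ≤ M)
    {C R : ℝ} (hC : ∀ x, |χ x| ≤ C) (hR : ∀ x, R < |x| → χ x = 0) :
    |∫ x, w x * χ x| ≤ C * ∫ x in Icc (-R) R, |w x| := by
  have hC0 : 0 ≤ C := (abs_nonneg _).trans (hC 0)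
  rw [← integral_const_mul, ← integral_indicator measurableSet_Icc, ← Real.norm_eq_abs]
  have hi : IntegrableOn (fun x => C * |w x|) (Icc (-R) R) :=
    Measure.integrableOn_of_bounded (by simp) (hw.abs.const_mul C).aestronglyMeasurable
      (M := C * M) (Eventually.of_forall fun x => by
        rw [Real.norm_eq_abs, abs_mul, abs_of_nonneg hC0, abs_abs]
        exact mul_le_mul_of_nonneg_left (hM x) hC0)
  refine norm_integral_le_of_norm_le ((integrable_indicator_iff measurableSet_Icc).2 hi)
    (Eventually.of_forall fun x => ?_)
  by_cases hx : x ∈ Icc (-R) R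
  · rw [indicator_of_mem hx, Real.norm_eq_abs, abs_mul, mul_comm]
    exact mul_le_mul_of_nonneg_right (hC x) (abs_nonneg _)
  · rw [indicator_of_notMem hx, hR x]
    · simp
    · by_contra h
      exact hx (abs_le.1 (not_lt.1 h))

theorem abs_integral_mul_le' {w χ : ℝ → ℝ} (hw : Measurable w) {M : ℝ} (hM : ∀ x, |w x| ≤ M)
    {C R : ℝ} (hR0 : 0 ≤ R) (hC : ∀ x, |χ x| ≤ C) (hR : ∀ x, R < |x| → χ x = 0) :
    |∫ x, w x * χ x| ≤ 2 * R * M * C := by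
  have hC0 : 0 ≤ C := (abs_nonneg _).trans (hC 0)
  refine (abs_integral_mul_le hw hM hC hR).trans ?_
  have : ∫ x in Icc (-R) R, |w x| ≤ M * (2 * R) := by
    have := norm_setIntegral_le_of_norm_le_const (μ := volume) (s := Icc (-R) R)
      (f := fun x => |w x|) (C := M) (by simp) (fun x _ => by simpa using hM x)
    refine (le_abs_self _).trans (this.trans (le_of_eq ?_))
    rw [Measure.real, Real.volume_Icc, ENNReal.toReal_ofReal (by linarith)]; ring
  nlinarith

theorem LocCont.continuousOn_integral {T : ℝ} {f : ℝ → ℝ → ℝ} (hf : LocCont T f)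
    (hm : ∀ s, Measurable (f s)) {M : ℝ} (hM : ∀ s x, |f s x| ≤ M) {χ : ℝ → ℝ}
    (hχ : Measurable χ) {C R : ℝ} (hC : ∀ x, |χ x| ≤ C) (hR : ∀ x, R < |x| → χ x = 0) :
    ContinuousOn (fun s => ∫ x, f s x * χ x) (Icc 0 T) := by
  have hC0 : 0 ≤ C := (abs_nonneg _).trans (hC 0)
  rw [Metric.continuousOn_iff]
  intro t ht ε hε
  obtain ⟨η, hη, H⟩ := hf R (ε / (C + 1) / 2) (by positivity)
  refine ⟨η, hη, fun s hs hst => ?_⟩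
  rw [Real.dist_eq, ← integral_sub (integrable_mul_of_bound (hm s) (hM s) hχ hC hR)
    (integrable_mul_of_bound (hm t) (hM t) hχ hC hR)]
  simp_rw [← sub_mul]
  have hM2 : ∀ x, |f s x - f t x| ≤ 2 * M := fun x =>
    (abs_sub _ _).trans (by linarith [hM s x, hM t x])
  refine (abs_integral_mul_le ((hm s).sub (hm t)) hM2 hC hR).trans_lt ?_
  have h1 := H s hs t ht (by simpa [Real.dist_eq] using hst.le)
  calc C * ∫ x in Icc (-R) R, |f s x - f t x| ≤ C * (ε / (C + 1) / 2) :=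
        mul_le_mul_of_nonneg_left h1 hC0
    _ ≤ (C + 1) * (ε / (C + 1) / 2) := by gcongr; linarith
    _ = ε / 2 := by field_simp
    _ < ε := by linarith

/-- Lipschitz functions are uniformly close to functions with Lipschitz derivatives (Steklov
averages), with the same bounds. -/
theorem exists_regularization {L M ε : ℝ} (hL : 0 ≤ L) (hε : 0 < ε) :
    ∃ K ≥ 0, ∀ a : ℝ → ℝ, (∀ x y, |a x - a y| ≤ L * |x - y|) → (∀ x, |a x| ≤ M) →
      ∃ b b' : ℝ → ℝ, (∀ x, HasDerivAt b (b' x) x) ∧ (∀ x, |b x - a x| ≤ ε) ∧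
        (∀ x, |b x| ≤ M) ∧ (∀ x, |b' x| ≤ L) ∧ ∀ x y, |b' x - b' y| ≤ K * |x - y| := by
  obtain ⟨δ, hδ, hLδ⟩ : ∃ δ > 0, L * δ ≤ ε :=
    ⟨ε / (L + 1), by positivity, by
      rw [mul_div_assoc', div_le_iff₀ (by positivity)]; nlinarith⟩
  -- The constant depends on `L` and `δ` only, not on `a`: one `K` serves the coefficient at all
  -- times.
  refine ⟨2 * L / δ, by positivity, fun a ha hM => ?_⟩
  have hac : Continuous a := continuous_of_abs_sub_le ha
  have hii : ∀ x y, IntervalIntegrable a volume x y := fun x y => hac.intervalIntegrable x y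
  refine ⟨fun x => (∫ y in x..x + δ, a y) / δ, fun x => (a (x + δ) - a x) / δ, fun x => ?_,
    fun x => ?_, fun x => ?_, fun x => ?_, fun x y => ?_⟩
  · have h1 : ∀ z, HasDerivAt (fun x => ∫ y in (0 : ℝ)..x, a y) (a z) z := fun z =>
      intervalIntegral.integral_hasDerivAt_right (hii _ _)
        (hac.stronglyMeasurableAtFilter _ _) hac.continuousAt
    have h2 := ((h1 (x + δ)).comp_add_const x δ).sub (h1 x)
    refine (h2.div_const δ).congr_of_eventuallyEq (Eventually.of_forall fun z => ?_)
    simp only [Pi.sub_apply]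
    rw [intervalIntegral.integral_interval_sub_left (hii _ _) (hii _ _)]
  · have h : (∫ y in x..x + δ, a y) / δ - a x = (∫ y in x..x + δ, (a y - a x)) / δ := by
      rw [intervalIntegral.integral_sub (hii _ _) (by simp)]
      simp; field_simp
    rw [h, abs_div, abs_of_pos hδ, div_le_iff₀ hδ]
    have := intervalIntegral.norm_integral_le_of_norm_le_const (a := x) (b := x + δ)
      (f := fun y => a y - a x) (C := L * δ) (fun y hy => by
        rw [uIoc_of_le (by linarith)] at hy
        refine (ha y x).trans (mul_le_mul_of_nonneg_left ?_ hL)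
        rw [abs_of_pos (by linarith [hy.1])]; linarith [hy.2])
    rw [Real.norm_eq_abs, add_sub_cancel_left, abs_of_pos hδ] at this
    exact this.trans (by gcongr)
  · rw [abs_div, abs_of_pos hδ, div_le_iff₀ hδ]
    have := intervalIntegral.norm_integral_le_of_norm_le_const (a := x) (b := x + δ)
      (f := a) (C := M) (fun y _ => hM y)
    rwa [Real.norm_eq_abs, add_sub_cancel_left, abs_of_pos hδ] at this
  · rw [abs_div, abs_of_pos hδ, div_le_iff₀ hδ]
    simpa [abs_of_pos hδ] using ha (x + δ) x
  · rw [← sub_div, abs_div, abs_of_pos hδ, div_mul_eq_mul_div]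
    gcongr
    have h1 := ha (x + δ) (y + δ)
    have h2 := ha x y
    rw [add_sub_add_right_eq_sub] at h1
    calc |a (x + δ) - a x - (a (y + δ) - a y)|
        = |(a (x + δ) - a (y + δ)) - (a x - a y)| := by ring_nf
      _ ≤ |a (x + δ) - a (y + δ)| + |a x - a y| := abs_sub _ _
      _ ≤ _ := by linarith

/-- Quantitative classes of test functions. -/
structure TestClass (κ Λ₁ Λ₂ R : ℝ) (φ : ℝ → ℝ) : Prop where
  contDiff : ContDiff ℝ 1 φ
  bounds : ∀ x, -κ ≤ φ x ∧ φ x ≤ 1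
  abs_deriv_le : ∀ x, |deriv φ x| ≤ Λ₁
  lipschitz_deriv : ∀ x y, |deriv φ x - deriv φ y| ≤ Λ₂ * |x - y|
  support : ∀ x, R < |x| → φ x = 0

theorem TestClass.testFn {κ Λ₁ Λ₂ R : ℝ} {φ : ℝ → ℝ} (h : TestClass κ Λ₁ Λ₂ R φ) : TestFn φ where
  contDiff := h.contDiff
  hasCompactSupport := HasCompactSupport.of_support_subset_isCompact
    (isCompact_closedBall (0 : ℝ) R) fun x hx => by
      by_contra h'
      exact hx (h.support x (by simpa using h'))
  lipschitz_deriv := ⟨Λ₂, h.lipschitz_deriv⟩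

theorem abs_taylor_le {φ φ' : ℝ → ℝ} (h : ∀ x, HasDerivAt φ (φ' x) x) {K : ℝ} (hK : 0 ≤ K)
    (hl : ∀ x y, |φ' x - φ' y| ≤ K * |x - y|) (x z : ℝ) :
    |φ (x + z) - φ x - z * φ' x| ≤ K * z ^ 2 := by
  have h1 : ∀ y ∈ uIcc x (x + z), HasDerivWithinAt (fun y => φ y - (y - x) * φ' x)
      (φ' y - φ' x) (uIcc x (x + z)) y := fun y _ => by
    have h2 := (h y).sub (((hasDerivAt_id y).sub_const x).mul_const (φ' x))
    simp only [id, one_mul] at h2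
    exact h2.hasDerivWithinAt
  have h2 := (convex_uIcc x (x + z)).norm_image_sub_le_of_norm_hasDerivWithin_le
    (C := K * |z|) h1 (fun y hy => by
      refine (hl y x).trans (mul_le_mul_of_nonneg_left ?_ hK)
      simpa using abs_sub_left_of_mem_uIcc hy) left_mem_uIcc right_mem_uIcc
  simp only [Real.norm_eq_abs, sub_self, zero_mul, sub_zero, add_sub_cancel_left] at h2
  calc |φ (x + z) - φ x - z * φ' x| = |φ (x + z) - z * φ' x - φ x| := by ring_nf
    _ ≤ K * |z| * |z| := h2
    _ = K * z ^ 2 := by rw [mul_assoc, abs_mul_abs_self, sq]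

/-- One Euler step of the dual equation. The bound on the first derivative grows by a factor that
involves only the Lipschitz constant `L`; the regularization constant `K` enters only the Lipschitz
bound of the derivative. Hence the first derivative stays controlled independently of the
regularization. -/
theorem TestClass.comp {κ Λ₁ Λ₂ R : ℝ} {φ : ℝ → ℝ} (h : TestClass κ Λ₁ Λ₂ R φ)
    (hΛ₂ : 0 ≤ Λ₂) {b b' : ℝ → ℝ} {M L K τ : ℝ} (hL : 0 ≤ L) (hτ : 0 ≤ τ)
    (hb : ∀ x, HasDerivAt b (b' x) x) (hM : ∀ x, |b x| ≤ M) (hbL : ∀ x, |b' x| ≤ L)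
    (hbK : ∀ x y, |b' x - b' y| ≤ K * |x - y|) :
    TestClass κ (Λ₁ * (1 + L * τ)) (Λ₂ * (1 + L * τ) ^ 2 + Λ₁ * K * τ) (R + M * τ)
      (fun x => φ (x + τ * b x)) := by
  have hΛ₁ : 0 ≤ Λ₁ := (abs_nonneg _).trans (h.abs_deriv_le 0)
  have hd : ∀ x, HasDerivAt (fun x => φ (x + τ * b x))
      (deriv φ (x + τ * b x) * (1 + τ * b' x)) x := fun x =>
    HasDerivAt.comp x (h.testFn.hasDerivAt _) ((hasDerivAt_id x).add ((hb x).const_mul τ))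
  have hd' : deriv (fun x => φ (x + τ * b x)) =
      fun x => deriv φ (x + τ * b x) * (1 + τ * b' x) := funext fun x => (hd x).deriv
  have h1 : ∀ x, |1 + τ * b' x| ≤ 1 + L * τ := fun x => by
    refine (abs_add_le _ _).trans ?_
    rw [abs_one, abs_mul, abs_of_nonneg hτ]
    nlinarith [hbL x]
  have hlb : ∀ x y, |b x - b y| ≤ L * |x - y| := fun x y => by
    simpa using convex_univ.norm_image_sub_le_of_norm_hasDerivWithin_le (C := L)
      (fun x _ => (hb x).hasDerivWithinAt) (fun x _ => hbL x) (mem_univ y) (mem_univ x)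
  have hY : ∀ x y, |x + τ * b x - (y + τ * b y)| ≤ (1 + L * τ) * |x - y| := fun x y => by
    calc |x + τ * b x - (y + τ * b y)| = |(x - y) + τ * (b x - b y)| := by ring_nf
      _ ≤ |x - y| + |τ * (b x - b y)| := abs_add_le _ _
      _ ≤ |x - y| + τ * (L * |x - y|) := by
        rw [abs_mul, abs_of_nonneg hτ]; gcongr; exact hlb x y
      _ = _ := by ring
  have hlip : ∀ x y, |deriv φ (x + τ * b x) * (1 + τ * b' x)
      - deriv φ (y + τ * b y) * (1 + τ * b' y)|
      ≤ (Λ₂ * (1 + L * τ) ^ 2 + Λ₁ * K * τ) * |x - y| := fun x y => by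
    have e : deriv φ (x + τ * b x) * (1 + τ * b' x) - deriv φ (y + τ * b y) * (1 + τ * b' y)
        = (deriv φ (x + τ * b x) - deriv φ (y + τ * b y)) * (1 + τ * b' x)
          + deriv φ (y + τ * b y) * (τ * (b' x - b' y)) := by ring
    rw [e]
    refine (abs_add_le _ _).trans ?_
    rw [abs_mul, abs_mul, abs_mul, abs_of_nonneg hτ]
    have e1 : |deriv φ (x + τ * b x) - deriv φ (y + τ * b y)| * |1 + τ * b' x|
        ≤ (Λ₂ * ((1 + L * τ) * |x - y|)) * (1 + L * τ) := by
      apply mul_le_mul _ (h1 x) (abs_nonneg _) (by positivity)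
      exact (h.lipschitz_deriv _ _).trans (mul_le_mul_of_nonneg_left (hY x y) hΛ₂)
    have e2 : |deriv φ (y + τ * b y)| * (τ * |b' x - b' y|) ≤ Λ₁ * (τ * (K * |x - y|)) := by
      apply mul_le_mul (h.abs_deriv_le _) _ (by positivity) hΛ₁
      exact mul_le_mul_of_nonneg_left (hbK x y) hτ
    nlinarith
  refine ⟨?_, fun x => h.bounds _, fun x => ?_, fun x y => ?_, fun x hx => ?_⟩
  · rw [contDiff_one_iff_deriv]
    refine ⟨fun x => (hd x).differentiableAt, ?_⟩
    have hbc : Continuous b := continuous_iff_continuousAt.2 fun x => (hb x).continuousAt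
    have hbc' : Continuous b' := continuous_of_abs_sub_le hbK
    have := h.testFn.continuous_deriv
    rw [hd']; fun_prop
  · rw [hd', abs_mul]
    exact mul_le_mul (h.abs_deriv_le _) (h1 x) (abs_nonneg _) hΛ₁
  · rw [hd']; exact hlip x y
  · apply h.support
    have h2 : |τ * b x| ≤ M * τ := by
      rw [abs_mul, abs_of_nonneg hτ, mul_comm]; gcongr; exact hM x
    have h3 : |x| ≤ |x + τ * b x| + |τ * b x| := by
      simpa using abs_sub (x + τ * b x) (τ * b x)
    linarith

theorem TestClass.mono {κ Λ₁ Λ₂ R Λ₁' Λ₂' R' : ℝ} {φ : ℝ → ℝ} (h : TestClass κ Λ₁ Λ₂ R φ)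
    (h1 : Λ₁ ≤ Λ₁') (h2 : Λ₂ ≤ Λ₂') (h3 : R ≤ R') : TestClass κ Λ₁' Λ₂' R' φ where
  contDiff := h.contDiff
  bounds := h.bounds
  abs_deriv_le := fun x => (h.abs_deriv_le x).trans h1
  lipschitz_deriv := fun x y => (h.lipschitz_deriv x y).trans
    (mul_le_mul_of_nonneg_right h2 (abs_nonneg _))
  support := fun x hx => h.support x (h3.trans_lt hx)

/-- Error of one explicit Euler step of the dual transport equation. -/
theorem integral_step_le {κ Λ₁ Λ₂ R N M ε τ : ℝ} {φ w a b b' : ℝ → ℝ}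
    (hφ : TestClass κ Λ₁ Λ₂ R φ) (hR : 0 ≤ R) (hΛ₂ : 0 ≤ Λ₂) (hτ : 0 ≤ τ) (hε : 0 ≤ ε)
    (hM0 : 0 ≤ M) (hw : Measurable w) (hN : ∀ x, |w x| ≤ N) (ha : Measurable a)
    (haM : ∀ x, |a x| ≤ M) (hb : ∀ x, HasDerivAt b (b' x) x) (hM : ∀ x, |b x| ≤ M)
    (hba : ∀ x, |b x - a x| ≤ ε) :
    (∫ x, w x * φ x) + τ * ∫ x, a x * w x * deriv φ x
      ≤ (∫ x, w x * φ (x + τ * b x))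
        + (2 * (R + M * τ) * N * (Λ₂ * (τ * M) ^ 2) + τ * (2 * R * (ε * N) * Λ₁)) := by
  have hΛ₁ : 0 ≤ Λ₁ := (abs_nonneg _).trans (hφ.abs_deriv_le 0)
  have hN0 : 0 ≤ N := (abs_nonneg _).trans (hN 0)
  have hbm : Measurable b :=
    (continuous_iff_continuousAt.2 fun x => (hb x).continuousAt).measurable
  have hφm : Measurable φ := hφ.contDiff.continuous.measurable
  have hdm : Measurable (deriv φ) := hφ.testFn.continuous_deriv.measurable
  have hds : ∀ x, R < |x| → deriv φ x = 0 := fun x => deriv_eq_zero_of_bound hφ.support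
  have hφb : ∀ x, |φ x| ≤ max κ 1 := fun x => abs_le.2
    ⟨by linarith [hφ.bounds x, le_max_left κ 1], (hφ.bounds x).2.trans (le_max_right _ _)⟩
  have hbw : ∀ c : ℝ → ℝ, (∀ x, |c x| ≤ M) → ∀ x, |c x * w x| ≤ M * N := fun c hc x => by
    rw [abs_mul]; exact mul_le_mul (hc x) (hN x) (abs_nonneg _) hM0
  have hsupp : ∀ x, R + M * τ < |x| → φ (x + τ * b x) = 0 := fun x hx => by
    apply hφ.support
    have h2 : |τ * b x| ≤ M * τ := by
      rw [abs_mul, abs_of_nonneg hτ, mul_comm]; gcongr; exact hM x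
    have h3 : |x| ≤ |x + τ * b x| + |τ * b x| := by
      simpa using abs_sub (x + τ * b x) (τ * b x)
    linarith
  have i1 : Integrable (fun x => w x * φ x) :=
    integrable_mul_of_bound hw hN hφm hφb hφ.support
  have i2 : Integrable (fun x => a x * w x * deriv φ x) :=
    integrable_mul_of_bound (ha.mul hw) (hbw a haM) hdm hφ.abs_deriv_le hds
  have i3 : Integrable (fun x => b x * w x * deriv φ x) :=
    integrable_mul_of_bound (hbm.mul hw) (hbw b hM) hdm hφ.abs_deriv_le hds
  have i4 : Integrable (fun x => w x * φ (x + τ * b x)) :=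
    integrable_mul_of_bound hw hN (hφm.comp (measurable_id.add (hbm.const_mul τ)))
      (fun x => hφb _) hsupp
  have hMτ : 0 ≤ M * τ := by positivity
  have e1 : |∫ x, w x * (φ (x + τ * b x) - φ x - τ * b x * deriv φ x)|
      ≤ 2 * (R + M * τ) * N * (Λ₂ * (τ * M) ^ 2) := by
    refine abs_integral_mul_le' hw hN (by positivity) (fun x => ?_) (fun x hx => ?_)
    · refine (abs_taylor_le hφ.testFn.hasDerivAt hΛ₂ hφ.lipschitz_deriv x (τ * b x)).trans ?_
      refine mul_le_mul_of_nonneg_left ?_ hΛ₂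
      rw [← sq_abs]
      refine pow_le_pow_left₀ (abs_nonneg _) ?_ 2
      rw [abs_mul, abs_of_nonneg hτ]; gcongr; exact hM x
    · rw [hsupp x hx, hφ.support x (by linarith), hds x (by linarith)]; ring
  have e2 : |∫ x, (a x - b x) * w x * deriv φ x| ≤ 2 * R * (ε * N) * Λ₁ := by
    refine abs_integral_mul_le' ((ha.sub hbm).mul hw) (fun x => ?_) hR hφ.abs_deriv_le hds
    simp only [Pi.mul_apply, Pi.sub_apply]
    rw [abs_mul]
    refine mul_le_mul ?_ (hN x) (abs_nonneg _) hε
    rw [abs_sub_comm]; exact hba x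
  have e3 : ∫ x, w x * (φ (x + τ * b x) - φ x - τ * b x * deriv φ x)
      = (∫ x, w x * φ (x + τ * b x)) - (∫ x, w x * φ x)
        - τ * ∫ x, b x * w x * deriv φ x := by
    rw [← integral_const_mul, ← integral_sub i4 i1,
      ← integral_sub (f := fun x => w x * φ (x + τ * b x) - w x * φ x) (i4.sub i1)
        (i3.const_mul τ)]
    refine integral_congr_ae (Eventually.of_forall fun x => ?_)
    ring
  have e4 : ∫ x, (a x - b x) * w x * deriv φ x
      = (∫ x, a x * w x * deriv φ x) - ∫ x, b x * w x * deriv φ x := by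
    rw [← integral_sub i2 i3]
    refine integral_congr_ae (Eventually.of_forall fun x => ?_)
    simp only; ring
  have h1 := neg_le_of_abs_le e1
  have h2 := mul_le_mul_of_nonneg_left ((le_abs_self _).trans e2) hτ
  rw [e3] at h1
  rw [e4] at h2
  linarith

/-- Continuity in time allows the flux to be frozen at time `s`, with error `τ Λ₁ ε`. The frozen
flux is the first-order change of the test function under the Euler step, which is
`integral_step_le`. -/
theorem transport_step {T M N κ Λ₁ Λ₂ R s τ ε εa : ℝ} {a w : ℝ → ℝ → ℝ} {β : ℝ → ℝ}
    (ham : ∀ s, Measurable (a s)) (ha : ∀ s x, |a s x| ≤ M)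
    (hw : ∀ s, Measurable (w s)) (hN : ∀ s x, |w s x| ≤ N)
    (hcont : LocCont T fun s x => a s x * w s x) (hβ : ContinuousOn β (Icc 0 T))
    {ψ : ℝ → ℝ} (hψ : TestClass κ Λ₁ Λ₂ R ψ) (hR : 0 ≤ R) (hΛ₂ : 0 ≤ Λ₂) (hτ : 0 ≤ τ)
    (hs : s ∈ Icc 0 T) (hsτ : s + τ ∈ Icc 0 T)
    (H : ∫ x, w (s + τ) x * ψ x ≤ (∫ x, w s x * ψ x)
        + ∫ σ in s..(s + τ), ((∫ x, a σ x * w σ x * deriv ψ x) + β σ))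
    (hLC : ∀ σ ∈ Icc 0 T, |σ - s| ≤ τ →
      ∫ x in Icc (-R) R, |a σ x * w σ x - a s x * w s x| ≤ ε)
    {b b' : ℝ → ℝ} (hb : ∀ x, HasDerivAt b (b' x) x) (hba : ∀ x, |b x - a s x| ≤ εa)
    (hbM : ∀ x, |b x| ≤ M) :
    ∫ x, w (s + τ) x * ψ x ≤ (∫ x, w s x * ψ (x + τ * b x)) + (∫ σ in s..(s + τ), β σ)
      + (2 * (R + M * τ) * N * (Λ₂ * (τ * M) ^ 2) + τ * (2 * R * (εa * N) * Λ₁)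
        + τ * (Λ₁ * ε)) := by
  have hM0 : 0 ≤ M := (abs_nonneg _).trans (ha 0 0)
  have hΛ₁ : 0 ≤ Λ₁ := (abs_nonneg _).trans (hψ.abs_deriv_le 0)
  have hds : ∀ x, R < |x| → deriv ψ x = 0 := fun x => deriv_eq_zero_of_bound hψ.support
  have hdm : Measurable (deriv ψ) := hψ.testFn.continuous_deriv.measurable
  have hawm : ∀ s, Measurable fun x => a s x * w s x := fun s => (ham s).mul (hw s)
  have hawb : ∀ s x, |a s x * w s x| ≤ M * N := fun s x => by
    rw [abs_mul]; exact mul_le_mul (ha s x) (hN s x) (abs_nonneg _) hM0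
  have hGc := hcont.continuousOn_integral hawm hawb hdm hψ.abs_deriv_le hds
  have hGi : IntervalIntegrable (fun σ => ∫ x, a σ x * w σ x * deriv ψ x) volume
      s (s + τ) := (hGc.mono (uIcc_subset_Icc hs hsτ)).intervalIntegrable
  have hβi : IntervalIntegrable β volume s (s + τ) :=
    (hβ.mono (uIcc_subset_Icc hs hsτ)).intervalIntegrable
  have h1 : ∀ σ ∈ Icc s (s + τ), (∫ x, a σ x * w σ x * deriv ψ x)
      ≤ (∫ x, a s x * w s x * deriv ψ x) + Λ₁ * ε := fun σ hσ => by
    have hσT : σ ∈ Icc 0 T := ⟨hs.1.trans hσ.1, hσ.2.trans hsτ.2⟩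
    have h2 := hLC σ hσT (by
      rw [abs_of_nonneg (by linarith [hσ.1])]; linarith [hσ.2])
    have hb2 : ∀ x, |a σ x * w σ x - a s x * w s x| ≤ 2 * (M * N) := fun x =>
      (abs_sub _ _).trans (by linarith [hawb σ x, hawb s x])
    have h3 := abs_integral_mul_le ((hawm σ).sub (hawm s)) hb2 hψ.abs_deriv_le hds
    have h4 : ∫ x, (a σ x * w σ x - a s x * w s x) * deriv ψ x
        = (∫ x, a σ x * w σ x * deriv ψ x) - ∫ x, a s x * w s x * deriv ψ x := by
      rw [← integral_sub
        (integrable_mul_of_bound (hawm σ) (hawb σ) hdm hψ.abs_deriv_le hds)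
        (integrable_mul_of_bound (hawm _) (hawb _) hdm hψ.abs_deriv_le hds)]
      simp_rw [sub_mul]
    have h6 := (le_abs_self _).trans (h3.trans (mul_le_mul_of_nonneg_left h2 hΛ₁))
    simp only [Pi.sub_apply] at h6
    rw [h4] at h6
    linarith
  have hGle : ∫ σ in s..(s + τ), (∫ x, a σ x * w σ x * deriv ψ x)
      ≤ τ * ((∫ x, a s x * w s x * deriv ψ x) + Λ₁ * ε) := by
    refine (intervalIntegral.integral_mono_on (by linarith) hGi (by simp) h1).trans
      (le_of_eq ?_)
    rw [intervalIntegral.integral_const, smul_eq_mul]; ring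
  rw [intervalIntegral.integral_add hGi hβi] at H
  have hεa : 0 ≤ εa := (abs_nonneg _).trans (hba 0)
  have hstep := integral_step_le hψ hR hΛ₂ hτ hεa hM0 (hw s) (hN s)
    (ham s) (ha s) hb hbM hba
  linarith

set_option maxHeartbeats 1000000 in
/-- Comparison principle for transport equations: an integrated inequality for all test functions
with values in `[-κ, 1]` and derivative at most `Λ exp (L T)` propagates bounds from time `0`. -/
theorem transport_comparison {T L M N κ Λ I₀ : ℝ} (hL : 0 ≤ L) (hΛ : 0 ≤ Λ)
    {a w : ℝ → ℝ → ℝ} {β : ℝ → ℝ}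
    (ha_lip : ∀ s x y, |a s x - a s y| ≤ L * |x - y|) (ha : ∀ s x, |a s x| ≤ M)
    (hw : ∀ s, Measurable (w s)) (hN : ∀ s x, |w s x| ≤ N)
    (hcont : LocCont T fun s x => a s x * w s x) (hβ : ContinuousOn β (Icc 0 T))
    (H : ∀ φ, TestFn φ → (∀ x, -κ ≤ φ x ∧ φ x ≤ 1) →
      (∀ x, |deriv φ x| ≤ Λ * Real.exp (L * T)) → ∀ s t, 0 ≤ s → s ≤ t → t ≤ T →
      ∫ x, w t x * φ x ≤ (∫ x, w s x * φ x)
        + ∫ σ in s..t, ((∫ x, a σ x * w σ x * deriv φ x) + β σ))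
    (H₀ : ∀ φ, TestFn φ → (∀ x, -κ ≤ φ x ∧ φ x ≤ 1) → ∫ x, w 0 x * φ x ≤ I₀)
    {φ : ℝ → ℝ} (hφ : TestFn φ) (hφb : ∀ x, -κ ≤ φ x ∧ φ x ≤ 1)
    (hφΛ : ∀ x, |deriv φ x| ≤ Λ) {t : ℝ} (ht : t ∈ Icc 0 T) :
    ∫ x, w t x * φ x ≤ I₀ + ∫ σ in (0 : ℝ)..t, β σ := by
  obtain ⟨ht0, htT⟩ := ht
  have hT : 0 ≤ T := ht0.trans htT
  have hM0 : 0 ≤ M := (abs_nonneg _).trans (ha 0 0)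
  have hN0 : 0 ≤ N := (abs_nonneg _).trans (hN 0 0)
  obtain ⟨R₀, hR₀, hsupp⟩ := exists_support_bound hφ.hasCompactSupport
  obtain ⟨K₂, hK₂⟩ := hφ.lipschitz_deriv
  set Λ₂ := max K₂ 0 with hΛ₂def
  have hΛ₂ : 0 ≤ Λ₂ := le_max_right _ _
  have ham : ∀ s, Measurable (a s) := fun s => (continuous_of_abs_sub_le (ha_lip s)).measurable
  refine le_of_forall_pos_le_add fun ε hε => ?_
  -- constants
  set Λ' := Λ * Real.exp (L * T) with hΛ'def
  have hΛ' : 0 ≤ Λ' := by positivity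
  set R' := R₀ + M * T with hR'def
  have hR' : 0 ≤ R' := by positivity
  -- Error budget: each step makes three errors (Taylor, regularization, freezing in time), each at
  -- most `τ ε₁`. The `n` steps of length `τ = t / n` add up to `3 t ε₁ ≤ ε`.
  set ε₁ := ε / (3 * (T + 1)) with hε₁
  have hε₁0 : 0 < ε₁ := by positivity
  obtain ⟨εa, hεa, hεa'⟩ : ∃ e > 0, 2 * R' * (e * N) * Λ' ≤ ε₁ :=
    ⟨ε₁ / (2 * R' * N * Λ' + 1), by positivity, by
      have : 2 * R' * (ε₁ / (2 * R' * N * Λ' + 1) * N) * Λ'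
        = ε₁ * ((2 * R' * N * Λ') / (2 * R' * N * Λ' + 1)) := by ring
      rw [this]
      refine mul_le_of_le_one_right hε₁0.le ?_
      rw [div_le_one (by positivity)]; linarith⟩
  -- The order of the choices matters: `K` may blow up as `εa` tends to zero, but it enters only
  -- through `Λ₂'`, which is multiplied by `τ²` and is compensated by the later choice of `n`.
  obtain ⟨K, hK, hreg⟩ := exists_regularization (M := M) hL hεa
  obtain ⟨η, hη, hLC⟩ := hcont R' (ε₁ / (Λ' + 1)) (by positivity)
  set Λ₂' := (Λ₂ + Λ' * K * T) * Real.exp (2 * L * T) with hΛ₂'def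
  have hΛ₂' : 0 ≤ Λ₂' := by positivity
  obtain ⟨n, hn⟩ := exists_nat_gt
    (max (T / η) (T * (2 * R' * N * Λ₂' * M ^ 2) / ε₁))
  have hTn0 : 0 ≤ max (T / η) (T * (2 * R' * N * Λ₂' * M ^ 2) / ε₁) :=
    le_max_of_le_left (by positivity)
  have hn0 : (0 : ℝ) < n := hTn0.trans_lt hn
  set τ := t / n with hτdef
  have hτ0 : 0 ≤ τ := by positivity
  have hnτ : n * τ = t := by rw [hτdef]; field_simp
  have hτη : τ ≤ η := by
    have h1 := (le_max_left _ _).trans_lt hn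
    rw [div_lt_iff₀ hη] at h1
    rw [hτdef, div_le_iff₀ hn0]; linarith
  have hτε : τ * (2 * R' * N * Λ₂' * M ^ 2) ≤ ε₁ := by
    have h1 := (le_max_right _ _).trans_lt hn
    rw [div_lt_iff₀ hε₁0] at h1
    rw [hτdef, div_mul_eq_mul_div, div_le_iff₀ hn0]
    have : t * (2 * R' * N * Λ₂' * M ^ 2) ≤ T * (2 * R' * N * Λ₂' * M ^ 2) := by gcongr
    linarith
  have h1L : 1 ≤ 1 + L * τ := by linarith [mul_nonneg hL hτ0]
  have hpow : ∀ j : ℕ, j ≤ n → (1 + L * τ) ^ j ≤ Real.exp (L * T) := fun j hj => by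
    calc (1 + L * τ) ^ j ≤ (1 + L * τ) ^ n := pow_le_pow_right₀ h1L hj
      _ ≤ (Real.exp (L * τ)) ^ n := by
        gcongr; linarith [Real.add_one_le_exp (L * τ)]
      _ = Real.exp (L * t) := by rw [← Real.exp_nat_mul, ← hnτ]; ring_nf
      _ ≤ _ := by gcongr
  have hjτ : ∀ j : ℕ, j ≤ n → j * τ ≤ T := fun j hj => by
    have : (j : ℝ) * τ ≤ n * τ := by gcongr
    linarith
  have hβi : ∀ s t, s ∈ Icc 0 T → t ∈ Icc 0 T → IntervalIntegrable β volume s t :=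
    fun s t hs ht => (hβ.mono (uIcc_subset_Icc hs ht)).intervalIntegrable
  have hawb : ∀ s x, |a s x * w s x| ≤ M * N := fun s x => by
    rw [abs_mul]; exact mul_le_mul (ha s x) (hN s x) (abs_nonneg _) hM0
  -- The class of `ψ` records that, between time `t` and time `k τ`, the test function has undergone
  -- `n - k` backward steps. The claim for `k + 1` follows from the claim for `k` applied to `ψ`
  -- composed with one more step.
  have main : ∀ k : ℕ, k ≤ n → ∀ ψ, TestClass κ (Λ * (1 + L * τ) ^ (n - k))
      ((Λ₂ + Λ' * K * (τ * (n - k : ℕ))) * (1 + L * τ) ^ (2 * (n - k)))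
      (R₀ + M * (τ * (n - k : ℕ))) ψ →
      ∫ x, w (k * τ) x * ψ x ≤ I₀ + (∫ σ in (0 : ℝ)..(k * τ), β σ) + k * τ * (3 * ε₁) := by
    intro k
    induction k with
    | zero =>
      intro _ ψ hψ
      simpa using H₀ ψ hψ.testFn hψ.bounds
    | succ k ih =>
      intro hk ψ hψ
      have hkn : n - k = (n - (k + 1)) + 1 := by omega
      set j := n - (k + 1) with hj
      have hjn : j ≤ n := by omega
      have hj1 : j + 1 ≤ n := by omega
      have hτj : τ * j ≤ T := by rw [mul_comm]; exact hjτ j hjn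
      have hkk : (k : ℝ) * τ ∈ Icc 0 T := ⟨by positivity, hjτ k (by omega)⟩
      have hkk1 : ((k : ℝ) + 1) * τ ∈ Icc 0 T :=
        ⟨by positivity, by simpa using hjτ (k + 1) hk⟩
      have hle : (k : ℝ) * τ ≤ ((k : ℝ) + 1) * τ := by gcongr; linarith
      obtain ⟨b, b', hb, hba, hbM, hbL, hbK⟩ := hreg (a (k * τ)) (ha_lip _) (ha _)
      have hψ2 : 0 ≤ (Λ₂ + Λ' * K * (τ * j)) * (1 + L * τ) ^ (2 * j) := by positivity
      have hψ' := hψ.comp hψ2 hL hτ0 hb hbM hbL hbK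
      have hΛj : Λ * (1 + L * τ) ^ j ≤ Λ' := by
        rw [hΛ'def]; gcongr; exact hpow j hjn
      have step := ih (by omega) (fun x => ψ (x + τ * b x)) (by
        rw [hkn]
        refine hψ'.mono (by rw [pow_succ]; linarith) ?_ (by push_cast; linarith)
        have hp1 : 1 ≤ (1 + L * τ) ^ (2 * (j + 1)) := one_le_pow₀ h1L
        have hKτ : 0 ≤ K * τ := by positivity
        calc (Λ₂ + Λ' * K * (τ * j)) * (1 + L * τ) ^ (2 * j) * (1 + L * τ) ^ 2
              + Λ * (1 + L * τ) ^ j * K * τ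
            ≤ (Λ₂ + Λ' * K * (τ * j)) * (1 + L * τ) ^ (2 * (j + 1)) + Λ' * K * τ * 1 := by
              rw [show 2 * (j + 1) = 2 * j + 2 by ring, pow_add]
              have : Λ * (1 + L * τ) ^ j * K * τ ≤ Λ' * K * τ := by gcongr
              linarith
          _ ≤ (Λ₂ + Λ' * K * (τ * j)) * (1 + L * τ) ^ (2 * (j + 1))
              + Λ' * K * τ * (1 + L * τ) ^ (2 * (j + 1)) := by gcongr
          _ = _ := by push_cast; ring)
      have hψu : TestClass κ Λ' Λ₂' R' ψ := by
        refine hψ.mono hΛj ?_ ?_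
        · rw [hΛ₂'def]
          have h1 : (1 + L * τ) ^ (2 * j) ≤ Real.exp (2 * L * T) := by
            rw [pow_mul', show 2 * L * T = L * T + L * T by ring, Real.exp_add, ← sq]
            exact pow_le_pow_left₀ (by positivity) (hpow j hjn) 2
          gcongr
        · rw [hR'def]; gcongr
      have hRjR : R₀ + M * (τ * j) + M * τ ≤ R' := by
        have h1 := hjτ (j + 1) hj1
        push_cast at h1
        have : M * ((j + 1) * τ) ≤ M * T := by gcongr
        rw [hR'def]; linarith
      have hRjR' : R₀ + M * (τ * j) ≤ R' := by linarith [mul_nonneg hM0 hτ0]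
      have hs1 : (k : ℝ) * τ + τ = ((k : ℝ) + 1) * τ := by ring
      have hψH := H ψ hψ.testFn hψ.bounds hψu.abs_deriv_le (k * τ) ((k + 1) * τ) hkk.1 hle hkk1.2
      have hRj : 0 ≤ R₀ + M * (τ * j) := by positivity
      have hstep := transport_step (ε := ε₁ / (Λ' + 1)) ham ha hw hN hcont hβ hψ hRj hψ2 hτ0 hkk
        (hs1 ▸ hkk1) (hs1 ▸ hψH) (fun σ hσ hστ => ?_) hb hba hbM
      rotate_left
      · refine le_trans ?_ (hLC σ hσ _ hkk (hστ.trans hτη))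
        refine setIntegral_mono_set ?_ (Eventually.of_forall fun x => abs_nonneg _)
          (Icc_subset_Icc (neg_le_neg hRjR') hRjR').eventuallyLE
        refine Measure.integrableOn_of_bounded (by simp) (M := M * N + M * N)
          ((((ham _).mul (hw _)).sub ((ham _).mul (hw _))).abs).aestronglyMeasurable
          (Eventually.of_forall fun x => ?_)
        rw [Real.norm_eq_abs, abs_abs]
        exact (abs_sub _ _).trans (add_le_add (hawb _ _) (hawb _ _))
      rw [hs1] at hstep
      have hsum : (∫ σ in (0 : ℝ)..(k * τ), β σ) + ∫ σ in (k * τ)..((k + 1) * τ), β σ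
          = ∫ σ in (0 : ℝ)..((k + 1) * τ), β σ :=
        intervalIntegral.integral_add_adjacent_intervals
          (hβi _ _ (left_mem_Icc.2 hT) hkk) (hβi _ _ hkk hkk1)
      have hψ2' : (Λ₂ + Λ' * K * (τ * j)) * (1 + L * τ) ^ (2 * j) ≤ Λ₂' := by
        rw [hΛ₂'def]
        have h1 : (1 + L * τ) ^ (2 * j) ≤ Real.exp (2 * L * T) := by
          rw [pow_mul', show 2 * L * T = L * T + L * T by ring, Real.exp_add, ← sq]
          exact pow_le_pow_left₀ (by positivity) (hpow j hjn) 2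
        gcongr
      have b1 : 2 * (R₀ + M * (τ * j) + M * τ) * N
          * ((Λ₂ + Λ' * K * (τ * j)) * (1 + L * τ) ^ (2 * j) * (τ * M) ^ 2) ≤ τ * ε₁ := by
        calc _ ≤ 2 * R' * N * (Λ₂' * (τ * M) ^ 2) := by gcongr
          _ = τ * (τ * (2 * R' * N * Λ₂' * M ^ 2)) := by ring
          _ ≤ _ := by gcongr
      have b2 : 2 * (R₀ + M * (τ * j)) * (εa * N) * (Λ * (1 + L * τ) ^ j) ≤ ε₁ := by
        refine le_trans ?_ hεa'
        gcongr
      have b3 := mul_le_mul_of_nonneg_left b2 hτ0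
      have b4 : τ * (Λ * (1 + L * τ) ^ j * (ε₁ / (Λ' + 1))) ≤ τ * ε₁ := by
        gcongr
        rw [mul_div_assoc', div_le_iff₀ (by positivity)]
        nlinarith
      push_cast
      rw [← hsum]
      linarith
  have hfin := main n le_rfl φ (by
    simp only [Nat.sub_self, pow_zero, mul_one, Nat.cast_zero, mul_zero, add_zero]
    exact ⟨hφ.contDiff, hφb, hφΛ, fun x y => (hK₂ x y).trans
      (mul_le_mul_of_nonneg_right (le_max_left _ _) (abs_nonneg _)), hsupp⟩)
  rw [hnτ] at hfin
  have : t * (3 * ε₁) ≤ ε := by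
    have : (3 * ε₁) = ε / (T + 1) := by rw [hε₁]; field_simp
    rw [this, mul_div_assoc', div_le_iff₀ (by positivity)]
    nlinarith
  linarith

/-! ### Grönwall's inequality without regularity in time -/

/-- Grönwall's inequality for a family of functions without regularity in time: it suffices that
each continuous bound can be improved by the integral inequality. -/
theorem gronwall_family {ι : Type*} {f : ι → ℝ → ℝ} {T I₀ K C B₀ : ℝ} {β : ℝ → ℝ}
    (hK : 0 ≤ K) (hC : 0 ≤ C) (hI₀ : 0 ≤ I₀) (hβ : Continuous β) (hβ0 : ∀ s, 0 ≤ β s)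
    (hB₀ : ∀ i, ∀ t ∈ Icc 0 T, f i t ≤ B₀)
    (H : ∀ z : ℝ → ℝ, Continuous z → (∀ s ∈ Icc 0 T, ∀ i, f i s ≤ z s) →
      ∀ t ∈ Icc 0 T, ∀ i, Real.exp (C * t) * f i t
        ≤ I₀ + ∫ s in (0 : ℝ)..t, Real.exp (C * s) * (β s + (K + C) * z s))
    (i : ι) {t : ℝ} (ht : t ∈ Icc 0 T) :
    f i t ≤ (I₀ + ∫ s in (0 : ℝ)..t, β s) * Real.exp (K * t) := by
  set Z : ℝ → ℝ := fun t => (I₀ + ∫ s in (0 : ℝ)..t, β s) * Real.exp (K * t) with hZ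
  have hDβ : ∀ t, HasDerivAt (fun t => ∫ s in (0 : ℝ)..t, β s) (β t) t := fun t =>
    intervalIntegral.integral_hasDerivAt_right (hβ.intervalIntegrable _ _)
      (hβ.stronglyMeasurableAtFilter _ _) hβ.continuousAt
  have hcβ : Continuous fun t => ∫ s in (0 : ℝ)..t, β s :=
    continuous_iff_continuousAt.2 fun t => (hDβ t).continuousAt
  have hZc : Continuous Z := by fun_prop
  have hβI : ∀ t ∈ Icc 0 T, 0 ≤ ∫ s in (0 : ℝ)..t, β s := fun t ht =>
    intervalIntegral.integral_nonneg ht.1 fun s _ => hβ0 s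
  have hZ0 : ∀ t ∈ Icc 0 T, 0 ≤ Z t := fun t ht =>
    mul_nonneg (add_nonneg hI₀ (hβI t ht)) (Real.exp_pos _).le
  have hB : ∃ B ≥ 0, ∀ i, ∀ t ∈ Icc 0 T, f i t ≤ B :=
    ⟨max B₀ 0, le_max_right _ _, fun i t ht => (hB₀ i t ht).trans (le_max_left _ _)⟩
  obtain ⟨B, hB0, hB⟩ := hB
  have hexp : ∀ c t : ℝ, HasDerivAt (fun t => Real.exp (c * t)) (c * Real.exp (c * t)) t :=
    fun c t => by
      have := ((hasDerivAt_id t).const_mul c).exp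
      simpa [mul_comm] using this
  -- the supersolution
  have hsuper : ∀ t ∈ Icc 0 T, I₀ + ∫ s in (0 : ℝ)..t, Real.exp (C * s) * (β s + (K + C) * Z s)
      ≤ Real.exp (C * t) * Z t := fun t ht => by
    have hd : ∀ s, HasDerivAt (fun s => Real.exp (C * s) * Z s)
        (Real.exp (C * s) * (β s * Real.exp (K * s) + (K + C) * Z s)) s := fun s => by
      have h1 := (hexp C s).mul (((hDβ s).const_add I₀).mul (hexp K s))
      refine h1.congr_deriv ?_
      simp only [hZ, Pi.mul_apply]; ring
    have hftc := intervalIntegral.integral_eq_sub_of_hasDerivAt (a := 0) (b := t)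
      (fun s _ => hd s) (Continuous.intervalIntegrable (by fun_prop) _ _)
    have hmono : ∫ s in (0 : ℝ)..t, Real.exp (C * s) * (β s + (K + C) * Z s)
        ≤ ∫ s in (0 : ℝ)..t, Real.exp (C * s) * (β s * Real.exp (K * s) + (K + C) * Z s) := by
      refine intervalIntegral.integral_mono_on ht.1
        (Continuous.intervalIntegrable (by fun_prop) _ _)
        (Continuous.intervalIntegrable (by fun_prop) _ _) fun s hs => ?_
      have : 1 ≤ Real.exp (K * s) := Real.one_le_exp (mul_nonneg hK hs.1)
      have := le_mul_of_one_le_right (hβ0 s) this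
      gcongr
    have hz0 : Real.exp (C * 0) * Z 0 = I₀ := by simp [hZ]
    rw [hz0] at hftc
    linarith
  -- iteration
  have iter : ∀ n : ℕ, ∀ t ∈ Icc 0 T, ∀ i, f i t
      ≤ Z t + Real.exp (-(C * t)) * (B * Real.exp (C * T)) * (((K + C) * t) ^ n / n.factorial) := by
    intro n
    induction n with
    | zero =>
      intro t ht i
      have h1 : 1 ≤ Real.exp (-(C * t)) * Real.exp (C * T) := by
        rw [← Real.exp_add]
        refine Real.one_le_exp ?_
        have := mul_le_mul_of_nonneg_left ht.2 hC
        linarith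
      have h2 := hB i t ht
      have h3 := hZ0 t ht
      have h4 := mul_le_mul_of_nonneg_left h1 hB0
      simp only [pow_zero, Nat.factorial_zero, Nat.cast_one, div_one, mul_one]
      linarith
    | succ n ih =>
      intro t ht i
      have h := H _ (by fun_prop) ih t ht i
      set D := B * Real.exp (C * T) with hD
      -- The factor `exp (-(C s))` in the iterates cancels the weight, so that the remainder is a
      -- monomial and integrates exactly to the next term of the exponential series.
      have e : ∀ s, Real.exp (C * s) * (β s + (K + C) *
            (Z s + Real.exp (-(C * s)) * D * (((K + C) * s) ^ n / n.factorial)))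
          = Real.exp (C * s) * (β s + (K + C) * Z s)
            + D * ((K + C) ^ (n + 1) / n.factorial * s ^ n) := fun s => by
        have : Real.exp (C * s) * Real.exp (-(C * s)) = 1 := by rw [← Real.exp_add]; simp
        have e2 : Real.exp (C * s) * ((K + C) * (Real.exp (-(C * s)) * D
            * (((K + C) * s) ^ n / n.factorial)))
            = (Real.exp (C * s) * Real.exp (-(C * s))) * (D * ((K + C) ^ (n + 1)
              / n.factorial * s ^ n)) := by
          rw [mul_pow, pow_succ]; ring
        rw [mul_add (K + C), ← add_assoc, mul_add (Real.exp (C * s)), e2, this, one_mul]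
      simp_rw [e] at h
      rw [intervalIntegral.integral_add (Continuous.intervalIntegrable (by fun_prop) _ _)
        (Continuous.intervalIntegrable (by fun_prop) _ _)] at h
      have e3 : ∫ s in (0 : ℝ)..t, D * ((K + C) ^ (n + 1) / n.factorial * s ^ n)
          = D * (((K + C) * t) ^ (n + 1) / (n + 1).factorial) := by
        rw [intervalIntegral.integral_const_mul, intervalIntegral.integral_const_mul,
          integral_pow, Nat.factorial_succ]
        push_cast
        rw [mul_pow]
        field_simp
        simp
      rw [e3] at h
      have h2 := hsuper t ht
      have h3 : Real.exp (-(C * t)) * (Real.exp (C * t) * f i t) = f i t := by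
        rw [← mul_assoc, ← Real.exp_add]; simp
      have h4 : Real.exp (-(C * t)) * (Real.exp (C * t) * Z t) = Z t := by
        rw [← mul_assoc, ← Real.exp_add]; simp
      have h5 : Real.exp (C * t) * f i t
          ≤ Real.exp (C * t) * Z t + D * (((K + C) * t) ^ (n + 1) / (n + 1).factorial) := by
        linarith
      have h6 := mul_le_mul_of_nonneg_left h5 (Real.exp_pos (-(C * t))).le
      rw [h3, mul_add, h4] at h6
      linarith
  have hlim : Tendsto (fun n : ℕ => Z t + Real.exp (-(C * t)) * (B * Real.exp (C * T))
      * (((K + C) * t) ^ n / n.factorial)) atTop (𝓝 (Z t)) := by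
    have := (FloorSemiring.tendsto_pow_div_factorial_atTop ((K + C) * t)).const_mul
      (Real.exp (-(C * t)) * (B * Real.exp (C * T)))
    simpa using this.const_add (Z t)
  exact ge_of_tendsto' hlim fun n => iter n t ht i

/-! ### Correlations and monotone kernels -/

/-- The correlation `∫ κ(z) f(x + z) dz`. -/
def corr (κ f : ℝ → ℝ) (x : ℝ) : ℝ := ∫ z, κ z * f (x + z)

theorem integrable_corr_integrand {κ f : ℝ → ℝ} (hκ : Integrable κ) (hf : Measurable f) {M : ℝ}
    (hM : ∀ x, |f x| ≤ M) (x : ℝ) : Integrable fun z => κ z * f (x + z) :=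
  hκ.mul_bdd (c := M) (hf.comp (measurable_const_add x)).aestronglyMeasurable
    (Eventually.of_forall fun _ => hM _)

theorem measurable_corr {κ f : ℝ → ℝ} (hκ : Measurable κ) (hf : Measurable f) :
    Measurable (corr κ f) := by
  have : StronglyMeasurable (Function.uncurry fun x z => κ z * f (x + z)) :=
    ((hκ.comp measurable_snd).mul (hf.comp (measurable_fst.add measurable_snd))).stronglyMeasurable
  exact this.integral_prod_right.measurable

theorem abs_corr_le {κ f : ℝ → ℝ} (hκ : Integrable κ) {M : ℝ}
    (hM : ∀ x, |f x| ≤ M) (x : ℝ) : |corr κ f x| ≤ (∫ z, |κ z|) * M := by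
  rw [← integral_mul_const, ← Real.norm_eq_abs]
  refine norm_integral_le_of_norm_le (hκ.abs.mul_const M) (Eventually.of_forall fun z => ?_)
  rw [Real.norm_eq_abs, abs_mul]
  exact mul_le_mul_of_nonneg_left (hM _) (abs_nonneg _)

theorem abs_corr_le_of_bdd {κ f : ℝ → ℝ} {C : ℝ} (hC : ∀ z, |κ z| ≤ C) (hf : Integrable f)
    (x : ℝ) : |corr κ f x| ≤ C * ∫ z, |f z| := by
  have h1 : ∫ z, |f z| = ∫ z, |f (x + z)| :=
    (integral_add_left_eq_self (fun z => |f z|) x).symm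
  rw [h1, ← integral_const_mul, ← Real.norm_eq_abs]
  refine norm_integral_le_of_norm_le ((hf.comp_add_left x).abs.const_mul C)
    (Eventually.of_forall fun z => ?_)
  rw [Real.norm_eq_abs, abs_mul]
  exact mul_le_mul_of_nonneg_right (hC _) (abs_nonneg _)

theorem corr_sub_right {κ f g : ℝ → ℝ} (hκ : Integrable κ) (hf : Measurable f) (hg : Measurable g)
    {M N : ℝ} (hM : ∀ x, |f x| ≤ M) (hN : ∀ x, |g x| ≤ N) (x : ℝ) :
    corr κ (fun y => f y - g y) x = corr κ f x - corr κ g x := by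
  rw [corr, corr, corr, ← integral_sub (integrable_corr_integrand hκ hf hM x)
    (integrable_corr_integrand hκ hg hN x)]
  simp_rw [mul_sub]

theorem corr_sub_left {κ l f : ℝ → ℝ} (hκ : Integrable κ) (hl : Integrable l) (hf : Measurable f)
    {M : ℝ} (hM : ∀ x, |f x| ≤ M) (x : ℝ) :
    corr (fun z => κ z - l z) f x = corr κ f x - corr l f x := by
  rw [corr, corr, corr, ← integral_sub (integrable_corr_integrand hκ hf hM x)
    (integrable_corr_integrand hl hf hM x)]
  simp_rw [sub_mul]

theorem corr_comp_add (κ f : ℝ → ℝ) (h x : ℝ) :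
    corr κ (fun y => f (y + h)) x = corr κ f (x + h) := by
  rw [corr, corr]; congr 1; ext z; ring_nf

/-- After reflection of the second variable this is the integrand of a convolution with the
reflected kernel. -/
theorem integrable_corr_prod {κ f : ℝ → ℝ} (hκ : Integrable κ) (hf : Integrable f) :
    Integrable (fun p : ℝ × ℝ => κ p.2 * f (p.1 + p.2)) (volume.prod volume) := by
  have h := Integrable.convolution_integrand (ContinuousLinearMap.mul ℝ ℝ) hκ.comp_neg hf
  have h2 := (((MeasurePreserving.id (volume : Measure ℝ)).prod
    (Measure.measurePreserving_neg (volume : Measure ℝ))).integrable_comp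
      h.aestronglyMeasurable).2 h
  refine h2.congr (Eventually.of_forall fun p => ?_)
  simp

theorem integrable_corr {κ f : ℝ → ℝ} (hκ : Integrable κ) (hf : Integrable f) :
    Integrable (corr κ f) :=
  (integrable_corr_prod hκ hf).integral_prod_left

theorem integral_abs_corr_le {κ f : ℝ → ℝ} (hκ : Integrable κ) (hf : Integrable f) :
    ∫ x, |corr κ f x| ≤ (∫ z, |κ z|) * ∫ x, |f x| := by
  have h := integrable_corr_prod hκ hf
  have h1 : ∫ x, |corr κ f x| ≤ ∫ x, ∫ z, |κ z * f (x + z)| :=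
    integral_mono (integrable_corr hκ hf).abs h.abs.integral_prod_left
      fun x => abs_integral_le_integral_abs
  refine h1.trans (le_of_eq ?_)
  rw [integral_integral_swap h.abs, ← integral_mul_const]
  congr 1; ext z
  simp_rw [abs_mul]
  rw [integral_const_mul, integral_add_right_eq_self (fun x => |f x|) z]

theorem corr_mono {κ f g : ℝ → ℝ} (hκ : Integrable κ) (h0 : ∀ z, 0 ≤ κ z) (hf : Measurable f)
    (hg : Measurable g) {M N : ℝ} (hM : ∀ x, |f x| ≤ M) (hN : ∀ x, |g x| ≤ N)
    (hfg : ∀ x, f x ≤ g x) (x : ℝ) : corr κ f x ≤ corr κ g x :=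
  integral_mono (integrable_corr_integrand hκ hf hM x) (integrable_corr_integrand hκ hg hN x)
    fun z => mul_le_mul_of_nonneg_left (hfg _) (h0 z)

theorem corr_const (κ : ℝ → ℝ) (c x : ℝ) : corr κ (fun _ => c) x = (∫ z, κ z) * c := by
  rw [corr, integral_mul_const]

/-- Nonlocal kernels, extended by zero to the negative half-line. -/
structure Kern (CΓ : ℝ) (k : ℝ → ℝ) : Prop where
  measurable : Measurable k
  eq_zero : ∀ z ≤ 0, k z = 0
  nonneg : ∀ z, 0 ≤ k z
  le : ∀ z, k z ≤ CΓ
  anti : ∀ x y, 0 < x → x ≤ y → k y ≤ k x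
  integrable : Integrable k
  integral_eq : ∫ z, k z = 1

/-- Positive part of `k (· + h) - k`. -/
def posKern (k : ℝ → ℝ) (h z : ℝ) : ℝ := if z ≤ 0 then k (z + h) else 0

/-- Negative part of `k (· + h) - k`. -/
def negKern (k : ℝ → ℝ) (h z : ℝ) : ℝ := if z ≤ 0 then 0 else k z - k (z + h)

namespace Kern

variable {CΓ : ℝ} {k : ℝ → ℝ} (hk : Kern CΓ k)

include hk

theorem bound_nonneg : 0 ≤ CΓ := (hk.nonneg 0).trans (hk.le 0)

theorem abs_le (z : ℝ) : |k z| ≤ CΓ := by rw [abs_of_nonneg (hk.nonneg z)]; exact hk.le z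

theorem integral_abs : ∫ z, |k z| = 1 := by
  simp_rw [abs_of_nonneg (hk.nonneg _)]; exact hk.integral_eq

theorem posKern_nonneg (h z : ℝ) : 0 ≤ posKern k h z := by
  unfold posKern; split_ifs; exacts [hk.nonneg _, le_rfl]

theorem negKern_nonneg {h : ℝ} (hh : 0 ≤ h) (z : ℝ) : 0 ≤ negKern k h z := by
  unfold negKern
  split_ifs with hz
  · exact le_rfl
  · exact sub_nonneg.2 (hk.anti _ _ (not_le.1 hz) (by linarith))

theorem sub_eq {h : ℝ} (z : ℝ) : k (z + h) - k z = posKern k h z - negKern k h z := by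
  unfold posKern negKern
  split_ifs with hz
  · rw [hk.eq_zero z hz]
  · ring

theorem measurable_posKern (h : ℝ) : Measurable (posKern k h) :=
  Measurable.ite measurableSet_Iic (hk.measurable.comp (measurable_add_const h)) measurable_const

theorem posKern_le (h z : ℝ) : posKern k h z ≤ (Ioc (-h) 0).indicator (fun _ => CΓ) z := by
  unfold posKern
  split_ifs with hz
  · by_cases h1 : -h < z
    · rw [indicator_of_mem (show z ∈ Ioc (-h) 0 from ⟨h1, hz⟩)]; exact hk.le _
    · rw [hk.eq_zero _ (by linarith)]
      exact indicator_nonneg (fun _ _ => hk.bound_nonneg) _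
  · exact indicator_nonneg (fun _ _ => hk.bound_nonneg) _

theorem integrable_posKern (h : ℝ) : Integrable (posKern k h) := by
  have h1 : Integrable ((Ioc (-h) 0).indicator fun _ : ℝ => CΓ) := by
    rw [integrable_indicator_iff measurableSet_Ioc]; exact integrableOn_const (by simp)
  refine h1.mono' (hk.measurable_posKern h).aestronglyMeasurable (Eventually.of_forall fun z => ?_)
  rw [Real.norm_of_nonneg (hk.posKern_nonneg h z)]
  exact hk.posKern_le h z

/-- The support is contained in `(-h, 0]` and the values are at most `CΓ`. For small `h` this part
acts like a multiple of a point mass, produced by the jump of the kernel at `0`. -/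
theorem integral_posKern_le {h : ℝ} (hh : 0 ≤ h) : ∫ z, posKern k h z ≤ h * CΓ := by
  have h1 : Integrable ((Ioc (-h) 0).indicator fun _ : ℝ => CΓ) := by
    rw [integrable_indicator_iff measurableSet_Ioc]; exact integrableOn_const (by simp)
  refine (integral_mono (hk.integrable_posKern h) h1 (hk.posKern_le h)).trans (le_of_eq ?_)
  rw [integral_indicator measurableSet_Ioc, setIntegral_const, smul_eq_mul, Measure.real,
    Real.volume_Ioc, ENNReal.toReal_ofReal (by linarith)]
  ring

theorem negKern_eq (h z : ℝ) : negKern k h z = posKern k h z - (k (z + h) - k z) := by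
  rw [hk.sub_eq]; ring

theorem integrable_negKern (h : ℝ) : Integrable (negKern k h) := by
  have := (hk.integrable_posKern h).sub ((hk.integrable.comp_add_right h).sub hk.integrable)
  refine this.congr (Eventually.of_forall fun z => ?_)
  simp [hk.negKern_eq h z]

/-- By translation invariance `k (· + h) - k` has integral zero, so its two parts have equal mass.
-/
theorem integral_negKern (h : ℝ) : ∫ z, negKern k h z = ∫ z, posKern k h z := by
  simp_rw [hk.negKern_eq h]
  rw [integral_sub (g := fun z => k (z + h) - k z) (hk.integrable_posKern h)
      ((hk.integrable.comp_add_right h).sub hk.integrable),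
    integral_sub (hk.integrable.comp_add_right h) hk.integrable,
    integral_add_right_eq_self (fun z => k z) h]
  ring

theorem integral_abs_posKern (h : ℝ) : ∫ z, |posKern k h z| = ∫ z, posKern k h z := by
  simp_rw [abs_of_nonneg (hk.posKern_nonneg h _)]

theorem integral_abs_negKern {h : ℝ} (hh : 0 ≤ h) :
    ∫ z, |negKern k h z| = ∫ z, posKern k h z := by
  simp_rw [abs_of_nonneg (hk.negKern_nonneg hh _)]; exact hk.integral_negKern h

theorem corr_sub_eq {f : ℝ → ℝ} (hf : Measurable f) {M : ℝ} (hM : ∀ x, |f x| ≤ M) (h x : ℝ) :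
    corr k f (x - h) - corr k f x = corr (posKern k h) f x - corr (negKern k h) f x := by
  have h1 : corr k f (x - h) = corr (fun z => k (z + h)) f x := by
    rw [corr, corr, ← integral_add_right_eq_self _ h]
    congr 1; ext z; ring_nf
  rw [h1, ← corr_sub_left (hk.integrable.comp_add_right h) hk.integrable hf hM,
    ← corr_sub_left (hk.integrable_posKern h) (hk.integrable_negKern h) hf hM]
  simp_rw [corr, hk.sub_eq]

/-- For `f` with values in `[0, m]` both parts of the increment are nonnegative and at most `m h
CΓ`, so their difference obeys the same bound. For `f` without a sign the two bounds add up, whence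
the factor `2` in `abs_corr_sub_le_of_abs`. -/
theorem abs_corr_sub_le {f : ℝ → ℝ} (hf : Measurable f) {m : ℝ}
    (hm : ∀ x, 0 ≤ f x ∧ f x ≤ m) (x y : ℝ) :
    |corr k f x - corr k f y| ≤ m * CΓ * |x - y| := by
  wlog hxy : x ≤ y generalizing x y
  · rw [abs_sub_comm, abs_sub_comm x y]; exact this y x (not_le.1 hxy).le
  have hm' : ∀ x, |f x| ≤ m := fun x => by rw [abs_of_nonneg (hm x).1]; exact (hm x).2
  have hm0 : 0 ≤ m := (hm 0).1.trans (hm 0).2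
  obtain ⟨h, hh, rfl⟩ : ∃ h, 0 ≤ h ∧ x = y - h := ⟨y - x, by linarith, by ring⟩
  rw [hk.corr_sub_eq hf hm', show |y - h - y| = h by rw [sub_sub_cancel_left, abs_neg,
    abs_of_nonneg hh]]
  have b : ∀ κ : ℝ → ℝ, (∀ z, 0 ≤ κ z) → 0 ≤ corr κ f y := fun κ h0 =>
    integral_nonneg fun z => mul_nonneg (h0 z) (hm _).1
  have b1 := b _ (hk.posKern_nonneg h)
  have b2 := b _ (hk.negKern_nonneg hh)
  have b3 := (le_abs_self _).trans (abs_corr_le (hk.integrable_posKern h) hm' y)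
  have b4 := (le_abs_self _).trans (abs_corr_le (hk.integrable_negKern h) hm' y)
  rw [hk.integral_abs_posKern] at b3
  rw [hk.integral_abs_negKern hh] at b4
  have b5 := mul_le_mul_of_nonneg_right (hk.integral_posKern_le hh) hm0
  rw [_root_.abs_le]
  constructor <;> linarith

theorem abs_corr_sub_le_of_abs {f : ℝ → ℝ} (hf : Measurable f) {M : ℝ}
    (hM : ∀ x, |f x| ≤ M) (x y : ℝ) :
    |corr k f x - corr k f y| ≤ 2 * M * CΓ * |x - y| := by
  wlog hxy : x ≤ y generalizing x y
  · rw [abs_sub_comm, abs_sub_comm x y]; exact this y x (not_le.1 hxy).le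
  have hM0 : 0 ≤ M := (abs_nonneg _).trans (hM 0)
  obtain ⟨h, hh, rfl⟩ : ∃ h, 0 ≤ h ∧ x = y - h := ⟨y - x, by linarith, by ring⟩
  rw [hk.corr_sub_eq hf hM, show |y - h - y| = h by rw [sub_sub_cancel_left, abs_neg,
    abs_of_nonneg hh]]
  have b3 := abs_corr_le (hk.integrable_posKern h) hM y
  have b4 := abs_corr_le (hk.integrable_negKern h) hM y
  rw [hk.integral_abs_posKern] at b3
  rw [hk.integral_abs_negKern hh] at b4
  have b5 := mul_le_mul_of_nonneg_right (hk.integral_posKern_le hh) hM0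
  refine (abs_sub _ _).trans ?_
  linarith

/-- The increment falls on the kernel, whose two parts have mass at most `|h| CΓ` each; no
regularity of `f` is used. -/
theorem integral_abs_corr_sub_le {f : ℝ → ℝ} (hf : Measurable f) {M : ℝ}
    (hM : ∀ x, |f x| ≤ M) (hfi : Integrable f) (h : ℝ) :
    ∫ x, |corr k f (x + h) - corr k f x| ≤ 2 * CΓ * |h| * ∫ x, |f x| := by
  have hpos : ∀ h : ℝ, 0 ≤ h →
      ∫ x, |corr k f (x - h) - corr k f x| ≤ 2 * CΓ * |h| * ∫ x, |f x| := fun h hh => by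
    simp_rw [hk.corr_sub_eq hf hM]
    have i1 := integrable_corr (hk.integrable_posKern h) hfi
    have i2 := integrable_corr (hk.integrable_negKern h) hfi
    have b1 := integral_abs_corr_le (hk.integrable_posKern h) hfi
    have b2 := integral_abs_corr_le (hk.integrable_negKern h) hfi
    rw [hk.integral_abs_posKern] at b1
    rw [hk.integral_abs_negKern hh] at b2
    have b0 : 0 ≤ ∫ x, |f x| := integral_nonneg fun x => abs_nonneg _
    have b5 := mul_le_mul_of_nonneg_right (hk.integral_posKern_le hh) b0
    have b6 : ∫ x, |corr (posKern k h) f x - corr (negKern k h) f x|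
        ≤ ∫ x, (|corr (posKern k h) f x| + |corr (negKern k h) f x|) :=
      integral_mono (i1.sub i2).abs (i1.abs.add i2.abs) fun x => abs_sub _ _
    rw [integral_add i1.abs i2.abs] at b6
    rw [abs_of_nonneg hh]
    linarith
  rcases le_total 0 h with hh | hh
  · have := hpos h hh
    rw [← integral_add_right_eq_self _ h] at this
    simp only [add_sub_cancel_right] at this
    simp_rw [abs_sub_comm (corr k f (_ + h))]
    exact this
  · have := hpos (-h) (by linarith)
    simpa using this

end Kern

/-! ### Velocities -/

/-- Velocities: `C¹` functions with nonpositive, bounded and Lipschitz derivative. -/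
structure Vel (A₁ A₂ : ℝ) (V v : ℝ → ℝ) : Prop where
  hasDerivAt : ∀ x, HasDerivAt V (v x) x
  nonpos : ∀ x, v x ≤ 0
  lower : ∀ x, -A₁ ≤ v x
  lip : ∀ x y, |v x - v y| ≤ A₂ * |x - y|

namespace Vel

variable {A₁ A₂ : ℝ} {V v : ℝ → ℝ} (hV : Vel A₁ A₂ V v)

include hV

theorem A₁_nonneg : 0 ≤ A₁ := by linarith [hV.nonpos 0, hV.lower 0]

theorem A₂_nonneg : 0 ≤ A₂ := by simpa using (abs_nonneg _).trans (hV.lip 1 0)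

theorem abs_deriv_le (x : ℝ) : |v x| ≤ A₁ :=
  abs_le.2 ⟨hV.lower x, (hV.nonpos x).trans hV.A₁_nonneg⟩

theorem continuous : Continuous V :=
  continuous_iff_continuousAt.2 fun x => (hV.hasDerivAt x).continuousAt

theorem continuous_deriv : Continuous v := continuous_of_abs_sub_le hV.lip

theorem abs_sub_le (x y : ℝ) : |V x - V y| ≤ A₁ * |x - y| := by
  simpa using convex_univ.norm_image_sub_le_of_norm_hasDerivWithin_le (C := A₁)
    (fun x _ => (hV.hasDerivAt x).hasDerivWithinAt) (fun x _ => hV.abs_deriv_le x)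
    (mem_univ y) (mem_univ x)

theorem abs_taylor_le (x y : ℝ) : |V y - V x - v x * (y - x)| ≤ A₂ * (y - x) ^ 2 := by
  have := NonlocalCL.abs_taylor_le hV.hasDerivAt hV.A₂_nonneg hV.lip x (y - x)
  rwa [add_sub_cancel, mul_comm (y - x)] at this

/-- The left side is the increment over `[0, 1]` of the difference of `V` along the two segments.
Its derivative is a slope times the difference of the increments, plus a difference of slopes times
the first increment. -/
theorem four_point_le (x₁ y₁ x₂ y₂ : ℝ) :
    |(V y₁ - V x₁) - (V y₂ - V x₂)| ≤ A₁ * |(y₁ - x₁) - (y₂ - x₂)|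
      + A₂ * |y₁ - x₁| * (|x₁ - x₂| + |y₁ - y₂|) := by
  set g : ℝ → ℝ := fun θ => V (x₁ + θ * (y₁ - x₁)) - V (x₂ + θ * (y₂ - x₂)) with hg
  have hp : ∀ x d θ : ℝ, HasDerivAt (fun θ => V (x + θ * d)) (v (x + θ * d) * d) θ :=
    fun x d θ => by
      have h1 : HasDerivAt (fun θ : ℝ => x + θ * d) d θ := by
        simpa using ((hasDerivAt_id θ).mul_const d).const_add x
      exact HasDerivAt.comp θ (hV.hasDerivAt _) h1
  have h1 := (convex_Icc (0 : ℝ) 1).norm_image_sub_le_of_norm_hasDerivWithin_le (f := g)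
    (C := A₁ * |(y₁ - x₁) - (y₂ - x₂)| + A₂ * |y₁ - x₁| * (|x₁ - x₂| + |y₁ - y₂|))
    (fun θ _ => ((hp x₁ (y₁ - x₁) θ).sub (hp x₂ (y₂ - x₂) θ)).hasDerivWithinAt)
    (fun θ hθ => by
      set p₁ := x₁ + θ * (y₁ - x₁)
      set p₂ := x₂ + θ * (y₂ - x₂)
      have e : v p₁ * (y₁ - x₁) - v p₂ * (y₂ - x₂)
          = v p₂ * ((y₁ - x₁) - (y₂ - x₂)) + (v p₁ - v p₂) * (y₁ - x₁) := by ring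
      rw [Real.norm_eq_abs, e]
      refine (abs_add_le _ _).trans ?_
      rw [abs_mul, abs_mul]
      have e2 : |p₁ - p₂| ≤ |x₁ - x₂| + |y₁ - y₂| := by
        have : p₁ - p₂ = (1 - θ) * (x₁ - x₂) + θ * (y₁ - y₂) := by simp only [p₁, p₂]; ring
        rw [this]
        refine (abs_add_le _ _).trans ?_
        rw [abs_mul, abs_mul, abs_of_nonneg hθ.1, abs_of_nonneg (sub_nonneg.2 hθ.2)]
        have := mul_le_mul_of_nonneg_right hθ.2 (abs_nonneg (y₁ - y₂))
        have := mul_nonneg hθ.1 (abs_nonneg (x₁ - x₂))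
        linarith
      have e3 : |v p₁ - v p₂| ≤ A₂ * (|x₁ - x₂| + |y₁ - y₂|) :=
        (hV.lip _ _).trans (mul_le_mul_of_nonneg_left e2 hV.A₂_nonneg)
      have e4 := mul_le_mul_of_nonneg_right e3 (abs_nonneg (y₁ - x₁))
      have e5 := mul_le_mul_of_nonneg_right (hV.abs_deriv_le p₂)
        (abs_nonneg ((y₁ - x₁) - (y₂ - x₂)))
      linarith)
    (left_mem_Icc.2 zero_le_one) (right_mem_Icc.2 zero_le_one)
  simp only [hg, one_mul, zero_mul, add_zero, add_sub_cancel, Real.norm_eq_abs, sub_zero,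
    abs_one, mul_one] at h1
  rwa [sub_sub_sub_comm]

end Vel

/-! ### Variation, through translations and through tests of bounded slope -/

/-- Bounded variation, in terms of translations. -/
def ShiftBd (u : ℝ → ℝ) (K : ℝ) : Prop := ∀ h : ℝ, ∫ x, |u (x + h) - u x| ≤ K * |h|

/-- Variation of `u` at length scale `1 / Λ`. -/
def ScaleBd (Λ : ℝ) (u : ℝ → ℝ) (K : ℝ) : Prop :=
  ∀ φ, TestFn φ → (∀ x, |φ x| ≤ 1) → (∀ x, |deriv φ x| ≤ Λ) → ∫ x, u x * deriv φ x ≤ K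

theorem ShiftBd.of_pos {u : ℝ → ℝ} {K : ℝ} (H : ∀ h > 0, ∫ x, |u (x + h) - u x| ≤ K * h) :
    ShiftBd u K := by
  intro h
  rcases lt_trichotomy h 0 with hh | rfl | hh
  · have := H (-h) (by linarith)
    rw [← integral_add_right_eq_self _ h] at this
    simp only [add_neg_cancel_right] at this
    simp_rw [abs_sub_comm (u (_ + h))]
    rwa [abs_of_neg hh]
  · simp
  · rw [abs_of_pos hh]; exact H h hh

theorem ShiftBd.nonneg {u : ℝ → ℝ} {K : ℝ} (h : ShiftBd u K) : 0 ≤ K := by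
  have h1 := h 1
  rw [abs_one, mul_one] at h1
  exact (integral_nonneg fun x => abs_nonneg _).trans h1

theorem ShiftBd.comp_add {u : ℝ → ℝ} {K : ℝ} (h : ShiftBd u K) (η : ℝ) :
    ShiftBd (fun x => u (x + η)) K := fun s => by
  have := h s
  rw [← integral_add_right_eq_self _ η] at this
  refine le_trans (le_of_eq (integral_congr_ae (Eventually.of_forall fun x => ?_))) this
  simp only [add_right_comm x s η]

theorem hasDerivAt_window {φ : ℝ → ℝ} (hφ : Continuous φ) (h x : ℝ) :
    HasDerivAt (fun x => ∫ y in (x - h)..x, φ y) (φ x - φ (x - h)) x := by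
  have hi : ∀ a b, IntervalIntegrable φ volume a b := fun a b => hφ.intervalIntegrable a b
  have h1 : ∀ z, HasDerivAt (fun x => ∫ y in (0 : ℝ)..x, φ y) (φ z) z := fun z =>
    intervalIntegral.integral_hasDerivAt_right (hi _ _)
      (hφ.stronglyMeasurableAtFilter _ _) hφ.continuousAt
  have h2 := (h1 x).sub ((h1 (x - h)).comp_sub_const x h)
  refine h2.congr_of_eventuallyEq (Eventually.of_forall fun z => ?_)
  simp only [Pi.sub_apply]
  rw [intervalIntegral.integral_interval_sub_left (hi _ _) (hi _ _)]

theorem abs_window_le {φ : ℝ → ℝ} {C : ℝ} (hC : ∀ x, |φ x| ≤ C) {h : ℝ} (hh : 0 ≤ h) (x : ℝ) :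
    |∫ y in (x - h)..x, φ y| ≤ C * h := by
  have := intervalIntegral.norm_integral_le_of_norm_le_const (a := x - h) (b := x)
    (f := φ) (C := C) (fun y _ => hC y)
  rwa [Real.norm_eq_abs, sub_sub_cancel, abs_of_nonneg hh] at this

/-- Up to sign, testing `u (· + h) - u` with `φ` is testing `u` with the derivative of the moving
integral of `φ`. This turns bounds on the weak derivative into bounds on differences. -/
theorem testFn_window {φ : ℝ → ℝ} (hφ : ContDiff ℝ 1 φ) (hc : HasCompactSupport φ) {h : ℝ}
    (hh : 0 ≤ h) (c : ℝ) : TestFn (fun x => c * ∫ y in (x - h)..x, φ y) ∧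
      ∀ x, deriv (fun x => c * ∫ y in (x - h)..x, φ y) x = c * (φ x - φ (x - h)) := by
  have hd : ∀ x, HasDerivAt (fun x => c * ∫ y in (x - h)..x, φ y) (c * (φ x - φ (x - h))) x :=
    fun x => (hasDerivAt_window hφ.continuous h x).const_mul c
  have hd' : deriv (fun x => c * ∫ y in (x - h)..x, φ y) = fun x => c * (φ x - φ (x - h)) :=
    funext fun x => (hd x).deriv
  obtain ⟨R, hR, hsupp⟩ := exists_support_bound hc
  obtain ⟨K, hK⟩ := exists_lipschitz_of_contDiff hφ hc
  refine ⟨⟨?_, ?_, |c| * (K + K), fun x y => ?_⟩, fun x => (hd x).deriv⟩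
  · rw [contDiff_one_iff_deriv, hd']
    have := hφ.continuous
    exact ⟨fun x => (hd x).differentiableAt, by fun_prop⟩
  · refine HasCompactSupport.of_support_subset_isCompact
      (isCompact_closedBall (0 : ℝ) (R + h)) fun x hx => ?_
    by_contra hx'
    apply hx
    have hx2 : R + h < |x| := by simpa using hx'
    have : ∫ y in (x - h)..x, φ y = ∫ y in (x - h)..x, 0 :=
      intervalIntegral.integral_congr fun y hy => by
        apply hsupp
        rw [uIcc_of_le (by linarith)] at hy
        have h1 : |x - y| ≤ h := abs_le.2 ⟨by linarith [hy.2], by linarith [hy.1]⟩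
        have h2 := abs_sub_abs_le_abs_sub x y
        linarith
    simp [this]
  · rw [hd', ← mul_sub, abs_mul, mul_assoc]
    refine mul_le_mul_of_nonneg_left ?_ (abs_nonneg _)
    have h1 := hK x y
    have h2 := hK (x - h) (y - h)
    rw [sub_sub_sub_cancel_right] at h2
    calc |φ x - φ (x - h) - (φ y - φ (y - h))|
        = |(φ x - φ y) - (φ (x - h) - φ (y - h))| := by ring_nf
      _ ≤ |φ x - φ y| + |φ (x - h) - φ (y - h)| := abs_sub _ _
      _ ≤ _ := by linarith

theorem integral_shift_mul {u φ : ℝ → ℝ} (hu : Measurable u) {M : ℝ} (hM : ∀ x, |u x| ≤ M)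
    (hφ : Continuous φ) (hc : HasCompactSupport φ) (h : ℝ) :
    ∫ x, (u (x + h) - u x) * φ x = ∫ x, u x * (φ (x - h) - φ x) := by
  obtain ⟨R, hR, hsupp⟩ := exists_support_bound hc
  obtain ⟨C, -, hC⟩ := exists_abs_le hφ hc
  have i1 : Integrable fun x => u x * φ x :=
    integrable_mul_of_bound hu hM hφ.measurable hC hsupp
  have i2 : Integrable fun x => u (x + h) * φ x :=
    integrable_mul_of_bound (hu.comp (measurable_add_const h)) (fun x => hM _) hφ.measurable hC
      hsupp
  have e : ∫ x, u x * φ (x - h) = ∫ x, u (x + h) * φ x := by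
    rw [← integral_add_right_eq_self _ h]
    simp
  have i3 : Integrable fun x => u x * φ (x - h) := by
    have := i2.comp_sub_right h
    simpa using this
  simp_rw [sub_mul, mul_sub]
  rw [integral_sub i2 i1, integral_sub i3 i1, e]

/-- Bounds on finite differences of `f` bound the distributional derivative of `f`. -/
theorem integral_mul_deriv_le_of_shift {f φ : ℝ → ℝ} (hf : Measurable f) {M : ℝ}
    (hM : ∀ x, |f x| ≤ M) (hφ : ContDiff ℝ 1 φ) (hc : HasCompactSupport φ) {B B' : ℝ}
    (H : ∀ h, 0 < h → h ≤ 1 → ∫ x, (f (x - h) - f x) * φ x ≤ h * B + h ^ 2 * B') :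
    ∫ x, f x * deriv φ x ≤ B := by
  obtain ⟨R, hR, hsupp⟩ := exists_support_bound hc
  have hM0 : 0 ≤ M := (abs_nonneg _).trans (hM 0)
  have hdc : Continuous (deriv φ) := hφ.continuous_deriv le_rfl
  have hds : ∀ x, R < |x| → deriv φ x = 0 := fun x => deriv_eq_zero_of_bound hsupp
  obtain ⟨C, -, hC⟩ := exists_abs_le hφ.continuous hc
  obtain ⟨C', -, hC'⟩ := exists_abs_le hdc hc.deriv
  have key : ∀ ε > 0, ∫ x, f x * deriv φ x ≤ B + ε * (|B'| + 2 * (R + 1) * M) := fun ε hε => by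
    -- As `φ` is only `C¹`, its first-order expansion has no rate; uniform continuity of `φ'` still
    -- makes the error at most `ε h`.
    obtain ⟨δ, hδ, hδ'⟩ := Metric.uniformContinuous_iff.1
      (hc.deriv.uniformContinuous_of_continuous hdc) ε hε
    obtain ⟨h, hh0, hhδ, hh1, hhε⟩ : ∃ h > 0, h < δ ∧ h ≤ 1 ∧ h ≤ ε :=
      ⟨min (δ / 2) (min 1 ε), by positivity, by
        refine (min_le_left _ _).trans_lt (by linarith),
        (min_le_right _ _).trans (min_le_left _ _), (min_le_right _ _).trans (min_le_right _ _)⟩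
    have herr : ∀ x, |φ (x + h) - φ x - h * deriv φ x| ≤ ε * h := fun x => by
      have h1 : ∀ y ∈ Icc x (x + h), HasDerivWithinAt (fun y => φ y - (y - x) * deriv φ x)
          (deriv φ y - deriv φ x) (Icc x (x + h)) y := fun y _ => by
        have h2 := ((hφ.differentiable one_ne_zero y).hasDerivAt).sub
          (((hasDerivAt_id y).sub_const x).mul_const (deriv φ x))
        simp only [id, one_mul] at h2
        exact h2.hasDerivWithinAt
      have h2 := (convex_Icc x (x + h)).norm_image_sub_le_of_norm_hasDerivWithin_le
        (C := ε) h1 (fun y hy => by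
          have := hδ' (a := y) (b := x) (by
            rw [Real.dist_eq, abs_of_nonneg (by linarith [hy.1])]; linarith [hy.2])
          exact this.le) (left_mem_Icc.2 (by linarith)) (right_mem_Icc.2 (by linarith))
      simp only [Real.norm_eq_abs, sub_self, zero_mul, sub_zero, add_sub_cancel_left,
        abs_of_pos hh0] at h2
      calc |φ (x + h) - φ x - h * deriv φ x| = |φ (x + h) - h * deriv φ x - φ x| := by ring_nf
        _ ≤ _ := h2
    have hsupp' : ∀ x, R + 1 < |x| → φ (x + h) = 0 := fun x hx => hsupp _ (by
      have := abs_sub_abs_le_abs_sub x (-h)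
      rw [sub_neg_eq_add, abs_neg, abs_of_pos hh0] at this
      linarith)
    have i1 : Integrable fun x => f x * φ x :=
      integrable_mul_of_bound hf hM hφ.continuous.measurable hC hsupp
    have i2 : Integrable fun x => f x * φ (x + h) :=
      integrable_mul_of_bound hf hM (hφ.continuous.measurable.comp (measurable_add_const h))
        (fun x => hC _) hsupp'
    have i3 : Integrable fun x => f x * deriv φ x :=
      integrable_mul_of_bound hf hM hdc.measurable hC' hds
    have e1 := abs_integral_mul_le' hf hM (χ := fun x => φ (x + h) - φ x - h * deriv φ x)
      (C := ε * h) (R := R + 1) (by linarith) herr (fun x hx => by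
        rw [hsupp' x hx, hsupp x (by linarith), hds x (by linarith)]; ring)
    have e2 : ∫ x, f x * (φ (x + h) - φ x - h * deriv φ x)
        = (∫ x, f x * (φ (x + h) - φ x)) - h * ∫ x, f x * deriv φ x := by
      rw [← integral_const_mul, ← integral_sub _ (i3.const_mul h)]
      · refine integral_congr_ae (Eventually.of_forall fun x => ?_)
        ring
      · simp_rw [mul_sub]; exact i2.sub i1
    have e3 := integral_shift_mul hf hM hφ.continuous hc (-h)
    simp only [← sub_eq_add_neg, sub_neg_eq_add] at e3
    have e4 := H h hh0 hh1
    rw [e3] at e4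
    rw [e2] at e1
    have e5 := neg_le_of_abs_le e1
    have e6 : h * ∫ x, f x * deriv φ x
        ≤ h * (B + h * B' + 2 * (R + 1) * M * ε) := by nlinarith
    have e7 := le_of_mul_le_mul_left e6 hh0
    have e8 : h * B' ≤ ε * |B'| :=
      (mul_le_mul_of_nonneg_left (le_abs_self _) hh0.le).trans
        (mul_le_mul_of_nonneg_right hhε (abs_nonneg _))
    linarith
  refine le_of_forall_pos_le_add fun ε hε => ?_
  have h0 : 0 ≤ |B'| + 2 * (R + 1) * M := by positivity
  refine (key (ε / (|B'| + 2 * (R + 1) * M + 1)) (by positivity)).trans ?_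
  rw [add_le_add_iff_left, div_mul_eq_mul_div, div_le_iff₀ (by positivity)]
  nlinarith

theorem abs_sub_le_two_mul {u : ℝ → ℝ} {M : ℝ} (hM : ∀ x, |u x| ≤ M) (x y : ℝ) :
    |u x - u y| ≤ 2 * M := (abs_sub _ _).trans (by linarith [hM x, hM y])

theorem ShiftBd.integral_mul_deriv_le {u φ : ℝ → ℝ} {K : ℝ} (h : ShiftBd u K) (hu : Measurable u)
    {M : ℝ} (hM : ∀ x, |u x| ≤ M) (hφ : ContDiff ℝ 1 φ) (hc : HasCompactSupport φ)
    (hi : Integrable u) (hφ1 : ∀ x, |φ x| ≤ 1) : ∫ x, u x * deriv φ x ≤ K := by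
  refine integral_mul_deriv_le_of_shift hu hM hφ hc (B' := 0) fun s hs _ => ?_
  have h1 := h (-s)
  simp only [← sub_eq_add_neg, abs_neg, abs_of_pos hs] at h1
  have i1 : Integrable fun x => |u (x - s) - u x| := ((hi.comp_sub_right s).sub hi).abs
  have h2 : ∫ x, (u (x - s) - u x) * φ x ≤ ∫ x, |u (x - s) - u x| := by
    refine (Real.le_norm_self _).trans (norm_integral_le_of_norm_le i1
      (Eventually.of_forall fun x => ?_))
    rw [Real.norm_eq_abs, abs_mul]
    exact mul_le_of_le_one_right (abs_nonneg _) (hφ1 x)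
  linarith

theorem ShiftBd.totalVariation_le {u : ℝ → ℝ} {K : ℝ} (h : ShiftBd u K) (hu : Measurable u)
    {M : ℝ} (hM : ∀ x, |u x| ≤ M) (hi : Integrable u) :
    totalVariation u ≤ ENNReal.ofReal K :=
  iSup₂_le fun _ hφ => ENNReal.ofReal_le_ofReal
    (h.integral_mul_deriv_le hu hM hφ.1 hφ.2.1 hi hφ.2.2)

theorem scaleBd_of_totalVariation_le {u : ℝ → ℝ} {K : ℝ} (hK : 0 ≤ K)
    (h : totalVariation u ≤ ENNReal.ofReal K) (Λ : ℝ) : ScaleBd Λ u K := fun φ hφ hφ1 _ => by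
  have h1 : ENNReal.ofReal (∫ x, u x * deriv φ x) ≤ totalVariation u :=
    le_iSup₂_of_le φ ⟨hφ.contDiff, hφ.hasCompactSupport, hφ1⟩ le_rfl
  exact (ENNReal.ofReal_le_ofReal_iff hK).1 (h1.trans h)

theorem integral_shift_eq_window {u φ : ℝ → ℝ} (hu : Measurable u) {M : ℝ} (hM : ∀ x, |u x| ≤ M)
    (hφ : ContDiff ℝ 1 φ) (hc : HasCompactSupport φ) {h : ℝ} (hh : 0 ≤ h) {c : ℝ} :
    c * ∫ x, (u (x + h) - u x) * φ x
      = ∫ x, u x * deriv (fun x => (-c) * ∫ y in (x - h)..x, φ y) x := by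
  rw [integral_shift_mul hu hM hφ.continuous hc, ← integral_const_mul]
  congr 1; ext x
  rw [(testFn_window hφ hc hh (-c)).2 x]; ring

/-- For a shift `s`, the moving integral divided by `s` is bounded by `1` with derivative at most `2
/ s`. The slope needed grows as `s` shrinks, which is why the hypothesis covers all `Λ`. -/
theorem ScaleBd.shiftBd {u : ℝ → ℝ} {K : ℝ} (h : ∀ Λ, ScaleBd Λ u K) (hu : Measurable u)
    {M : ℝ} (hM : ∀ x, |u x| ≤ M) : ShiftBd u K := by
  refine ShiftBd.of_pos fun s hs => (integrable_abs_of_smooth (M := 2 * M)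
    ((hu.comp (measurable_add_const s)).sub hu)
    (fun x => abs_sub_le_two_mul hM _ _) fun φ h1 h2 h3 => ?_).2
  have h1' : ContDiff ℝ 1 φ := h1.of_le (by exact_mod_cast le_top)
  have e := integral_shift_eq_window hu hM h1' h2 hs.le (c := 1 / s)
  obtain ⟨t1, t2⟩ := testFn_window h1' h2 hs.le (-(1 / s))
  have := h (1 / s * 2) _ t1 (fun x => ?_) (fun x => ?_)
  · rw [← e, one_div, ← div_eq_inv_mul, div_le_iff₀ hs] at this
    exact this
  · rw [abs_mul, abs_neg, abs_of_pos (by positivity), one_div, ← div_eq_inv_mul,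
      div_le_one hs]
    simpa using abs_window_le h3 hs.le x
  · rw [t2, abs_mul, abs_neg, abs_of_pos (by positivity)]
    gcongr
    simpa using abs_sub_le_two_mul h3 x (x - s)

/-- For shifts up to `1 / Λ`, the moving integral times `Λ / 2` is bounded by `1 / 2` and has
derivative at most `Λ`, so it is an admissible test. -/
theorem ScaleBd.integral_shift_le {u : ℝ → ℝ} {K Λ θ : ℝ} (h : ScaleBd Λ u K) (hu : Measurable u)
    {M : ℝ} (hM : ∀ x, |u x| ≤ M) (hΛ : 0 < Λ) (hθ : 0 ≤ θ) (hθΛ : θ * Λ ≤ 1) :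
    ∫ x, |u (x + θ) - u x| ≤ 2 * K / Λ := by
  refine (integrable_abs_of_smooth (M := 2 * M)
    ((hu.comp (measurable_add_const θ)).sub hu)
    (fun x => abs_sub_le_two_mul hM _ _) fun φ h1 h2 h3 => ?_).2
  have h1' : ContDiff ℝ 1 φ := h1.of_le (by exact_mod_cast le_top)
  have e := integral_shift_eq_window hu hM h1' h2 hθ (c := Λ / 2)
  obtain ⟨t1, t2⟩ := testFn_window h1' h2 hθ (-(Λ / 2))
  have := h _ t1 (fun x => ?_) (fun x => ?_)
  · rw [← e] at this
    rw [le_div_iff₀ hΛ]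
    simp only [Pi.sub_apply, Function.comp_apply]
    linarith
  · rw [abs_mul, abs_neg, abs_of_pos (by positivity)]
    have := mul_le_mul_of_nonneg_left (abs_window_le h3 hθ x) (show 0 ≤ Λ / 2 by positivity)
    linarith
  · rw [t2, abs_mul, abs_neg, abs_of_pos (by positivity)]
    have := mul_le_mul_of_nonneg_left (abs_sub_le_two_mul h3 x (x - θ))
      (show 0 ≤ Λ / 2 by positivity)
    linarith

/-- A test with slope at most `Λ c` becomes admissible for `Λ` after division by `c ≥ 1`. This pays
for the growth of slopes under transport. -/
theorem ScaleBd.scale {u : ℝ → ℝ} {K Λ c : ℝ} (h : ScaleBd Λ u K) (hc : 1 ≤ c) :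
    ScaleBd (Λ * c) u (K * c) := fun φ hφ h1 h2 => by
  have hc0 : 0 < c := by linarith
  have hd : ∀ x, deriv (fun x => c⁻¹ * φ x) x = c⁻¹ * deriv φ x := fun x =>
    ((hφ.hasDerivAt x).const_mul _).deriv
  have hd' : deriv (fun x => c⁻¹ * φ x) = fun x => c⁻¹ * deriv φ x := funext hd
  have ht : TestFn (fun x => c⁻¹ * φ x) := by
    refine ⟨contDiff_const.mul hφ.contDiff, hφ.hasCompactSupport.mul_left, ?_⟩
    obtain ⟨K, hK⟩ := hφ.lipschitz_deriv
    refine ⟨c⁻¹ * K, fun x y => ?_⟩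
    rw [hd, hd, ← mul_sub, abs_mul, abs_of_pos (inv_pos.2 hc0), mul_assoc]
    exact mul_le_mul_of_nonneg_left (hK x y) (inv_pos.2 hc0).le
  have := h _ ht (fun x => ?_) (fun x => ?_)
  · simp_rw [hd, mul_left_comm _ c⁻¹] at this
    rw [integral_const_mul, ← div_eq_inv_mul, div_le_iff₀ hc0] at this
    exact this
  · rw [abs_mul, abs_of_pos (inv_pos.2 hc0)]
    exact mul_le_one₀ (inv_le_one_of_one_le₀ hc) (abs_nonneg _) (h1 x)
  · rw [hd, abs_mul, abs_of_pos (inv_pos.2 hc0), ← div_eq_inv_mul, div_le_iff₀ hc0]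
    exact h2 x

/-! ### Averages of translates and Steklov means -/

/-- Distance of an average of translates to the function itself. -/
theorem integral_abs_corr_sub_self_le {κ f : ℝ → ℝ} (hκ : Integrable κ) (h0 : ∀ z, 0 ≤ κ z)
    (hf : Integrable f) {D : ℝ} (hD : ∀ z, κ z ≠ 0 → ∫ x, |f (x + z) - f x| ≤ D) :
    ∫ x, |corr κ f x - (∫ z, κ z) * f x| ≤ (∫ z, κ z) * D := by
  have h1 := integrable_corr_prod hκ hf
  have h2 : Integrable (fun p : ℝ × ℝ => κ p.2 * f p.1) (volume.prod volume) := by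
    have := (hf.mul_prod hκ)
    simpa [mul_comm] using this
  have h3 := (h1.sub h2).abs
  have e1 : ∫ x, |corr κ f x - (∫ z, κ z) * f x|
      ≤ ∫ x, ∫ z, |κ z * f (x + z) - κ z * f x| := by
    have i1 : Integrable fun x => |corr κ f x - (∫ z, κ z) * f x| :=
      ((integrable_corr hκ hf).sub (hf.const_mul _)).abs
    refine integral_mono_ae i1 h3.integral_prod_left ?_
    filter_upwards [h1.prod_right_ae] with x hx
    rw [corr, ← integral_mul_const, ← integral_sub hx (hκ.mul_const _)]
    exact abs_integral_le_integral_abs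
  refine e1.trans ?_
  rw [integral_integral_swap h3, ← integral_mul_const]
  refine integral_mono h3.integral_prod_right (hκ.mul_const D) fun z => ?_
  simp only [← mul_sub, abs_mul, abs_of_nonneg (h0 z)]
  rw [integral_const_mul]
  by_cases hz : κ z = 0
  · simp [hz]
  · exact mul_le_mul_of_nonneg_left (hD z hz) (h0 z)

/-- Steklov averages as correlations. -/
def stekKern (δ z : ℝ) : ℝ := (Ioc 0 δ).indicator (fun _ => δ⁻¹) z

theorem measurable_stekKern (δ : ℝ) : Measurable (stekKern δ) :=
  measurable_const.indicator measurableSet_Ioc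

theorem integrable_stekKern (δ : ℝ) : Integrable (stekKern δ) := by
  have : Integrable ((Ioc 0 δ).indicator fun _ : ℝ => δ⁻¹) := by
    rw [integrable_indicator_iff measurableSet_Ioc]; exact integrableOn_const (by simp)
  exact this

theorem stekKern_nonneg {δ : ℝ} (hδ : 0 < δ) (z : ℝ) : 0 ≤ stekKern δ z :=
  indicator_nonneg (fun _ _ => (inv_pos.2 hδ).le) _

theorem integral_stekKern {δ : ℝ} (hδ : 0 < δ) : ∫ z, stekKern δ z = 1 := by
  have : ∫ z, stekKern δ z = ∫ z, (Ioc 0 δ).indicator (fun _ => δ⁻¹) z := rfl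
  rw [this, integral_indicator measurableSet_Ioc, setIntegral_const, smul_eq_mul, Measure.real,
    Real.volume_Ioc, ENNReal.toReal_ofReal (by linarith), sub_zero, mul_inv_cancel₀ hδ.ne']

theorem corr_stekKern {δ : ℝ} (hδ : 0 < δ) (f : ℝ → ℝ) (x : ℝ) :
    corr (stekKern δ) f x = δ⁻¹ * ∫ y in x..(x + δ), f y := by
  have h1 : ∀ z, stekKern δ z * f (x + z) = (Ioc 0 δ).indicator (fun z => δ⁻¹ * f (x + z)) z :=
    fun z => by unfold stekKern; by_cases hz : z ∈ Ioc 0 δ <;> simp [hz]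
  rw [corr]
  simp_rw [h1]
  rw [integral_indicator measurableSet_Ioc, ← intervalIntegral.integral_of_le hδ.le,
    intervalIntegral.integral_const_mul, intervalIntegral.integral_comp_add_left]
  simp

theorem intervalIntegrable_of_bdd {f : ℝ → ℝ} (hf : Measurable f) {M : ℝ}
    (hM : ∀ x, |f x| ≤ M) (a b : ℝ) : IntervalIntegrable f volume a b := by
  have hc : IntervalIntegrable (fun _ : ℝ => M) volume a b := intervalIntegrable_const
  refine hc.mono_fun hf.aestronglyMeasurable (Eventually.of_forall fun x => ?_)
  exact (hM x).trans (le_abs_self _)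

/-- Both sides are the second difference with steps `h` and `δ` of a primitive of `f`, divided by
`δ`, so the roles of `h` and `δ` may be exchanged. A control of `f` at the shift `δ` alone then
controls all shifts of its Steklov mean. -/
theorem corr_stekKern_sub {δ h : ℝ} (hδ : 0 < δ) (hh : 0 < h) {f : ℝ → ℝ} (hf : Measurable f)
    {M : ℝ} (hM : ∀ x, |f x| ≤ M) (x : ℝ) :
    corr (stekKern δ) f (x + h) - corr (stekKern δ) f x
      = h / δ * corr (stekKern h) (fun y => f (y + δ) - f y) x := by
  have hi : ∀ a b, IntervalIntegrable f volume a b := intervalIntegrable_of_bdd hf hM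
  have hi' : ∀ a b, IntervalIntegrable (fun y => f (y + δ)) volume a b :=
    intervalIntegrable_of_bdd (hf.comp (measurable_add_const δ)) fun y => hM _
  rw [corr_stekKern hδ, corr_stekKern hδ, corr_stekKern hh, intervalIntegral.integral_sub
    (hi' _ _) (hi _ _), intervalIntegral.integral_comp_add_right]
  have e1 := intervalIntegral.integral_add_adjacent_intervals (hi x (x + h)) (hi (x + h) (x + h + δ))
  have e2 := intervalIntegral.integral_add_adjacent_intervals (hi x (x + δ)) (hi (x + δ) (x + h + δ))
  field_simp
  linarith

/-! ### Source terms at a fixed time -/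

theorem mul_le_of_abs_le {X Y c : ℝ} (hX : |X| ≤ Y) (hc : |c| ≤ 1) : X * c ≤ Y := by
  refine (le_abs_self _).trans ?_
  rw [abs_mul]
  exact (mul_le_of_le_one_right (abs_nonneg _) hc).trans hX

theorem Kern.corr_mem_Icc {CΓ m : ℝ} {k f : ℝ → ℝ} (hk : Kern CΓ k)
    (hm : ∀ x, 0 ≤ f x ∧ f x ≤ m) (x : ℝ) : corr k f x ∈ Icc 0 m := by
  have hm' : ∀ x, |f x| ≤ m := fun x => by rw [abs_of_nonneg (hm x).1]; exact (hm x).2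
  have h1 := (le_abs_self _).trans (abs_corr_le hk.integrable hm' x)
  rw [hk.integral_abs, one_mul] at h1
  exact ⟨integral_nonneg fun z => mul_nonneg (hk.nonneg z) (hm _).1, h1⟩

theorem measurable_vel_corr {A₁ A₂ CΓ : ℝ} {V v k f : ℝ → ℝ} (hV : Vel A₁ A₂ V v)
    (hk : Kern CΓ k) (hf : Measurable f) : Measurable fun x => V (corr k f x) :=
  hV.continuous.measurable.comp (measurable_corr hk.measurable hf)

/-- The pointwise estimate behind `stability_source_le`. -/
theorem stability_pointwise {A₁ A₂ A₁' A₂' N₀ N₁ m D c g h : ℝ} {V v V' v' : ℝ → ℝ}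
    (hV : Vel A₁ A₂ V v) (hV' : Vel A₁' A₂' V' v')
    (hN₀ : ∀ s ∈ Icc 0 m, |V s - V' s| ≤ N₀) (hN₁ : ∀ s ∈ Icc 0 m, |v s - v' s| ≤ N₁)
    {W W' Wh Wh' q qh r p n e φ : ℝ} (hW' : W' ∈ Icc 0 m) (hWh' : Wh' ∈ Icc 0 m)
    (hDh : |Wh - Wh'| ≤ D) (hq : 0 ≤ q ∧ q ≤ m)
    (hc : |Wh - W| ≤ c) (hc' : |Wh' - W'| ≤ c) (hΔ : (Wh - W) - (Wh' - W') = e + (p - n))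
    (hφ : |φ| ≤ 1) (hg : 0 ≤ g) (hgh : g ≤ h) :
    ((V Wh - V' Wh') * qh - (V W - V' W') * q) * φ ≤
      (N₀ + A₁ * D) * |qh - q| + (A₂ + A₂') * c ^ 2 * q + c * (A₂ * (q * |W - W'|) + N₁ * q)
        + A₁' * m * |e| + A₁' * m * |n| + A₁' * m * |p - g * r|
        + h * (A₁' * m) * |r| - h * (A₁' * m) * (r * φ) := by
  have hm0 : 0 ≤ m := hq.1.trans hq.2
  have hA₁' := hV'.A₁_nonneg
  have hA₂ := hV.A₂_nonneg
  have hA₂' := hV'.A₂_nonneg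
  have hc0 : 0 ≤ c := (abs_nonneg _).trans hc
  have hb : |V Wh - V' Wh'| ≤ N₀ + A₁ * D := by
    have h1 := hV.abs_sub_le Wh Wh'
    have h2 := hN₀ Wh' hWh'
    have h3 := mul_le_mul_of_nonneg_left hDh hV.A₁_nonneg
    calc |V Wh - V' Wh'| = |(V Wh - V Wh') + (V Wh' - V' Wh')| := by ring_nf
      _ ≤ |V Wh - V Wh'| + |V Wh' - V' Wh'| := abs_add_le _ _
      _ ≤ _ := by linarith
  -- Discrete product rule: `t1` is the increment of `q`, `t2` and `t3` are Taylor remainders, `t4`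
  -- is the difference of the slopes. What remains is `v' W'` times `q` times the increment of `W -
  -- W'`, split by `hΔ`.
  have t1 : (V Wh - V' Wh') * (qh - q) * φ ≤ (N₀ + A₁ * D) * |qh - q| :=
    mul_le_of_abs_le (by rw [abs_mul]; gcongr) hφ
  have hcsq : ∀ y : ℝ, |y| ≤ c → y ^ 2 ≤ c ^ 2 := fun y hy => by
    rw [← sq_abs]; exact pow_le_pow_left₀ (abs_nonneg _) hy 2
  have t2 : (V Wh - V W - v W * (Wh - W)) * q * φ ≤ A₂ * c ^ 2 * q := by
    refine mul_le_of_abs_le ?_ hφ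
    rw [abs_mul, abs_of_nonneg hq.1]
    refine mul_le_mul_of_nonneg_right ((hV.abs_taylor_le W Wh).trans ?_) hq.1
    exact mul_le_mul_of_nonneg_left (hcsq _ hc) hA₂
  have t3 : -(V' Wh' - V' W' - v' W' * (Wh' - W')) * q * φ ≤ A₂' * c ^ 2 * q := by
    refine mul_le_of_abs_le ?_ hφ
    rw [abs_mul, abs_of_nonneg hq.1, abs_neg]
    refine mul_le_mul_of_nonneg_right ((hV'.abs_taylor_le W' Wh').trans ?_) hq.1
    exact mul_le_mul_of_nonneg_left (hcsq _ hc') hA₂'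
  have hvv : |v W - v' W'| ≤ A₂ * |W - W'| + N₁ := by
    have h1 := hV.lip W W'
    have h2 := hN₁ W' hW'
    calc |v W - v' W'| = |(v W - v W') + (v W' - v' W')| := by ring_nf
      _ ≤ |v W - v W'| + |v W' - v' W'| := abs_add_le _ _
      _ ≤ _ := by linarith
  have t4 : (v W - v' W') * (Wh - W) * q * φ ≤ c * (A₂ * (q * |W - W'|) + N₁ * q) := by
    refine mul_le_of_abs_le ?_ hφ
    rw [abs_mul, abs_mul, abs_of_nonneg hq.1]
    calc |v W - v' W'| * |Wh - W| * q ≤ (A₂ * |W - W'| + N₁) * c * q := by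
          have := hq.1
          have := (abs_nonneg _).trans hvv
          gcongr
      _ = _ := by ring
  -- The monotonicity of the velocity and the sign of `q` enter here.
  set ee := -(v' W') * q with hee
  have hee0 : 0 ≤ ee := mul_nonneg (by linarith [hV'.nonpos W']) hq.1
  have hee1 : ee ≤ A₁' * m :=
    mul_le_mul (by linarith [hV'.lower W']) hq.2 hq.1 hA₁'
  have heX : ∀ X : ℝ, -ee * X * φ ≤ A₁' * m * |X| := fun X => by
    refine mul_le_of_abs_le ?_ hφ
    rw [abs_mul, abs_neg, abs_of_nonneg hee0]
    exact mul_le_mul_of_nonneg_right hee1 (abs_nonneg _)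
  have t5 := heX e
  have t6 := heX (-n)
  have t7 := heX (p - g * r)
  rw [abs_neg] at t6
  -- The local part is `-ee g r φ`. Adding `h A₁' m r φ` makes the coefficient nonnegative and at
  -- most `h A₁' m`, so the sum costs `|r|` once. The added term is subtracted again with its sign
  -- kept, as damping.
  have t8 : (h * (A₁' * m) - ee * g) * r * φ ≤ h * (A₁' * m) * |r| := by
    refine mul_le_of_abs_le ?_ hφ
    rw [abs_mul]
    refine mul_le_mul_of_nonneg_right ?_ (abs_nonneg _)
    have h1 : ee * g ≤ A₁' * m * h := mul_le_mul hee1 hgh hg (by positivity)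
    rw [abs_of_nonneg (by linarith)]
    have := mul_nonneg hee0 hg
    linarith
  have id : ((V Wh - V' Wh') * qh - (V W - V' W') * q) * φ
      = (V Wh - V' Wh') * (qh - q) * φ + (V Wh - V W - v W * (Wh - W)) * q * φ
        + -(V' Wh' - V' W' - v' W' * (Wh' - W')) * q * φ + (v W - v' W') * (Wh - W) * q * φ
        + (v' W' * q) * ((Wh - W) - (Wh' - W')) * φ := by ring
  have id2 : (v' W' * q) * (e + (p - n)) * φ
      = -ee * e * φ + -ee * (-n) * φ + -ee * (p - g * r) * φ
        + (h * (A₁' * m) - ee * g) * r * φ - h * (A₁' * m) * (r * φ) := by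
    rw [hee]; ring
  rw [id, hΔ, id2]
  linarith

/-- Main stability estimate at a fixed time: the difference of the fluxes, tested with `φ'`. -/
theorem stability_source_le {A₁ A₂ A₁' A₂' N₀ N₁ m CΓ D D₁ G C₁ τ τ' : ℝ}
    {V v V' v' k k' q q' : ℝ → ℝ}
    (hV : Vel A₁ A₂ V v) (hV' : Vel A₁' A₂' V' v') (hk : Kern CΓ k) (hk' : Kern CΓ k')
    (hN₀ : ∀ s ∈ Icc 0 m, |V s - V' s| ≤ N₀) (hN₁ : ∀ s ∈ Icc 0 m, |v s - v' s| ≤ N₁)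
    (hq : Measurable q) (hq' : Measurable q') (hqm : ∀ x, 0 ≤ q x ∧ q x ≤ m)
    (hqm' : ∀ x, 0 ≤ q' x ∧ q' x ≤ m) (hqi : Integrable q) (hqi' : Integrable q')
    (hτ : ShiftBd q τ) (hτ' : ShiftBd q' τ')
    (hD : ∀ x, |corr k q x - corr k' q' x| ≤ D)
    (hD₁ : ∫ x, q x * |corr k q x - corr k' q' x| ≤ D₁)
    (hG : ∫ z, |k z - k' z| ≤ G) (hC₁ : ∫ x, q x ≤ C₁)
    {φ : ℝ → ℝ} (hφ : TestFn φ) (hφ1 : ∀ x, |φ x| ≤ 1) :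
    ∫ x, (V (corr k q x) - V' (corr k' q' x)) * q x * deriv φ x ≤
      (N₀ + A₁ * D) * τ + m * CΓ * (A₂ * D₁ + N₁ * C₁) + A₁' * m * G * τ
        + 2 * (A₁' * m * CΓ) * (∫ x, |q x - q' x|)
        - A₁' * m * CΓ * ∫ x, (q x - q' x) * φ x := by
  have hm0 : 0 ≤ m := (hqm 0).1.trans (hqm 0).2
  have hA₁' := hV'.A₁_nonneg
  have hA₁ := hV.A₁_nonneg
  have hA₂ := hV.A₂_nonneg
  have hA₂' := hV'.A₂_nonneg
  have hCΓ := hk.bound_nonneg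
  have hN₀0 : 0 ≤ N₀ := (abs_nonneg _).trans (hN₀ 0 ⟨le_rfl, hm0⟩)
  have hN₁0 : 0 ≤ N₁ := (abs_nonneg _).trans (hN₁ 0 ⟨le_rfl, hm0⟩)
  have hD0 : 0 ≤ D := (abs_nonneg _).trans (hD 0)
  have habs : ∀ x, |q x| ≤ m := fun x => by rw [abs_of_nonneg (hqm x).1]; exact (hqm x).2
  have habs' : ∀ x, |q' x| ≤ m := fun x => by rw [abs_of_nonneg (hqm' x).1]; exact (hqm' x).2
  have hkk : Integrable fun z => k z - k' z := hk.integrable.sub hk'.integrable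
  set r : ℝ → ℝ := fun x => q x - q' x with hr
  have hrm : Measurable r := hq.sub hq'
  have hri : Integrable r := hqi.sub hqi'
  have hrb : ∀ x, |r x| ≤ m + m := fun x => (abs_sub _ _).trans (add_le_add (habs x) (habs' x))
  set W := corr k q with hWdef
  set W' := corr k' q' with hWdef'
  have hWm := measurable_corr hk.measurable hq
  have hWm' := measurable_corr hk'.measurable hq'
  have hWI : ∀ x, W x ∈ Icc 0 m := hk.corr_mem_Icc hqm
  have hWI' : ∀ x, W' x ∈ Icc 0 m := hk'.corr_mem_Icc hqm'
  set b : ℝ → ℝ := fun x => V (W x) - V' (W' x) with hb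
  have hbm : Measurable b := (measurable_vel_corr hV hk hq).sub (measurable_vel_corr hV' hk' hq')
  have hbb : ∀ x, |b x| ≤ N₀ + A₁ * D := fun x => by
    have h1 := hV.abs_sub_le (W x) (W' x)
    have h2 := hN₀ _ (hWI' x)
    have h3 := mul_le_mul_of_nonneg_left (hD x) hV.A₁_nonneg
    calc |b x| = |(V (W x) - V (W' x)) + (V (W' x) - V' (W' x))| := by rw [hb]; ring_nf
      _ ≤ |V (W x) - V (W' x)| + |V (W' x) - V' (W' x)| := abs_add_le _ _
      _ ≤ _ := by linarith
  have hfb : ∀ x, |b x * q x| ≤ (N₀ + A₁ * D) * m := fun x => by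
    rw [abs_mul]; exact mul_le_mul (hbb x) (habs x) (abs_nonneg _) (by positivity)
  obtain ⟨Rφ, hRφ, hsupp⟩ := exists_support_bound hφ.hasCompactSupport
  have iφ : Integrable fun x => r x * φ x :=
    integrable_mul_of_bound hrm hrb hφ.continuous.measurable hφ1 hsupp
  -- `B'` collects what is of order `h²`: the Taylor remainders and the replacement of `P` by `g r`.
  -- It disappears in the limit, and with it the variation `τ'` of the second solution.
  refine integral_mul_deriv_le_of_shift (f := fun x => b x * q x) (hbm.mul hq) hfb hφ.contDiff
    hφ.hasCompactSupport (B' := (A₂ + A₂') * (m * CΓ) ^ 2 * C₁ + A₁' * m * CΓ * (τ + τ'))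
    fun h hh _ => ?_
  set g := ∫ z, posKern k' h z with hg
  have hg0 : 0 ≤ g := integral_nonneg (hk'.posKern_nonneg h)
  have hgh : g ≤ h * CΓ := hk'.integral_posKern_le hh.le
  set E : ℝ → ℝ := corr (fun z => k z - k' z) (fun y => q (y + -h) - q y) with hE
  set P := corr (posKern k' h) r with hP
  set Nn := corr (negKern k' h) r with hNn
  -- `E` carries the difference of the kernels and acts on the increment of `q`. `P - Nn` carries
  -- `r`, with the shift moved onto the kernel `k'`.
  have hΔ : ∀ x, (W (x - h) - W x) - (W' (x - h) - W' x) = E x + (P x - Nn x) := fun x => by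
    rw [hP, hNn, ← hk'.corr_sub_eq hrm hrb, hE, hr,
      corr_sub_right hk'.integrable hq hq' habs habs', corr_sub_right hk'.integrable hq hq'
      habs habs',
      corr_sub_right (f := fun y => q (y + -h)) hkk
        (hq.comp (measurable_add_const _)) hq (fun y => habs _) habs, corr_comp_add,
      corr_sub_left hk.integrable hk'.integrable hq habs,
      corr_sub_left hk.integrable hk'.integrable hq habs, ← sub_eq_add_neg, hWdef, hWdef']
    ring
  have hc : ∀ x, |W (x - h) - W x| ≤ m * CΓ * h := fun x => by
    simpa [abs_of_pos hh] using hk.abs_corr_sub_le hq hqm (x - h) x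
  have hc' : ∀ x, |W' (x - h) - W' x| ≤ m * CΓ * h := fun x => by
    simpa [abs_of_pos hh] using hk'.abs_corr_sub_le hq' hqm' (x - h) x
  have hpt : ∀ x, (b (x - h) * q (x - h) - b x * q x) * φ x ≤
      (N₀ + A₁ * D) * |q (x - h) - q x| + (A₂ + A₂') * (m * CΓ * h) ^ 2 * q x
        + (m * CΓ * h) * (A₂ * (q x * |W x - W' x|) + N₁ * q x)
        + A₁' * m * |E x| + A₁' * m * |Nn x| + A₁' * m * |P x - g * r x|
        + h * CΓ * (A₁' * m) * |r x| - h * CΓ * (A₁' * m) * (r x * φ x) := fun x =>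
    stability_pointwise hV hV' hN₀ hN₁ (hWI' x) (hWI' _) (hD _) (hqm x) (hc x) (hc' x) (hΔ x)
      (hφ1 x) hg0 hgh
  -- integrability
  have iq : Integrable fun x => q (x + -h) - q x := (hqi.comp_add_right (-h)).sub hqi
  have i1 : Integrable fun x => |q (x - h) - q x| := ((hqi.comp_sub_right h).sub hqi).abs
  have i2 : Integrable fun x => q x * |W x - W' x| :=
    hqi.mul_bdd (c := D) (hWm.sub hWm').abs.aestronglyMeasurable
      (Eventually.of_forall fun x => by simpa using hD x)
  have i3 : Integrable fun x => |E x| :=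
    (integrable_corr hkk iq).abs
  have i4 : Integrable fun x => |Nn x| := (integrable_corr (hk'.integrable_negKern h) hri).abs
  have i5 : Integrable fun x => |P x - g * r x| :=
    ((integrable_corr (hk'.integrable_posKern h) hri).sub (hri.const_mul g)).abs
  -- bounds of the integrals
  have b1 : ∫ x, |q (x - h) - q x| ≤ τ * h := by
    have := hτ (-h)
    simpa [← sub_eq_add_neg, abs_of_pos hh] using this
  have b3 : ∫ x, |E x| ≤ G * (τ * h) := by
    refine (integral_abs_corr_le hkk iq).trans ?_
    have h1 := hτ (-h)
    rw [abs_neg, abs_of_pos hh] at h1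
    exact mul_le_mul hG h1 (integral_nonneg fun x => abs_nonneg _)
      ((integral_nonneg fun x => abs_nonneg _).trans hG)
  have hR0 : 0 ≤ ∫ x, |r x| := integral_nonneg fun x => abs_nonneg _
  have b4 : ∫ x, |Nn x| ≤ h * CΓ * ∫ x, |r x| := by
    refine (integral_abs_corr_le (hk'.integrable_negKern h) hri).trans ?_
    rw [hk'.integral_abs_negKern hh.le]
    exact mul_le_mul_of_nonneg_right hgh hR0
  have hττ : 0 ≤ τ + τ' := add_nonneg hτ.nonneg hτ'.nonneg
  -- `posKern k' h` averages over shifts of length at most `h`, and `r` has finite variation; hence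
  -- `P` and `g r` differ by `O(h²)` in `L¹`.
  have b5 : ∫ x, |P x - g * r x| ≤ h * CΓ * ((τ + τ') * h) := by
    refine (integral_abs_corr_sub_self_le (hk'.integrable_posKern h) (hk'.posKern_nonneg h) hri
      (D := (τ + τ') * h) fun z hz => ?_).trans
      (mul_le_mul_of_nonneg_right hgh (mul_nonneg hττ hh.le))
    have hz' : |z| ≤ h := by
      have h1 := hk'.posKern_le h z
      by_cases hz2 : z ∈ Ioc (-h) 0
      · rw [abs_le]; exact ⟨hz2.1.le, hz2.2.trans hh.le⟩
      · rw [indicator_of_notMem hz2] at h1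
        exact absurd (le_antisymm h1 (hk'.posKern_nonneg h z)) hz
    have h1 := hτ z
    have h2 := hτ' z
    have h3 : ∫ x, |r (x + z) - r x| ≤ ∫ x, (|q (x + z) - q x| + |q' (x + z) - q' x|) :=
      integral_mono ((hri.comp_add_right z).sub hri).abs
        (((hqi.comp_add_right z).sub hqi).abs.add ((hqi'.comp_add_right z).sub hqi').abs)
        fun x => by
          have : r (x + z) - r x = (q (x + z) - q x) - (q' (x + z) - q' x) := by
            simp only [hr]; ring
          simp only [this]
          exact abs_sub _ _
    have j1 : Integrable fun x => |q (x + z) - q x| := ((hqi.comp_add_right z).sub hqi).abs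
    have j2 : Integrable fun x => |q' (x + z) - q' x| := ((hqi'.comp_add_right z).sub hqi').abs
    rw [integral_add j1 j2] at h3
    have h4 := mul_le_mul_of_nonneg_left hz' hττ
    linarith
  have hint := integral_mono (μ := volume) (by
    simp_rw [sub_mul]
    have j : ∀ y, Integrable fun x => b (x - y) * q (x - y) * φ x := fun y =>
      integrable_mul_of_bound ((hbm.mul hq).comp (measurable_sub_const y)) (fun x => hfb _)
        hφ.continuous.measurable hφ1 hsupp
    have j0 := j 0
    simp only [sub_zero] at j0
    exact (j h).sub j0) ((((((((i1.const_mul (N₀ + A₁ * D)).add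
      (hqi.const_mul ((A₂ + A₂') * (m * CΓ * h) ^ 2))).add
      (((i2.const_mul A₂).add (hqi.const_mul N₁)).const_mul (m * CΓ * h))).add
      (i3.const_mul (A₁' * m))).add (i4.const_mul (A₁' * m))).add (i5.const_mul (A₁' * m))).add
      (hri.abs.const_mul (h * CΓ * (A₁' * m)))).sub (iφ.const_mul (h * CΓ * (A₁' * m)))) hpt
  refine hint.trans ?_
  rw [integral_sub' (by fun_prop) (by fun_prop), integral_add' (by fun_prop) (by fun_prop),
    integral_add' (by fun_prop) (by fun_prop), integral_add' (by fun_prop) (by fun_prop),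
    integral_add' (by fun_prop) (by fun_prop), integral_add' (by fun_prop) (by fun_prop),
    integral_add' (by fun_prop) (by fun_prop)]
  simp only [Pi.add_apply, integral_const_mul]
  rw [integral_add (i2.const_mul A₂) (hqi.const_mul N₁), integral_const_mul, integral_const_mul]
  have hmC : 0 ≤ m * CΓ * h := by positivity
  have c1 := mul_le_mul_of_nonneg_left b1 (show 0 ≤ N₀ + A₁ * D by positivity)
  have c2 := mul_le_mul_of_nonneg_left hC₁
    (show 0 ≤ (A₂ + A₂') * (m * CΓ * h) ^ 2 by positivity)
  have c3 := mul_le_mul_of_nonneg_left (add_le_add (mul_le_mul_of_nonneg_left hD₁ hA₂)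
    (mul_le_mul_of_nonneg_left hC₁ hN₁0)) hmC
  have c4 := mul_le_mul_of_nonneg_left b3 (show 0 ≤ A₁' * m by positivity)
  have c5 := mul_le_mul_of_nonneg_left b4 (show 0 ≤ A₁' * m by positivity)
  have c6 := mul_le_mul_of_nonneg_left b5 (show 0 ≤ A₁' * m by positivity)
  simp only [hr] at c5 c6 ⊢
  linarith

theorem integral_corr {κ f : ℝ → ℝ} (hκ : Integrable κ) (hf : Integrable f) :
    ∫ x, corr κ f x = (∫ z, κ z) * ∫ x, f x := by
  unfold corr
  rw [integral_integral_swap (integrable_corr_prod hκ hf), ← integral_mul_const]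
  congr 1; ext z
  rw [integral_const_mul, integral_add_right_eq_self (fun x => f x) z]

theorem abs_integral_le_integral_of_le {f g : ℝ → ℝ} (hg : Integrable g)
    (h : ∀ x, |f x| ≤ g x) : ∫ x, f x ≤ ∫ x, g x :=
  (Real.le_norm_self _).trans
    (norm_integral_le_of_norm_le hg (Eventually.of_forall fun x => by simpa using h x))

/-- Source term in the equation of `u (· + h) - u`, bounded by the variation of `u` at the length
scale `1 / Λ`. -/
theorem scale_source_le {A₁ A₂ m CΓ C₁ K Λ h : ℝ} {V v k q φ : ℝ → ℝ}
    (hV : Vel A₁ A₂ V v) (hk : Kern CΓ k) (hq : Measurable q)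
    (hqm : ∀ x, 0 ≤ q x ∧ q x ≤ m) (hqi : Integrable q) (hC₁ : ∫ x, q x ≤ C₁)
    (hΛ : 0 < Λ) (hS : ScaleBd Λ q K) (hh : 0 < h)
    (hφ : TestFn φ) (hφ1 : ∀ x, |φ x| ≤ 1) (hφΛ : ∀ x, |deriv φ x| ≤ Λ) :
    ∫ x, (V (corr k q (x + h)) - V (corr k q x)) * q (x + h) * deriv φ x
      ≤ h * ((12 * A₁ * m * CΓ + 4 * A₂ * m ^ 2 * CΓ) * K + 2 * A₂ * m ^ 2 * CΓ ^ 2 * C₁) := by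
  have hm0 : 0 ≤ m := (hqm 0).1.trans (hqm 0).2
  have hA₁ := hV.A₁_nonneg
  have hA₂ := hV.A₂_nonneg
  have hCΓ := hk.bound_nonneg
  have habs : ∀ x, |q x| ≤ m := fun x => by rw [abs_of_nonneg (hqm x).1]; exact (hqm x).2
  -- Steklov average
  set δ := Λ⁻¹ with hδdef
  have hδ : 0 < δ := inv_pos.2 hΛ
  set v' := corr (stekKern δ) q with hv'
  have hvm : Measurable v' := measurable_corr (measurable_stekKern δ) hq
  have hsi := integrable_stekKern δ
  have hsa : ∫ z, |stekKern δ z| = 1 := by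
    simp_rw [abs_of_nonneg (stekKern_nonneg hδ _)]; exact integral_stekKern hδ
  have hvb : ∀ x, 0 ≤ v' x ∧ v' x ≤ m := fun x => by
    refine ⟨integral_nonneg fun z => mul_nonneg (stekKern_nonneg hδ z) (hqm _).1, ?_⟩
    have := (le_abs_self _).trans (abs_corr_le hsi habs x)
    rwa [hsa, one_mul] at this
  have hvabs : ∀ x, |v' x| ≤ m := fun x => by rw [abs_of_nonneg (hvb x).1]; exact (hvb x).2
  have hvi : Integrable v' := integrable_corr hsi hqi
  have hvC₁ : ∫ x, v' x ≤ C₁ := by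
    rw [hv', integral_corr hsi hqi, integral_stekKern hδ, one_mul]; exact hC₁
  have hθ : ∀ θ, 0 ≤ θ → θ ≤ δ → ∫ x, |q (x + θ) - q x| ≤ 2 * K / Λ := fun θ h0 h1 =>
    hS.integral_shift_le hq habs hΛ h0 (by
      calc θ * Λ ≤ δ * Λ := by gcongr
        _ = 1 := by rw [hδdef, inv_mul_cancel₀ hΛ.ne'])
  have hqv : ∫ x, |q x - v' x| ≤ 2 * K / Λ := by
    have := integral_abs_corr_sub_self_le hsi (stekKern_nonneg hδ) hqi (D := 2 * K / Λ)
      fun z hz => by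
        have hz' : z ∈ Ioc 0 δ := by
          by_contra hz2
          exact hz (indicator_of_notMem hz2 _)
        exact hθ z hz'.1.le hz'.2
    rw [integral_stekKern hδ, one_mul] at this
    simp_rw [one_mul, abs_sub_comm _ (q _)] at this
    exact this
  have hvs : ShiftBd v' (2 * K) := by
    refine ShiftBd.of_pos fun s hs => ?_
    simp_rw [hv', corr_stekKern_sub hδ hs hq habs, abs_mul]
    rw [integral_const_mul, abs_of_pos (by positivity)]
    have i : Integrable fun y => q (y + δ) - q y := (hqi.comp_add_right δ).sub hqi
    have h1 := integral_abs_corr_le (integrable_stekKern s) i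
    have h2 : ∫ z, |stekKern s z| = 1 := by
      simp_rw [abs_of_nonneg (stekKern_nonneg hs _)]; exact integral_stekKern hs
    rw [h2, one_mul] at h1
    have h3 := mul_le_mul_of_nonneg_left (h1.trans (hθ δ hδ.le le_rfl))
      (show 0 ≤ s / δ by positivity)
    refine h3.trans (le_of_eq ?_)
    rw [hδdef]; field_simp
  set W := corr k q with hWdef
  set Wv := corr k v' with hWvdef
  have hWm : Measurable W := measurable_corr hk.measurable hq
  have hWvm : Measurable Wv := measurable_corr hk.measurable hvm
  have hWlip : ∀ x, |W (x + h) - W x| ≤ m * CΓ * h := fun x => by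
    simpa [abs_of_pos hh] using hk.abs_corr_sub_le hq hqm (x + h) x
  have hWvlip : ∀ x y, |Wv x - Wv y| ≤ m * CΓ * |x - y| := hk.abs_corr_sub_le hvm hvb
  have hWvh : ∀ x, |Wv (x + h) - Wv x| ≤ m * CΓ * h := fun x => by
    simpa [abs_of_pos hh] using hWvlip (x + h) x
  set b : ℝ → ℝ := fun x => V (W (x + h)) - V (W x) with hb
  set bv : ℝ → ℝ := fun x => V (Wv (x + h)) - V (Wv x) with hbv
  have hVm := hV.continuous.measurable
  have hshm : Measurable fun x : ℝ => x + h := measurable_add_const h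
  have hbm : Measurable b := (hVm.comp (hWm.comp hshm)).sub (hVm.comp hWm)
  have hbvm : Measurable bv := (hVm.comp (hWvm.comp hshm)).sub (hVm.comp hWvm)
  have hbb : ∀ x, |b x| ≤ A₁ * (m * CΓ * h) := fun x =>
    (hV.abs_sub_le _ _).trans (mul_le_mul_of_nonneg_left (hWlip x) hA₁)
  have hbvb : ∀ x, |bv x| ≤ A₁ * (m * CΓ * h) := fun x =>
    (hV.abs_sub_le _ _).trans (mul_le_mul_of_nonneg_left (hWvh x) hA₁)
  have hAm : 0 ≤ A₁ * (m * CΓ * h) := by positivity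
  obtain ⟨R, hR, hsupp⟩ := exists_support_bound hφ.hasCompactSupport
  have hds : ∀ x, R < |x| → deriv φ x = 0 := fun x => deriv_eq_zero_of_bound hsupp
  have hdm := hφ.continuous_deriv.measurable
  -- differences
  set f : ℝ → ℝ := fun x => q x - v' x with hf
  have hfm : Measurable f := hq.sub hvm
  have hfi : Integrable f := hqi.sub hvi
  have hfb : ∀ x, |f x| ≤ m + m := fun x => (abs_sub _ _).trans (add_le_add (habs x) (hvabs x))
  have hWf : ∀ x, W x - Wv x = corr k f x := fun x =>
    (corr_sub_right hk.integrable hq hvm habs hvabs x).symm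
  have hWfi : Integrable (corr k f) := integrable_corr hk.integrable hfi
  have hWf1 : ∫ x, |corr k f x| ≤ 2 * K / Λ := by
    refine (integral_abs_corr_le hk.integrable hfi).trans ?_
    rw [hk.integral_abs, one_mul]; exact hqv
  have iT1 : Integrable fun x => b x * (q (x + h) - v' (x + h)) * deriv φ x :=
    integrable_mul_of_bound (M := A₁ * (m * CΓ * h) * (m + m)) (hbm.mul (hfm.comp hshm))
      (fun x => by
        rw [abs_mul]; exact mul_le_mul (hbb x) (hfb _) (abs_nonneg _) hAm) hdm hφΛ hds
  have iT2 : Integrable fun x => (b x - bv x) * v' (x + h) * deriv φ x :=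
    integrable_mul_of_bound (M := (A₁ * (m * CΓ * h) + A₁ * (m * CΓ * h)) * m)
      ((hbm.sub hbvm).mul (hvm.comp hshm)) (fun x => by
        rw [abs_mul]
        exact mul_le_mul ((abs_sub _ _).trans (add_le_add (hbb x) (hbvb x))) (hvabs _)
          (abs_nonneg _) (by positivity)) hdm hφΛ hds
  have hbvv : ∀ x, |bv x * v' (x + h)| ≤ A₁ * (m * CΓ * h) * m := fun x => by
    rw [abs_mul]; exact mul_le_mul (hbvb x) (hvabs _) (abs_nonneg _) hAm
  have hbvvm : Measurable fun x => bv x * v' (x + h) := hbvm.mul (hvm.comp hshm)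
  have iT3 : Integrable fun x => bv x * v' (x + h) * deriv φ x :=
    integrable_mul_of_bound hbvvm hbvv hdm hφΛ hds
  -- In the first two integrals the `L¹` distance `2 K / Λ` between `q` and its Steklov mean
  -- compensates the slope `Λ` of `φ`. In the third only the mean occurs, and the derivative can be
  -- moved onto it since its variation is at most `2 K`.
  have split : ∫ x, b x * q (x + h) * deriv φ x
      = (∫ x, b x * (q (x + h) - v' (x + h)) * deriv φ x)
        + (∫ x, (b x - bv x) * v' (x + h) * deriv φ x)
        + ∫ x, bv x * v' (x + h) * deriv φ x := by
    have j : Integrable fun x => b x * (q (x + h) - v' (x + h)) * deriv φ x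
        + (b x - bv x) * v' (x + h) * deriv φ x := iT1.add iT2
    rw [← integral_add iT1 iT2, ← integral_add j iT3]
    congr 1; ext x; ring
  have T1 : ∫ x, b x * (q (x + h) - v' (x + h)) * deriv φ x
      ≤ A₁ * (m * CΓ * h) * Λ * (2 * K / Λ) := by
    have i : Integrable fun x => A₁ * (m * CΓ * h) * Λ * |f (x + h)| :=
      (hfi.comp_add_right h).abs.const_mul _
    refine (abs_integral_le_integral_of_le i fun x => ?_).trans ?_
    · rw [abs_mul, abs_mul]
      calc |b x| * |q (x + h) - v' (x + h)| * |deriv φ x|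
          ≤ A₁ * (m * CΓ * h) * |f (x + h)| * Λ := by
            gcongr
            · exact hbb x
            · exact hφΛ x
        _ = _ := by ring
    · rw [integral_const_mul, integral_add_right_eq_self (fun x => |f x|) h]
      exact mul_le_mul_of_nonneg_left hqv (by positivity)
  have T2 : ∫ x, (b x - bv x) * v' (x + h) * deriv φ x
      ≤ m * Λ * ((A₁ * (2 * CΓ * h) + A₂ * (m * CΓ * h) * 2) * (2 * K / Λ)) := by
    have j1 : Integrable fun x => |corr k f (x + h) - corr k f x| :=
      ((hWfi.comp_add_right h).sub hWfi).abs
    have j2 : Integrable fun x => |corr k f (x + h)| := (hWfi.comp_add_right h).abs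
    have j3 : Integrable fun x => A₁ * |corr k f (x + h) - corr k f x| := j1.const_mul _
    have j5 : Integrable fun x => |corr k f x| + |corr k f (x + h)| := hWfi.abs.add j2
    have j4 : Integrable fun x => A₂ * (m * CΓ * h) * (|corr k f x| + |corr k f (x + h)|) :=
      j5.const_mul _
    have j : Integrable fun x => m * Λ * (A₁ * |corr k f (x + h) - corr k f x|
        + A₂ * (m * CΓ * h) * (|corr k f x| + |corr k f (x + h)|)) := (j3.add j4).const_mul _
    refine (abs_integral_le_integral_of_le j fun x => ?_).trans ?_
    · rw [abs_mul, abs_mul]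
      have h1 := hV.four_point_le (W x) (W (x + h)) (Wv x) (Wv (x + h))
      rw [hWf, hWf, sub_sub_sub_comm (W (x + h)) (W x), hWf, hWf] at h1
      have h2 : |b x - bv x| ≤ A₁ * |corr k f (x + h) - corr k f x|
          + A₂ * (m * CΓ * h) * (|corr k f x| + |corr k f (x + h)|) := by
        refine h1.trans ?_
        gcongr
        exact hWlip x
      calc |b x - bv x| * |v' (x + h)| * |deriv φ x|
          ≤ (A₁ * |corr k f (x + h) - corr k f x|
          + A₂ * (m * CΓ * h) * (|corr k f x| + |corr k f (x + h)|)) * m * Λ := by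
            gcongr
            · exact hvabs _
            · exact hφΛ x
        _ = _ := by ring
    · rw [integral_const_mul, integral_add j3 j4, integral_const_mul, integral_const_mul,
        integral_add hWfi.abs j2, integral_add_right_eq_self (fun x => |corr k f x|) h]
      refine mul_le_mul_of_nonneg_left ?_ (by positivity)
      have h1 := hk.integral_abs_corr_sub_le hfm hfb hfi h
      rw [abs_of_pos hh] at h1
      have h2 : 2 * CΓ * h * ∫ x, |f x| ≤ 2 * CΓ * h * (2 * K / Λ) :=
        mul_le_mul_of_nonneg_left hqv (by positivity)
      have h3 := mul_le_mul_of_nonneg_left (h1.trans h2) hA₁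
      have h4 := mul_le_mul_of_nonneg_left (add_le_add hWf1 hWf1)
        (show 0 ≤ A₂ * (m * CΓ * h) by positivity)
      linarith
  have T3 : ∫ x, bv x * v' (x + h) * deriv φ x
      ≤ A₁ * (m * CΓ * h) * (2 * K) + m * (A₁ * (2 * CΓ * (2 * K * h)))
        + A₂ * (m * CΓ * h) * (2 * (m * CΓ)) * C₁ := by
    refine integral_mul_deriv_le_of_shift hbvvm hbvv hφ.contDiff hφ.hasCompactSupport (B' := 0)
      fun s hs _ => ?_
    set d : ℝ → ℝ := fun x => v' (x + h) - v' x with hd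
    have hdmm : Measurable d := (hvm.comp hshm).sub hvm
    have hdi : Integrable d := (hvi.comp_add_right h).sub hvi
    have hdb : ∀ x, |d x| ≤ m + m := fun x =>
      (abs_sub _ _).trans (add_le_add (hvabs _) (hvabs _))
    have hWd : ∀ x, Wv (x + h) - Wv x = corr k d x := fun x => by
      rw [hd, corr_sub_right (f := fun x => v' (x + h)) hk.integrable (hvm.comp hshm) hvm
        (fun x => hvabs _) hvabs, corr_comp_add]
    have hCd : Integrable (corr k d) := integrable_corr hk.integrable hdi
    have hvih : Integrable fun x => v' (x + h) := hvi.comp_add_right h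
    have j1 : Integrable fun x => |v' (x - s + h) - v' (x + h)| :=
      ((hvih.comp_sub_right s).sub hvih).abs
    have j2 : Integrable fun x => |corr k d (x + -s) - corr k d x| :=
      ((hCd.comp_add_right (-s)).sub hCd).abs
    have j1' : Integrable fun x => A₁ * (m * CΓ * h) * |v' (x - s + h) - v' (x + h)| :=
      j1.const_mul _
    have j2' : Integrable fun x => m * (A₁ * |corr k d (x + -s) - corr k d x|) :=
      (j2.const_mul _).const_mul _
    have j3' : Integrable fun x => A₂ * (m * CΓ * h) * (2 * (m * CΓ * s)) * v' (x + h) :=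
      hvih.const_mul _
    have j12 : Integrable fun x => A₁ * (m * CΓ * h) * |v' (x - s + h) - v' (x + h)|
        + m * (A₁ * |corr k d (x + -s) - corr k d x|) := j1'.add j2'
    have j : Integrable fun x => A₁ * (m * CΓ * h) * |v' (x - s + h) - v' (x + h)|
        + m * (A₁ * |corr k d (x + -s) - corr k d x|)
        + A₂ * (m * CΓ * h) * (2 * (m * CΓ * s)) * v' (x + h) := j12.add j3'
    refine (abs_integral_le_integral_of_le j fun x => ?_).trans ?_
    · rw [abs_mul]
      refine (mul_le_of_le_one_right (abs_nonneg _) (hφ1 x)).trans ?_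
      have e : bv (x - s) * v' (x - s + h) - bv x * v' (x + h)
          = bv (x - s) * (v' (x - s + h) - v' (x + h)) + (bv (x - s) - bv x) * v' (x + h) := by
        ring
      rw [e]
      refine (abs_add_le _ _).trans ?_
      rw [abs_mul, abs_mul, add_assoc]
      refine add_le_add (mul_le_mul_of_nonneg_right (hbvb _) (abs_nonneg _)) ?_
      have h1 := hV.four_point_le (Wv (x - s)) (Wv (x - s + h)) (Wv x) (Wv (x + h))
      rw [hWd, hWd] at h1
      have h2 : |Wv (x - s) - Wv x| ≤ m * CΓ * s := by
        simpa [abs_of_pos hs] using hWvlip (x - s) x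
      have h3 : |Wv (x - s + h) - Wv (x + h)| ≤ m * CΓ * s := by
        have := hWvlip (x - s + h) (x + h)
        rwa [add_sub_add_right_eq_sub, sub_sub_cancel_left, abs_neg, abs_of_pos hs] at this
      have h4 : |corr k d (x - s)| ≤ m * CΓ * h := by rw [← hWd]; exact hWvh _
      have h5 : |bv (x - s) - bv x| ≤ A₁ * |corr k d (x + -s) - corr k d x|
          + A₂ * (m * CΓ * h) * (2 * (m * CΓ * s)) := by
        refine h1.trans ?_
        rw [← sub_eq_add_neg]
        gcongr
        linarith
      rw [abs_of_nonneg (hvb _).1]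
      have h6 := mul_le_mul_of_nonneg_right h5 (hvb (x + h)).1
      refine h6.trans ?_
      rw [add_mul]
      refine add_le_add ?_ le_rfl
      rw [mul_comm]
      exact mul_le_mul_of_nonneg_right (hvb _).2 (by positivity)
    · rw [integral_add j12 j3', integral_add j1' j2', integral_const_mul, integral_const_mul,
        integral_const_mul, integral_const_mul, integral_add_right_eq_self (fun x => v' x) h]
      have h1 : ∫ x, |v' (x - s + h) - v' (x + h)| ≤ 2 * K * s := by
        have := (hvs.comp_add h) (-s)
        rwa [abs_neg, abs_of_pos hs] at this
      have h2 := hk.integral_abs_corr_sub_le hdmm hdb hdi (-s)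
      rw [abs_neg, abs_of_pos hs] at h2
      have h3 := hvs h
      rw [abs_of_pos hh] at h3
      have h4 : 2 * CΓ * s * ∫ x, |d x| ≤ 2 * CΓ * s * (2 * K * h) :=
        mul_le_mul_of_nonneg_left h3 (by positivity)
      have h5 := mul_le_mul_of_nonneg_left h1 hAm
      have h6 := mul_le_mul_of_nonneg_left (mul_le_mul_of_nonneg_left (h2.trans h4) hA₁) hm0
      have h7 := mul_le_mul_of_nonneg_left hvC₁
        (show 0 ≤ A₂ * (m * CΓ * h) * (2 * (m * CΓ * s)) by positivity)
      linarith
  rw [split]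
  have e1 : A₁ * (m * CΓ * h) * Λ * (2 * K / Λ) = A₁ * (m * CΓ * h) * (2 * K) := by
    field_simp
  have e2 : m * Λ * ((A₁ * (2 * CΓ * h) + A₂ * (m * CΓ * h) * 2) * (2 * K / Λ))
      = m * ((A₁ * (2 * CΓ * h) + A₂ * (m * CΓ * h) * 2) * (2 * K)) := by
    field_simp
  rw [e1] at T1
  rw [e2] at T2
  linarith

/-- Source term in the maximum principle: `m ∂ₓ V(W)` has a sign up to the positive part of
`f - m`. -/
theorem max_source_le {A₁ A₂ m CΓ M : ℝ} {V v k f φ : ℝ → ℝ}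
    (hV : Vel A₁ A₂ V v) (hk : Kern CΓ k) (hm : 0 ≤ m) (hf : Measurable f)
    (hM : ∀ x, |f x| ≤ M) (hw : Integrable fun x => max (f x - m) 0)
    (hφ : TestFn φ) (hφ1 : ∀ x, 0 ≤ φ x ∧ φ x ≤ 1) :
    ∫ x, m * V (corr k f x) * deriv φ x
      ≤ 2 * (m * A₁ * CΓ) * (∫ x, max (f x - m) 0) - m * A₁ * CΓ * ∫ x, (f x - m) * φ x := by
  have hA₁ := hV.A₁_nonneg
  have hA₂ := hV.A₂_nonneg
  have hCΓ := hk.bound_nonneg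
  have hM0 : 0 ≤ M := (abs_nonneg _).trans (hM 0)
  obtain ⟨R, hR, hsupp⟩ := exists_support_bound hφ.hasCompactSupport
  have hφ1' : ∀ x, |φ x| ≤ 1 := fun x => by rw [abs_of_nonneg (hφ1 x).1]; exact (hφ1 x).2
  set W := corr k f with hW
  have hWm : Measurable W := measurable_corr hk.measurable hf
  have hWlip : ∀ x y, |W x - W y| ≤ 2 * M * CΓ * |x - y| := hk.abs_corr_sub_le_of_abs hf hM
  have hWb : ∀ x, |W x| ≤ M := fun x => by
    have := abs_corr_le hk.integrable hM x
    rwa [hk.integral_abs, one_mul] at this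
  set w : ℝ → ℝ := fun x => f x - m with hwdef
  have hwm : Measurable w := hf.sub_const m
  have hwb : ∀ x, |w x| ≤ M + m := fun x =>
    (abs_sub _ _).trans (add_le_add (hM x) (abs_of_nonneg hm).le)
  have hVb : ∀ x, |m * V (W x)| ≤ m * (A₁ * M + |V 0|) := fun x => by
    rw [abs_mul, abs_of_nonneg hm]
    refine mul_le_mul_of_nonneg_left ?_ hm
    have h1 := hV.abs_sub_le (W x) 0
    rw [sub_zero] at h1
    have h2 := mul_le_mul_of_nonneg_left (hWb x) hA₁
    have h3 := abs_sub_abs_le_abs_sub (V (W x)) (V 0)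
    linarith
  have hVm : Measurable fun x => m * V (W x) := (hV.continuous.measurable.comp hWm).const_mul m
  -- the weight `ψ = - m v(W) φ`
  set ψ : ℝ → ℝ := fun x => -(m * v (W x)) * φ x with hψ
  have hψm : Measurable ψ :=
    ((hV.continuous_deriv.measurable.comp hWm).const_mul m).neg.mul hφ.continuous.measurable
  have he0 : ∀ x, 0 ≤ -(m * v (W x)) := fun x => by
    have := mul_nonneg hm (neg_nonneg.2 (hV.nonpos (W x))); linarith
  have he1 : ∀ x, -(m * v (W x)) ≤ m * A₁ := fun x => by
    have := mul_le_mul_of_nonneg_left (hV.lower (W x)) hm; linarith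
  have hψ0 : ∀ x, 0 ≤ ψ x := fun x => mul_nonneg (he0 x) (hφ1 x).1
  have hψ1 : ∀ x, ψ x ≤ m * A₁ := fun x =>
    (mul_le_of_le_one_right (he0 x) (hφ1 x).2).trans (he1 x)
  have hψb : ∀ x, |ψ x| ≤ m * A₁ := fun x => by rw [abs_of_nonneg (hψ0 x)]; exact hψ1 x
  have hψs : ∀ x, R < |x| → ψ x = 0 := fun x hx => by simp only [hψ]; rw [hsupp x hx, mul_zero]
  obtain ⟨Kφ, hKφ⟩ := exists_lipschitz_of_contDiff hφ.contDiff hφ.hasCompactSupport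
  have hKφ0 : 0 ≤ Kφ := by simpa using (abs_nonneg _).trans (hKφ 1 0)
  set Lψ := m * A₂ * (2 * M * CΓ) + m * A₁ * Kφ with hLψ
  have hLψ0 : 0 ≤ Lψ := by positivity
  have hψL : ∀ x y, |ψ x - ψ y| ≤ Lψ * |x - y| := fun x y => by
    have e : ψ x - ψ y = -(m * (v (W x) - v (W y))) * φ x + -(m * v (W y)) * (φ x - φ y) := by
      simp only [hψ]; ring
    rw [e]
    refine (abs_add_le _ _).trans ?_
    rw [abs_mul, abs_mul, abs_neg, abs_mul, abs_of_nonneg hm, abs_of_nonneg (he0 y)]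
    have h1 : m * |v (W x) - v (W y)| * |φ x| ≤ m * (A₂ * (2 * M * CΓ * |x - y|)) * 1 := by
      gcongr
      · exact (hV.lip _ _).trans (mul_le_mul_of_nonneg_left (hWlip x y) hA₂)
      · exact hφ1' x
    have h2 : -(m * v (W y)) * |φ x - φ y| ≤ m * A₁ * (Kφ * |x - y|) :=
      mul_le_mul (he1 y) (hKφ x y) (abs_nonneg _) (by positivity)
    rw [hLψ]; linarith
  set I := ∫ x, max (w x) 0 with hI
  set J := ∫ x, w x * φ x with hJ
  have iwφ : Integrable fun x => w x * φ x :=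
    integrable_mul_of_bound hwm hwb hφ.continuous.measurable hφ1' hsupp
  have iwψ : Integrable fun x => w x * ψ x := integrable_mul_of_bound hwm hwb hψm hψb hψs
  have iφ : Integrable φ := hφ.continuous.integrable_of_hasCompactSupport hφ.hasCompactSupport
  have hI' : Integrable fun x => max (w x) 0 := hw
  refine integral_mul_deriv_le_of_shift hVm hVb hφ.contDiff hφ.hasCompactSupport
    (B' := CΓ * Lψ * (M + m) * (2 * (R + 1)) + m * A₂ * (2 * M * CΓ) ^ 2 * ∫ x, φ x)
    fun h hh hh1 => ?_
  set g := ∫ z, posKern k h z with hg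
  have hg0 : 0 ≤ g := integral_nonneg (hk.posKern_nonneg h)
  have hgh : g ≤ h * CΓ := hk.integral_posKern_le hh.le
  have ipos := hk.integrable_posKern h
  have ineg := hk.integrable_negKern h
  set P := corr (posKern k h) w with hP
  set Np := corr (negKern k h) (fun x => max (w x) 0) with hNp
  have hwp : ∀ x, |max (w x) 0| ≤ M + m := fun x => by
    rw [abs_of_nonneg (le_max_right _ _)]
    exact max_le ((le_abs_self _).trans (hwb x)) (by linarith)
  have hwpm : Measurable fun x => max (w x) 0 := hwm.max measurable_const
  -- The kernel has unit mass, so `f` may be replaced by `f - m` in increments of the nonlocal term.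
  -- Only a lower bound is needed, since it is multiplied by `ψ ≥ 0`; in the part entering with a
  -- minus sign `w` is therefore replaced by its positive part.
  have hΔ : ∀ x, P x - Np x ≤ W (x - h) - W x := fun x => by
    have h1 := hk.corr_sub_eq hwm hwb h x
    have h2 : ∀ y, corr k w y = W y - m := fun y => by
      rw [hwdef, corr_sub_right (g := fun _ => m) hk.integrable hf measurable_const hM
        (fun _ => (abs_of_nonneg hm).le), corr_const, hk.integral_eq, one_mul]
    rw [h2, h2] at h1
    have h3 := corr_mono ineg (hk.negKern_nonneg hh.le) hwm hwpm hwb hwp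
      (fun x => le_max_left _ _) x
    rw [hP, hNp]; linarith
  have hNp0 : ∀ x, 0 ≤ Np x := fun x =>
    integral_nonneg fun z => mul_nonneg (hk.negKern_nonneg hh.le z) (le_max_right _ _)
  have iNp : Integrable Np := integrable_corr ineg hI'
  have hNpI : ∫ x, Np x ≤ h * CΓ * I := by
    rw [hNp, integral_corr ineg hI', hk.integral_negKern]
    exact mul_le_mul_of_nonneg_right hgh (integral_nonneg fun x => le_max_right _ _)
  -- commuting the weight with the averaging
  set Q := corr (posKern k h) (fun x => w x * ψ x) with hQ
  have iQ : Integrable Q := integrable_corr ipos iwψ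
  -- No variation of `w` is available here, so `P` cannot be compared with `g w`. Instead the
  -- Lipschitz weight `ψ` is moved inside the average at the cost `O(h²)`; the resulting `Q` has
  -- integral exactly `g ∫ w ψ`.
  have hPQ : ∀ x, |ψ x * P x - Q x|
      ≤ (Icc (-(R + 1)) (R + 1)).indicator (fun _ => h * CΓ * (Lψ * h * (M + m))) x := fun x => by
    have i1 := (integrable_corr_integrand ipos hwm hwb x).const_mul (ψ x)
    have i2 : Integrable fun z => posKern k h z * (w (x + z) * ψ (x + z)) :=
      integrable_corr_integrand (f := fun y => w y * ψ y) (M := (M + m) * (m * A₁)) ipos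
        (hwm.mul hψm) (fun y => by
          rw [abs_mul]; exact mul_le_mul (hwb y) (hψb y) (abs_nonneg _) (by positivity)) x
    have e : ψ x * P x - Q x
        = ∫ z, posKern k h z * ((ψ x - ψ (x + z)) * w (x + z)) := by
      rw [hP, hQ, corr, corr, ← integral_const_mul, ← integral_sub i1 i2]
      congr 1; ext z; ring
    have hz : ∀ z, posKern k h z ≠ 0 → |z| ≤ h := fun z hz => by
      have h1 := hk.posKern_le h z
      by_cases hz2 : z ∈ Ioc (-h) 0
      · rw [abs_le]; exact ⟨hz2.1.le, hz2.2.trans hh.le⟩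
      · rw [indicator_of_notMem hz2] at h1
        exact absurd (le_antisymm h1 (hk.posKern_nonneg h z)) hz
    by_cases hx : x ∈ Icc (-(R + 1)) (R + 1)
    · rw [indicator_of_mem hx, e]
      have h1 : |∫ z, posKern k h z * ((ψ x - ψ (x + z)) * w (x + z))|
          ≤ ∫ z, posKern k h z * (Lψ * h * (M + m)) := by
        rw [← Real.norm_eq_abs]
        refine norm_integral_le_of_norm_le (ipos.mul_const _) (Eventually.of_forall fun z => ?_)
        rw [Real.norm_eq_abs, abs_mul, abs_of_nonneg (hk.posKern_nonneg h z)]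
        by_cases hz0 : posKern k h z = 0
        · simp [hz0]
        · refine mul_le_mul_of_nonneg_left ?_ (hk.posKern_nonneg h z)
          rw [abs_mul]
          refine mul_le_mul ?_ (hwb _) (abs_nonneg _) (by positivity)
          refine (hψL _ _).trans (mul_le_mul_of_nonneg_left ?_ hLψ0)
          rw [sub_add_cancel_left, abs_neg]; exact hz z hz0
      rw [integral_mul_const] at h1
      exact h1.trans (mul_le_mul_of_nonneg_right hgh (by positivity))
    · have hx' : R + 1 < |x| := by
        by_contra h'
        exact hx (abs_le.1 (not_lt.1 h'))
      rw [indicator_of_notMem hx, e]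
      refine le_of_eq ?_
      rw [abs_eq_zero]
      refine integral_eq_zero_of_ae (Eventually.of_forall fun z => ?_)
      by_cases hz0 : posKern k h z = 0
      · simp [hz0]
      · have h1 := hz z hz0
        have h2 := abs_sub_abs_le_abs_sub x (-z)
        rw [sub_neg_eq_add, abs_neg] at h2
        simp [hψs x (by linarith), hψs (x + z) (by linarith)]
  set ind : ℝ → ℝ := (Icc (-(R + 1)) (R + 1)).indicator fun _ => h * CΓ * (Lψ * h * (M + m))
    with hind
  have iind : Integrable ind := by
    rw [hind, integrable_indicator_iff measurableSet_Icc]; exact integrableOn_const (by simp)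
  have hindI : ∫ x, ind x = h * CΓ * (Lψ * h * (M + m)) * (2 * (R + 1)) := by
    rw [hind, integral_indicator measurableSet_Icc, setIntegral_const, smul_eq_mul, Measure.real,
      Real.volume_Icc, ENNReal.toReal_ofReal (by linarith)]
    ring
  have hpt : ∀ x, (m * V (W (x - h)) - m * V (W x)) * φ x
      ≤ (m * A₁ * Np x + ind x + m * A₂ * (2 * M * CΓ * h) ^ 2 * φ x
        + h * CΓ * (m * A₁) * max (w x) 0 - h * CΓ * (m * A₁) * (w x * φ x))
        + (g * (w x * ψ x) - Q x) := fun x => by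
    have h1 := (le_abs_self _).trans (hV.abs_taylor_le (W x) (W (x - h)))
    have h2 : (W (x - h) - W x) ^ 2 ≤ (2 * M * CΓ * h) ^ 2 := by
      rw [← sq_abs]
      refine pow_le_pow_left₀ (abs_nonneg _) ?_ 2
      simpa [abs_of_pos hh] using hWlip (x - h) x
    have h3 := mul_le_mul_of_nonneg_left h2 hA₂
    have h4 : m * φ x * (V (W (x - h)) - V (W x) - v (W x) * (W (x - h) - W x))
        ≤ m * φ x * (A₂ * (2 * M * CΓ * h) ^ 2) :=
      mul_le_mul_of_nonneg_left (h1.trans h3) (mul_nonneg hm (hφ1 x).1)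
    have h5 := mul_le_mul_of_nonneg_left (hΔ x) (hψ0 x)
    have h6 := mul_le_mul_of_nonneg_right (hψ1 x) (hNp0 x)
    have h7 := neg_le_of_abs_le (hPQ x)
    -- Damping as in `stability_pointwise`: the coefficient lies between `0` and `h CΓ m A₁`, so
    -- only the positive part of `w` is paid for.
    have h8 : (h * CΓ * (m * A₁) * φ x - g * ψ x) * w x ≤ h * CΓ * (m * A₁) * max (w x) 0 := by
      have e0 : 0 ≤ h * CΓ * (m * A₁) * φ x - g * ψ x := by
        have : g * ψ x ≤ h * CΓ * (m * A₁ * φ x) := by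
          refine mul_le_mul hgh ?_ (hψ0 x) (by positivity)
          exact mul_le_mul_of_nonneg_right (he1 x) (hφ1 x).1
        linarith
      have e1 : h * CΓ * (m * A₁) * φ x - g * ψ x ≤ h * CΓ * (m * A₁) := by
        have a1 := mul_nonneg hg0 (hψ0 x)
        have a2 : h * CΓ * (m * A₁) * φ x ≤ h * CΓ * (m * A₁) :=
          mul_le_of_le_one_right (by positivity) (hφ1 x).2
        linarith
      exact (mul_le_mul_of_nonneg_left (le_max_left (w x) 0) e0).trans
        (mul_le_mul_of_nonneg_right e1 (le_max_right _ _))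
    have e : (m * V (W (x - h)) - m * V (W x)) * φ x
        = m * φ x * (V (W (x - h)) - V (W x) - v (W x) * (W (x - h) - W x))
          - ψ x * (W (x - h) - W x) := by simp only [hψ]; ring
    rw [e]
    linarith
  have k1 : Integrable fun x => m * A₁ * Np x := iNp.const_mul _
  have k3 : Integrable fun x => m * A₂ * (2 * M * CΓ * h) ^ 2 * φ x := iφ.const_mul _
  have k4 : Integrable fun x => h * CΓ * (m * A₁) * max (w x) 0 := hI'.const_mul _
  have k5 : Integrable fun x => h * CΓ * (m * A₁) * (w x * φ x) := iwφ.const_mul _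
  have k6 : Integrable fun x => g * (w x * ψ x) := iwψ.const_mul _
  have hint := integral_mono (μ := volume) (by
    simp_rw [sub_mul]
    have j : ∀ y, Integrable fun x => m * V (W (x - y)) * φ x := fun y =>
      integrable_mul_of_bound (hVm.comp (measurable_sub_const y)) (fun x => hVb _)
        hφ.continuous.measurable hφ1' hsupp
    have j0 := j 0
    simp only [sub_zero] at j0
    exact (j h).sub j0) (((((k1.add iind).add k3).add k4).sub k5).add (k6.sub iQ)) hpt
  refine hint.trans ?_
  rw [integral_add' (by fun_prop) (by fun_prop), integral_sub' (by fun_prop) (by fun_prop),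
    integral_add' (by fun_prop) (by fun_prop), integral_add' (by fun_prop) (by fun_prop),
    integral_add' (by fun_prop) (by fun_prop), integral_sub' (by fun_prop) (by fun_prop)]
  simp only [integral_const_mul]
  rw [hindI, hQ, integral_corr ipos iwψ]
  have c1 := mul_le_mul_of_nonneg_left hNpI (show 0 ≤ m * A₁ by positivity)
  linarith

/-! ### Continuity in time -/

theorem setIntegral_Icc_const_le {f : ℝ → ℝ} {R C : ℝ} (hR : 0 ≤ R) (h : ∀ x, |f x| ≤ C) :
    ∫ x in Icc (-R) R, |f x| ≤ 2 * R * C := by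
  have := norm_setIntegral_le_of_norm_le_const (μ := volume) (s := Icc (-R) R)
    (f := fun x => |f x|) (C := C) (by simp) (fun x _ => by simpa using h x)
  refine (le_abs_self _).trans (this.trans (le_of_eq ?_))
  rw [Measure.real, Real.volume_Icc, ENNReal.toReal_ofReal (by linarith)]; ring

theorem integrableOn_Icc_of_bdd {f : ℝ → ℝ} (hf : Measurable f) {C : ℝ} (h : ∀ x, |f x| ≤ C)
    (R : ℝ) : IntegrableOn (fun x => |f x|) (Icc (-R) R) :=
  Measure.integrableOn_of_bounded (by simp) hf.abs.aestronglyMeasurable (M := C)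
    (Eventually.of_forall fun x => by simpa using h x)

/-- Uniform continuity in time, uniformly in space. -/
def UnifCont (T : ℝ) (a : ℝ → ℝ → ℝ) : Prop :=
  ∀ ε > 0, ∃ η > 0, ∀ s ∈ Icc 0 T, ∀ t ∈ Icc 0 T, |s - t| ≤ η → ∀ x, |a s x - a t x| ≤ ε

/-- Uniform continuity in time with values in `L²(ℝ)`. -/
def L2Cont (T : ℝ) (u : ℝ → ℝ → ℝ) : Prop :=
  ∀ ε > 0, ∃ η > 0, ∀ s ∈ Icc 0 T, ∀ t ∈ Icc 0 T, |s - t| ≤ η →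
    Integrable (fun x => (u s x - u t x) ^ 2) ∧ ∫ x, (u s x - u t x) ^ 2 ≤ ε

theorem abs_le_young {ε d : ℝ} (hε : 0 < ε) : |d| ≤ (ε + ε⁻¹ * d ^ 2) / 2 := by
  have h : 0 ≤ ε⁻¹ * (ε - |d|) ^ 2 := by positivity
  have e : ε⁻¹ * (ε - |d|) ^ 2 = ε + ε⁻¹ * d ^ 2 - 2 * |d| := by
    rw [← sq_abs d]; field_simp; ring
  linarith

/-- On a bounded interval Young's inequality bounds the `L¹` norm by the squared `L²` norm; the
parameter `e` is `ε` divided by (a bound of) the length. -/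
theorem L2Cont.locCont {T : ℝ} {u : ℝ → ℝ → ℝ} (hu : L2Cont T u) (hm : ∀ s, Measurable (u s))
    {M : ℝ} (hM : ∀ s x, |u s x| ≤ M) : LocCont T u := by
  intro R ε hε
  have hR' : 0 ≤ |R| := abs_nonneg R
  set e := ε / (2 * |R| + 1) with he
  have he0 : 0 < e := by positivity
  obtain ⟨η, hη, H⟩ := hu (e * ε) (by positivity)
  refine ⟨η, hη, fun s hs t ht hst => ?_⟩
  obtain ⟨h1, h2⟩ := H s hs t ht hst
  have hb : ∀ x, |u s x - u t x| ≤ M + M := fun x =>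
    (abs_sub _ _).trans (add_le_add (hM s x) (hM t x))
  have i1 : IntegrableOn (fun _ : ℝ => e / 2) (Icc (-R) R) := integrableOn_const (by simp)
  have i2 : IntegrableOn (fun x => e⁻¹ / 2 * (u s x - u t x) ^ 2) (Icc (-R) R) :=
    (h1.const_mul _).integrableOn
  have h3 : ∫ x in Icc (-R) R, |u s x - u t x|
      ≤ ∫ x in Icc (-R) R, (e / 2 + e⁻¹ / 2 * (u s x - u t x) ^ 2) :=
    integral_mono (integrableOn_Icc_of_bdd ((hm s).sub (hm t)) hb R) (i1.add i2) fun x => by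
      have := abs_le_young (d := u s x - u t x) he0
      change |u s x - u t x| ≤ e / 2 + e⁻¹ / 2 * (u s x - u t x) ^ 2
      linarith
  rw [integral_add i1 i2, integral_const_mul, setIntegral_const, smul_eq_mul] at h3
  have h4 : ∫ x in Icc (-R) R, (u s x - u t x) ^ 2 ≤ e * ε :=
    (setIntegral_le_integral h1 (Eventually.of_forall fun x => sq_nonneg _)).trans h2
  have h5 : volume.real (Icc (-R) R) ≤ 2 * |R| := by
    rw [Measure.real, Real.volume_Icc]
    exact ENNReal.toReal_le_of_le_ofReal (by positivity)
      (ENNReal.ofReal_le_ofReal (by linarith [le_abs_self R]))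
  have h6 : e⁻¹ / 2 * (e * ε) = ε / 2 := by field_simp
  have h7 := mul_le_mul_of_nonneg_left h4 (show 0 ≤ e⁻¹ / 2 by positivity)
  have h8 : 2 * |R| * (e / 2) ≤ ε / 2 := by
    rw [he]
    rw [show 2 * |R| * (ε / (2 * |R| + 1) / 2) = ε / 2 * (2 * |R| / (2 * |R| + 1)) by ring]
    refine mul_le_of_le_one_right (by positivity) ?_
    rw [div_le_one (by positivity)]; linarith
  have h9 := mul_le_mul_of_nonneg_right h5 (show 0 ≤ e / 2 by positivity)
  linarith

/-- The kernel is bounded and integrable, hence square integrable, so convergence in `L²` becomes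
uniform convergence of the nonlocal term. Cauchy–Schwarz appears in Young's form, with `∫ k = 1` and
`k ≤ CΓ`. -/
theorem L2Cont.unifCont_corr {T CΓ : ℝ} {u : ℝ → ℝ → ℝ} {k : ℝ → ℝ} (hu : L2Cont T u)
    (hk : Kern CΓ k) (hm : ∀ s, Measurable (u s)) {M : ℝ} (hM : ∀ s x, |u s x| ≤ M) :
    UnifCont T fun s => corr k (u s) := by
  intro ε hε
  have hC := hk.bound_nonneg
  obtain ⟨η, hη, H⟩ := hu (ε ^ 2 / (CΓ + 1)) (by positivity)
  refine ⟨η, hη, fun s hs t ht hst x => ?_⟩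
  obtain ⟨h1, h2⟩ := H s hs t ht hst
  have hb : ∀ x, |u s x - u t x| ≤ M + M := fun x =>
    (abs_sub _ _).trans (add_le_add (hM s x) (hM t x))
  rw [← corr_sub_right hk.integrable (hm s) (hm t) (hM s) (hM t)]
  have i2 : Integrable fun z => (u s (x + z) - u t (x + z)) ^ 2 := h1.comp_add_left x
  have i3 : Integrable fun z => ε / 2 * k z + ε⁻¹ * CΓ / 2 * (u s (x + z) - u t (x + z)) ^ 2 :=
    (hk.integrable.const_mul _).add (i2.const_mul _)
  have h3 : |corr k (fun y => u s y - u t y) x|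
      ≤ ∫ z, (ε / 2 * k z + ε⁻¹ * CΓ / 2 * (u s (x + z) - u t (x + z)) ^ 2) := by
    rw [← Real.norm_eq_abs]
    refine norm_integral_le_of_norm_le i3 (Eventually.of_forall fun z => ?_)
    rw [Real.norm_eq_abs, abs_mul, abs_of_nonneg (hk.nonneg z)]
    have h4 := mul_le_mul_of_nonneg_left
      (abs_le_young (d := u s (x + z) - u t (x + z)) hε) (hk.nonneg z)
    have h5 := mul_le_mul_of_nonneg_right (hk.le z)
      (show 0 ≤ ε⁻¹ * (u s (x + z) - u t (x + z)) ^ 2 by positivity)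
    linarith
  rw [integral_add (hk.integrable.const_mul _) (i2.const_mul _), integral_const_mul,
    integral_const_mul, hk.integral_eq,
    integral_add_left_eq_self (fun z => (u s z - u t z) ^ 2) x] at h3
  have h6 : ε⁻¹ * CΓ / 2 * ∫ z, (u s z - u t z) ^ 2 ≤ ε⁻¹ * CΓ / 2 * (ε ^ 2 / (CΓ + 1)) :=
    mul_le_mul_of_nonneg_left h2 (by positivity)
  have h7 : ε⁻¹ * CΓ / 2 * (ε ^ 2 / (CΓ + 1)) ≤ ε / 2 := by
    rw [show ε⁻¹ * CΓ / 2 * (ε ^ 2 / (CΓ + 1)) = ε / 2 * (CΓ / (CΓ + 1)) by field_simp]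
    refine mul_le_of_le_one_right (by positivity) ?_
    rw [div_le_one (by positivity)]; linarith
  linarith

theorem UnifCont.comp_vel {T A₁ A₂ : ℝ} {V v : ℝ → ℝ} {W : ℝ → ℝ → ℝ} (hW : UnifCont T W)
    (hV : Vel A₁ A₂ V v) : UnifCont T fun s x => V (W s x) := by
  intro ε hε
  have := hV.A₁_nonneg
  obtain ⟨η, hη, H⟩ := hW (ε / (A₁ + 1)) (by positivity)
  refine ⟨η, hη, fun s hs t ht hst x => (hV.abs_sub_le _ _).trans ?_⟩
  refine (mul_le_mul_of_nonneg_left (H s hs t ht hst x) this).trans ?_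
  rw [mul_div_assoc', div_le_iff₀ (by positivity)]
  nlinarith

theorem LocCont.mul {T M N : ℝ} {a w : ℝ → ℝ → ℝ} (ha : UnifCont T a) (hw : LocCont T w)
    (ham : ∀ s, Measurable (a s)) (hwm : ∀ s, Measurable (w s))
    (hM : ∀ s x, |a s x| ≤ M) (hN : ∀ s x, |w s x| ≤ N) : LocCont T fun s x => a s x * w s x := by
  have hM0 : 0 ≤ M := (abs_nonneg _).trans (hM 0 0)
  have hN0 : 0 ≤ N := (abs_nonneg _).trans (hN 0 0)
  intro R ε hε
  rcases lt_or_ge R 0 with hR | hR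
  · refine ⟨1, one_pos, fun s _ t _ _ => ?_⟩
    rw [Icc_eq_empty (by linarith)]; simpa using hε.le
  obtain ⟨η₁, hη₁, H₁⟩ := ha (ε / (2 * (2 * R * N + 1))) (by positivity)
  obtain ⟨η₂, hη₂, H₂⟩ := hw R (ε / (2 * (M + 1))) (by positivity)
  refine ⟨min η₁ η₂, lt_min hη₁ hη₂, fun s hs t ht hst => ?_⟩
  have h1 := H₁ s hs t ht (hst.trans (min_le_left _ _))
  have h2 := H₂ s hs t ht (hst.trans (min_le_right _ _))
  have hda : ∀ x, |(a s x - a t x) * w s x| ≤ ε / (2 * (2 * R * N + 1)) * N := fun x => by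
    rw [abs_mul]; exact mul_le_mul (h1 x) (hN s x) (abs_nonneg _) (by positivity)
  have i1 := integrableOn_Icc_of_bdd (((ham s).sub (ham t)).mul (hwm s)) hda R
  have i2 : IntegrableOn (fun x => M * |w s x - w t x|) (Icc (-R) R) :=
    (integrableOn_Icc_of_bdd ((hwm s).sub (hwm t)) (C := N + N)
      (fun x => (abs_sub _ _).trans (add_le_add (hN s x) (hN t x))) R).const_mul M
  have i0 : IntegrableOn (fun x => |a s x * w s x - a t x * w t x|) (Icc (-R) R) :=
    integrableOn_Icc_of_bdd (((ham s).mul (hwm s)).sub ((ham t).mul (hwm t))) (C := M * N + M * N)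
      (fun x => (abs_sub _ _).trans (add_le_add
        (by rw [Pi.mul_apply, abs_mul]; exact mul_le_mul (hM s x) (hN s x) (abs_nonneg _) hM0)
        (by rw [Pi.mul_apply, abs_mul]; exact mul_le_mul (hM t x) (hN t x) (abs_nonneg _) hM0))) R
  have h3 : ∫ x in Icc (-R) R, |a s x * w s x - a t x * w t x|
      ≤ ∫ x in Icc (-R) R, (|(a s x - a t x) * w s x| + M * |w s x - w t x|) := by
    refine integral_mono i0 (i1.add i2) fun x => ?_
    have e : a s x * w s x - a t x * w t x
        = (a s x - a t x) * w s x + a t x * (w s x - w t x) := by ring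
    simp only [e]
    refine (abs_add_le _ _).trans (add_le_add le_rfl ?_)
    rw [abs_mul]
    exact mul_le_mul_of_nonneg_right (hM t x) (abs_nonneg _)
  have i1' : IntegrableOn (fun x => |(a s x - a t x) * w s x|) (Icc (-R) R) := i1
  rw [integral_add i1' i2, integral_const_mul] at h3
  have h4 := setIntegral_Icc_const_le hR hda
  have h5 := mul_le_mul_of_nonneg_left h2 hM0
  have h6 : 2 * R * (ε / (2 * (2 * R * N + 1)) * N) ≤ ε / 2 := by
    rw [show 2 * R * (ε / (2 * (2 * R * N + 1)) * N)
      = ε / 2 * (2 * R * N / (2 * R * N + 1)) by field_simp]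
    refine mul_le_of_le_one_right (by positivity) ?_
    rw [div_le_one (by positivity)]; linarith
  have h7 : M * (ε / (2 * (M + 1))) ≤ ε / 2 := by
    rw [show M * (ε / (2 * (M + 1))) = ε / 2 * (M / (M + 1)) by field_simp]
    refine mul_le_of_le_one_right (by positivity) ?_
    rw [div_le_one (by positivity)]; linarith
  linarith

theorem L2Cont.comp_add {T : ℝ} {u : ℝ → ℝ → ℝ} (hu : L2Cont T u) (h : ℝ) :
    L2Cont T fun s x => u s (x + h) := fun ε hε => by
  obtain ⟨η, hη, H⟩ := hu ε hε
  refine ⟨η, hη, fun s hs t ht hst => ?_⟩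
  obtain ⟨h1, h2⟩ := H s hs t ht hst
  refine ⟨h1.comp_add_right h, ?_⟩
  rwa [integral_add_right_eq_self (fun x => (u s x - u t x) ^ 2) h]

theorem L2Cont.sub {T : ℝ} {u u' : ℝ → ℝ → ℝ} (hu : L2Cont T u) (hu' : L2Cont T u')
    (hm : ∀ s, Measurable (u s)) (hm' : ∀ s, Measurable (u' s)) :
    L2Cont T fun s x => u s x - u' s x := fun ε hε => by
  obtain ⟨η, hη, H⟩ := hu (ε / 4) (by positivity)
  obtain ⟨η', hη', H'⟩ := hu' (ε / 4) (by positivity)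
  refine ⟨min η η', lt_min hη hη', fun s hs t ht hst => ?_⟩
  obtain ⟨h1, h2⟩ := H s hs t ht (hst.trans (min_le_left _ _))
  obtain ⟨h1', h2'⟩ := H' s hs t ht (hst.trans (min_le_right _ _))
  have i : Integrable fun x => 2 * (u s x - u t x) ^ 2 + 2 * (u' s x - u' t x) ^ 2 :=
    (h1.const_mul 2).add (h1'.const_mul 2)
  have hle : ∀ x, (u s x - u' s x - (u t x - u' t x)) ^ 2
      ≤ 2 * (u s x - u t x) ^ 2 + 2 * (u' s x - u' t x) ^ 2 := fun x => by
    nlinarith [sq_nonneg ((u s x - u t x) + (u' s x - u' t x))]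
  have i' : Integrable fun x => (u s x - u' s x - (u t x - u' t x)) ^ 2 := by
    refine i.mono' ((((hm s).sub (hm' s)).sub ((hm t).sub (hm' t))).pow_const 2).aestronglyMeasurable
      (Eventually.of_forall fun x => ?_)
    rw [Real.norm_of_nonneg (sq_nonneg _)]; exact hle x
  refine ⟨i', (integral_mono i' i hle).trans ?_⟩
  rw [integral_add (h1.const_mul 2) (h1'.const_mul 2), integral_const_mul, integral_const_mul]
  linarith

/-! ### Comparison with damping -/

/-- Exponential weights in integrated balance laws. -/
theorem exp_mul_sub_eq_integral {F G : ℝ → ℝ} {T C s t : ℝ} (hs : 0 ≤ s) (hst : s ≤ t)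
    (ht : t ≤ T) (hG : ContinuousOn G (Icc 0 T))
    (hE : ∀ s t, 0 ≤ s → s ≤ t → t ≤ T → F t - F s = ∫ σ in s..t, G σ) :
    Real.exp (C * t) * F t - Real.exp (C * s) * F s
      = ∫ σ in s..t, Real.exp (C * σ) * (G σ + C * F σ) := by
  have hGst : ContinuousOn G (Icc s t) := hG.mono (Icc_subset_Icc hs ht)
  have hGi : IntegrableOn G (Icc s t) := hGst.integrableOn_Icc
  have hF : ∀ x ∈ Icc s t, F x = F s + ∫ σ in s..x, G σ := fun x hx => by
    rw [← hE s x hs hx.1 (hx.2.trans ht)]; ring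
  have hFc : ContinuousOn F (Icc s t) := by
    refine ContinuousOn.congr ?_ hF
    refine continuousOn_const.add ?_
    have := intervalIntegral.continuousOn_primitive_interval (a := s) (b := t) (μ := volume)
      (f := G) (by rwa [uIcc_of_le hst])
    rwa [uIcc_of_le hst] at this
  symm
  refine intervalIntegral.integral_eq_sub_of_hasDerivAt_of_le
    (f := fun x => Real.exp (C * x) * F x) hst ?_ (fun x hx => ?_) ?_
  · exact (Continuous.continuousOn (by fun_prop)).mul hFc
  · have h1 : HasDerivAt F (G x) x := by
      have h2 : HasDerivAt (fun x => F s + ∫ σ in s..x, G σ) (G x) x := by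
        refine HasDerivAt.const_add _ ?_
        refine intervalIntegral.integral_hasDerivAt_right ?_ ?_ ?_
        · exact (hGst.mono (by
            rw [uIcc_of_le hx.1.le]; exact Icc_subset_Icc le_rfl hx.2.le)).intervalIntegrable
        · exact ContinuousOn.stronglyMeasurableAtFilter isOpen_Ioo
            (hGst.mono Ioo_subset_Icc_self) x hx
        · exact hGst.continuousAt (Icc_mem_nhds hx.1 hx.2)
      refine h2.congr_of_eventuallyEq ?_
      filter_upwards [Icc_mem_nhds hx.1 hx.2] with y hy using hF y hy
    have h3 : HasDerivAt (fun x => Real.exp (C * x)) (C * Real.exp (C * x)) x := by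
      have := ((hasDerivAt_id x).const_mul C).exp
      simpa [mul_comm] using this
    refine (h3.mul h1).congr_deriv ?_
    ring
  · refine ContinuousOn.intervalIntegrable ?_
    rw [uIcc_of_le hst]
    exact (Continuous.continuousOn (by fun_prop)).mul (hGst.add (continuousOn_const.mul hFc))

/-- The comparison principle with damping. -/
theorem transport_bound {T L M N κ Λ I₀ C : ℝ} (hL : 0 ≤ L) (hΛ : 0 ≤ Λ) (hC : 0 ≤ C)
    {a w : ℝ → ℝ → ℝ} {β : ℝ → ℝ}
    (ha_lip : ∀ s x y, |a s x - a s y| ≤ L * |x - y|) (ha : ∀ s x, |a s x| ≤ M)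
    (hw : ∀ s, Measurable (w s)) (hN : ∀ s x, |w s x| ≤ N)
    (hau : UnifCont T a) (hwl : LocCont T w) (hβ : Continuous β)
    (G : (ℝ → ℝ) → ℝ → ℝ) (hG : ∀ φ, TestFn φ → ContinuousOn (G φ) (Icc 0 T))
    (hE : ∀ φ, TestFn φ → ∀ s t, 0 ≤ s → s ≤ t → t ≤ T →
      (∫ x, w t x * φ x) - ∫ x, w s x * φ x = ∫ σ in s..t, G φ σ)
    (H : ∀ φ, TestFn φ → (∀ x, -κ ≤ φ x ∧ φ x ≤ 1) →
      (∀ x, |deriv φ x| ≤ Λ * Real.exp (L * T)) → ∀ σ ∈ Icc 0 T,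
      G φ σ ≤ (∫ x, a σ x * w σ x * deriv φ x) + β σ - C * ∫ x, w σ x * φ x)
    (H₀ : ∀ φ, TestFn φ → (∀ x, -κ ≤ φ x ∧ φ x ≤ 1) → ∫ x, w 0 x * φ x ≤ I₀)
    {φ : ℝ → ℝ} (hφ : TestFn φ) (hφb : ∀ x, -κ ≤ φ x ∧ φ x ≤ 1)
    (hφΛ : ∀ x, |deriv φ x| ≤ Λ) {t : ℝ} (ht : t ∈ Icc 0 T) :
    Real.exp (C * t) * ∫ x, w t x * φ x
      ≤ I₀ + ∫ σ in (0 : ℝ)..t, Real.exp (C * σ) * β σ := by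
  have hT : 0 ≤ T := ht.1.trans ht.2
  have hM0 : 0 ≤ M := (abs_nonneg _).trans (ha 0 0)
  have hN0 : 0 ≤ N := (abs_nonneg _).trans (hN 0 0)
  have ham : ∀ s, Measurable (a s) := fun s => (continuous_of_abs_sub_le (ha_lip s)).measurable
  -- The weight is stopped at time `T`, because `transport_comparison` asks for bounds at all times.
  set E : ℝ → ℝ := fun s => Real.exp (C * min s T) with hEdef
  have hEc : Continuous E := by fun_prop
  have hE0 : ∀ s, 0 ≤ E s := fun s => (Real.exp_pos _).le
  have hEb : ∀ s, |E s| ≤ Real.exp (C * T) := fun s => by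
    rw [abs_of_nonneg (hE0 s)]
    exact Real.exp_le_exp.2 (mul_le_mul_of_nonneg_left (min_le_right _ _) hC)
  have hET : ∀ s ≤ T, E s = Real.exp (C * s) := fun s hs => by simp only [hEdef, min_eq_left hs]
  have hEu : UnifCont T fun s _ => E s := fun ε hε => by
    obtain ⟨δ, hδ, h⟩ := Metric.uniformContinuousOn_iff.1
      (isCompact_Icc.uniformContinuousOn_of_continuous hEc.continuousOn (s := Icc 0 T)) ε hε
    exact ⟨δ / 2, by positivity, fun s hs t ht hst _ =>
      (h s hs t ht (by rw [Real.dist_eq]; linarith)).le⟩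
  have hwE : LocCont T fun s x => E s * w s x :=
    LocCont.mul hEu hwl (fun s => measurable_const) hw (fun s _ => hEb s) hN
  have hwEm : ∀ s, Measurable fun x => E s * w s x := fun s => (hw s).const_mul _
  have hwEb : ∀ s x, |E s * w s x| ≤ Real.exp (C * T) * N := fun s x => by
    rw [abs_mul]; exact mul_le_mul (hEb s) (hN s x) (abs_nonneg _) (Real.exp_pos _).le
  have hawE : LocCont T fun s x => a s x * (E s * w s x) :=
    LocCont.mul hau hwE ham hwEm ha hwEb
  have hβE : ContinuousOn (fun s => E s * β s) (Icc 0 T) := (hEc.mul hβ).continuousOn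
  have key := transport_comparison (w := fun s x => E s * w s x) (β := fun s => E s * β s)
    (κ := κ) (I₀ := I₀) hL hΛ ha_lip ha hwEm hwEb hawE hβE ?_ ?_ hφ hφb hφΛ ht
  · simp_rw [mul_assoc, integral_const_mul] at key
    rw [hET t ht.2] at key
    refine key.trans (le_of_eq ?_)
    congr 1
    refine intervalIntegral.integral_congr fun s hs => ?_
    rw [uIcc_of_le ht.1] at hs
    simp only [hET s (hs.2.trans ht.2)]
  · intro ψ hψ hψb hψΛ s t hs hst ht
    have e := exp_mul_sub_eq_integral (C := C) hs hst ht (hG ψ hψ) (hE ψ hψ)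
    simp_rw [mul_assoc, integral_const_mul]
    rw [hET t ht, hET s (hst.trans ht)]
    obtain ⟨R, hR, hsupp⟩ := exists_support_bound hψ.hasCompactSupport
    have hds : ∀ x, R < |x| → deriv ψ x = 0 := fun x => deriv_eq_zero_of_bound hsupp
    obtain ⟨Cψ, -, hCψ⟩ := exists_abs_le hψ.continuous hψ.hasCompactSupport
    have hawm : ∀ s, Measurable fun x => a s x * w s x := fun s => (ham s).mul (hw s)
    have hawb : ∀ s x, |a s x * w s x| ≤ M * N := fun s x => by
      rw [abs_mul]; exact mul_le_mul (ha s x) (hN s x) (abs_nonneg _) hM0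
    have c1 : ContinuousOn (fun s => ∫ x, w s x * ψ x) (Icc 0 T) :=
      hwl.continuousOn_integral hw hN hψ.continuous.measurable hCψ hsupp
    have c2 : ContinuousOn (fun s => ∫ x, a s x * w s x * deriv ψ x) (Icc 0 T) :=
      (LocCont.mul hau hwl ham hw ha hN).continuousOn_integral hawm hawb
        hψ.continuous_deriv.measurable hψΛ hds
    have hsub : uIcc s t ⊆ Icc 0 T := by rw [uIcc_of_le hst]; exact Icc_subset_Icc hs ht
    have hexp : ContinuousOn (fun σ => Real.exp (C * σ)) (uIcc s t) :=
      Continuous.continuousOn (by fun_prop)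
    have hmono : ∫ σ in s..t, Real.exp (C * σ) * (G ψ σ + C * ∫ x, w σ x * ψ x)
        ≤ ∫ σ in s..t, ((∫ x, a σ x * (E σ * (w σ x * deriv ψ x))) + E σ * β σ) := by
      have e2 : ∀ σ, ∫ x, a σ x * (E σ * (w σ x * deriv ψ x))
          = E σ * ∫ x, a σ x * w σ x * deriv ψ x := fun σ => by
        rw [← integral_const_mul]; congr 1; ext x; ring
      simp_rw [e2]
      refine intervalIntegral.integral_mono_on hst ?_ ?_ fun σ hσ => ?_
      · exact ContinuousOn.intervalIntegrable
          (hexp.mul (((hG ψ hψ).mono hsub).add (continuousOn_const.mul (c1.mono hsub))))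
      · exact ContinuousOn.intervalIntegrable
          ((hEc.continuousOn.mul (c2.mono hsub)).add (hEc.mul hβ).continuousOn)
      · have hσT : σ ∈ Icc 0 T := ⟨hs.trans hσ.1, hσ.2.trans ht⟩
        rw [hET σ hσT.2, ← mul_add]
        refine mul_le_mul_of_nonneg_left ?_ (Real.exp_pos _).le
        linarith [H ψ hψ hψb hψΛ σ hσT]
    linarith
  · intro ψ hψ hψb
    simp_rw [mul_assoc, integral_const_mul]
    rw [hET 0 hT, mul_zero, Real.exp_zero, one_mul]
    exact H₀ ψ hψ hψb

/-! ### Mass, sign and maximum principle for weak solutions -/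

/-- Bounded weak solutions, as functions defined everywhere, in time-integrated form. -/
structure BddSol (T M : ℝ) (V k : ℝ → ℝ) (u : ℝ → ℝ → ℝ) : Prop where
  meas : ∀ t, Measurable (u t)
  bdd : ∀ t x, |u t x| ≤ M
  cont : L2Cont T u
  eq : ∀ φ, TestFn φ → ∀ s t, 0 ≤ s → s ≤ t → t ≤ T →
    (∫ x, u t x * φ x) - ∫ x, u s x * φ x
      = ∫ σ in s..t, ∫ x, V (corr k (u σ) x) * u σ x * deriv φ x

/-- Weak solutions with values in `[0, m]` and mass at most `C₁`. -/
structure Sol (T m C₁ : ℝ) (V k : ℝ → ℝ) (u : ℝ → ℝ → ℝ) : Prop extends BddSol T m V k u where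
  bounds : ∀ t x, 0 ≤ u t x ∧ u t x ≤ m
  integrable : ∀ t, Integrable (u t)
  integral_le : ∀ t, ∫ x, u t x ≤ C₁

theorem TestFn.integrable_mul {w φ : ℝ → ℝ} (hφ : TestFn φ) (hw : Measurable w) {M : ℝ}
    (hM : ∀ x, |w x| ≤ M) : Integrable fun x => w x * φ x := by
  obtain ⟨R, -, hR⟩ := exists_support_bound hφ.hasCompactSupport
  obtain ⟨C, -, hC⟩ := exists_abs_le hφ.continuous hφ.hasCompactSupport
  exact integrable_mul_of_bound hw hM hφ.continuous.measurable hC hR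

theorem TestFn.exists_abs_deriv_le {φ : ℝ → ℝ} (hφ : TestFn φ) :
    ∃ Λ > 0, ∀ x, |deriv φ x| ≤ Λ :=
  exists_abs_le hφ.continuous_deriv hφ.hasCompactSupport.deriv

theorem TestFn.integrable_mul_deriv {w φ : ℝ → ℝ} (hφ : TestFn φ) (hw : Measurable w) {M : ℝ}
    (hM : ∀ x, |w x| ≤ M) : Integrable fun x => w x * deriv φ x := by
  obtain ⟨R, -, hR⟩ := exists_support_bound hφ.hasCompactSupport
  obtain ⟨C, -, hC⟩ := hφ.exists_abs_deriv_le
  exact integrable_mul_of_bound hw hM hφ.continuous_deriv.measurable hC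
    fun x => deriv_eq_zero_of_bound hR

theorem LocCont.continuousOn_mul_testFn {T N : ℝ} {w : ℝ → ℝ → ℝ} (h : LocCont T w)
    (hw : ∀ s, Measurable (w s)) (hN : ∀ s x, |w s x| ≤ N) {φ : ℝ → ℝ} (hφ : TestFn φ) :
    ContinuousOn (fun s => ∫ x, w s x * φ x) (Icc 0 T) := by
  obtain ⟨R, -, hR⟩ := exists_support_bound hφ.hasCompactSupport
  obtain ⟨C, -, hC⟩ := exists_abs_le hφ.continuous hφ.hasCompactSupport
  exact h.continuousOn_integral hw hN hφ.continuous.measurable hC hR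

theorem LocCont.continuousOn_mul_deriv {T N : ℝ} {w : ℝ → ℝ → ℝ} (h : LocCont T w)
    (hw : ∀ s, Measurable (w s)) (hN : ∀ s x, |w s x| ≤ N) {φ : ℝ → ℝ} (hφ : TestFn φ) :
    ContinuousOn (fun s => ∫ x, w s x * deriv φ x) (Icc 0 T) := by
  obtain ⟨R, -, hR⟩ := exists_support_bound hφ.hasCompactSupport
  obtain ⟨C, -, hC⟩ := hφ.exists_abs_deriv_le
  exact h.continuousOn_integral hw hN hφ.continuous_deriv.measurable hC
    fun x => deriv_eq_zero_of_bound hR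

section Velocity

variable {T M A₁ A₂ CΓ : ℝ} {V v k : ℝ → ℝ} {u : ℝ → ℝ → ℝ}

theorem Vel.abs_comp_corr_le (hV : Vel A₁ A₂ V v) (hk : Kern CΓ k) {f : ℝ → ℝ}
    (hM : ∀ x, |f x| ≤ M) (x : ℝ) : |V (corr k f x)| ≤ A₁ * M + |V 0| := by
  have h1 := hV.abs_sub_le (corr k f x) 0
  have h2 := abs_corr_le hk.integrable hM x
  rw [hk.integral_abs, one_mul] at h2
  rw [sub_zero] at h1
  have h3 := mul_le_mul_of_nonneg_left h2 hV.A₁_nonneg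
  have h4 := abs_add_le (V (corr k f x) - V 0) (V 0)
  rw [sub_add_cancel] at h4
  linarith

theorem Vel.comp_corr_lip (hV : Vel A₁ A₂ V v) (hk : Kern CΓ k) {f : ℝ → ℝ} (hf : Measurable f)
    (hM : ∀ x, |f x| ≤ M) (x y : ℝ) :
    |V (corr k f x) - V (corr k f y)| ≤ A₁ * (2 * M * CΓ) * |x - y| := by
  refine (hV.abs_sub_le _ _).trans ?_
  rw [mul_assoc]
  exact mul_le_mul_of_nonneg_left (hk.abs_corr_sub_le_of_abs hf hM x y) hV.A₁_nonneg

theorem BddSol.nonneg_bound (hu : BddSol T M V k u) : 0 ≤ M :=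
  (abs_nonneg _).trans (hu.bdd 0 0)

theorem BddSol.unifCont_vel (hu : BddSol T M V k u) (hV : Vel A₁ A₂ V v) (hk : Kern CΓ k) :
    UnifCont T fun s x => V (corr k (u s) x) :=
  (hu.cont.unifCont_corr hk hu.meas hu.bdd).comp_vel hV

theorem BddSol.continuousOn_flux (hu : BddSol T M V k u) (hV : Vel A₁ A₂ V v) (hk : Kern CΓ k)
    {φ : ℝ → ℝ} (hφ : TestFn φ) :
    ContinuousOn (fun s => ∫ x, V (corr k (u s) x) * u s x * deriv φ x) (Icc 0 T) := by
  have hm : ∀ s, Measurable fun x => V (corr k (u s) x) := fun s =>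
    measurable_vel_corr hV hk (hu.meas s)
  have hb : ∀ s x, |V (corr k (u s) x)| ≤ A₁ * M + |V 0| := fun s =>
    hV.abs_comp_corr_le hk (hu.bdd s)
  refine LocCont.continuousOn_mul_deriv (N := (A₁ * M + |V 0|) * M) (LocCont.mul
    (hu.unifCont_vel hV hk) (hu.cont.locCont hu.meas hu.bdd) hm hu.meas hb hu.bdd)
    (fun s => (hm s).mul (hu.meas s)) (fun s x => ?_) hφ
  rw [abs_mul]
  exact mul_le_mul (hb s x) (hu.bdd s x) (abs_nonneg _) ((abs_nonneg _).trans (hb s x))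

/-- Comparison for affine functions of a solution. -/
theorem BddSol.affine_bound (hu : BddSol T M V k u) (hV : Vel A₁ A₂ V v) (hk : Kern CΓ k)
    {c d κ C I₀ : ℝ} {β : ℝ → ℝ} (hC : 0 ≤ C) (hβ : Continuous β)
    (H : ∀ φ, TestFn φ → (∀ x, -κ ≤ φ x ∧ φ x ≤ 1) → ∀ σ ∈ Icc 0 T,
      ∫ x, -d * V (corr k (u σ) x) * deriv φ x ≤ β σ - C * ∫ x, (c * u σ x + d) * φ x)
    (H₀ : ∀ φ, TestFn φ → (∀ x, -κ ≤ φ x ∧ φ x ≤ 1) → ∫ x, (c * u 0 x + d) * φ x ≤ I₀)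
    {φ : ℝ → ℝ} (hφ : TestFn φ) (hφb : ∀ x, -κ ≤ φ x ∧ φ x ≤ 1) {t : ℝ} (ht : t ∈ Icc 0 T) :
    Real.exp (C * t) * ∫ x, (c * u t x + d) * φ x
      ≤ I₀ + ∫ σ in (0 : ℝ)..t, Real.exp (C * σ) * β σ := by
  have hM0 := hu.nonneg_bound
  have hA := hV.A₁_nonneg
  have hCΓ := hk.bound_nonneg
  obtain ⟨Λ, hΛ, hφΛ⟩ := hφ.exists_abs_deriv_le
  have hm : ∀ s, Measurable fun x => V (corr k (u s) x) := fun s =>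
    measurable_vel_corr hV hk (hu.meas s)
  have hb : ∀ s x, |V (corr k (u s) x)| ≤ A₁ * M + |V 0| := fun s =>
    hV.abs_comp_corr_le hk (hu.bdd s)
  have hwm : ∀ s, Measurable fun x => c * u s x + d := fun s =>
    ((hu.meas s).const_mul c).add_const d
  have hwb : ∀ s x, |c * u s x + d| ≤ |c| * M + |d| := fun s x => by
    refine (abs_add_le _ _).trans (add_le_add ?_ le_rfl)
    rw [abs_mul]; exact mul_le_mul_of_nonneg_left (hu.bdd s x) (abs_nonneg _)
  have hul := hu.cont.locCont hu.meas hu.bdd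
  have hwl : LocCont T fun s x => c * u s x + d := fun R ε hε => by
    obtain ⟨η, hη, h⟩ := hul R (ε / (|c| + 1)) (by positivity)
    refine ⟨η, hη, fun s hs t ht hst => ?_⟩
    have e : ∀ x, |c * u s x + d - (c * u t x + d)| = |c| * |u s x - u t x| := fun x => by
      rw [← abs_mul]; congr 1; ring
    simp_rw [e, integral_const_mul]
    refine (mul_le_mul_of_nonneg_left (h s hs t ht hst) (abs_nonneg _)).trans ?_
    rw [mul_div_assoc', div_le_iff₀ (by positivity)]
    nlinarith [abs_nonneg c]
  refine transport_bound (L := A₁ * (2 * M * CΓ)) (κ := κ) (by positivity) hΛ.le hC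
    (a := fun s x => V (corr k (u s) x)) (fun s => hV.comp_corr_lip hk (hu.meas s) (hu.bdd s)) hb
    hwm hwb (hu.unifCont_vel hV hk) hwl hβ
    (fun ψ σ => c * ∫ x, V (corr k (u σ) x) * u σ x * deriv ψ x)
    (fun ψ hψ => continuousOn_const.mul (hu.continuousOn_flux hV hk hψ)) (fun ψ hψ s t hs hst ht => ?_)
    (fun ψ hψ hψb _ σ hσ => ?_) H₀ hφ hφb hφΛ ht
  · have e : ∀ s, ∫ x, (c * u s x + d) * ψ x = c * (∫ x, u s x * ψ x) + ∫ x, d * ψ x := fun s => by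
      rw [← integral_const_mul, ← integral_add]
      · congr 1; ext x; ring
      · exact (hψ.integrable_mul (hu.meas s) (hu.bdd s)).const_mul c
      · exact (hψ.continuous.integrable_of_hasCompactSupport hψ.hasCompactSupport).const_mul d
    rw [e, e, intervalIntegral.integral_const_mul, ← hu.eq ψ hψ s t hs hst ht]
    ring
  · have h1 := H ψ hψ hψb σ hσ
    have i1 : Integrable fun x => V (corr k (u σ) x) * (c * u σ x + d) * deriv ψ x := by
      refine hψ.integrable_mul_deriv ((hm σ).mul (hwm σ))
        (M := (A₁ * M + |V 0|) * (|c| * M + |d|)) fun x => ?_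
      rw [abs_mul]
      exact mul_le_mul (hb σ x) (hwb σ x) (abs_nonneg _) ((abs_nonneg _).trans (hb σ x))
    have i2 : Integrable fun x => -d * V (corr k (u σ) x) * deriv ψ x := by
      refine hψ.integrable_mul_deriv ((hm σ).const_mul _) (M := |d| * (A₁ * M + |V 0|)) fun x => ?_
      rw [abs_mul, abs_neg]
      exact mul_le_mul_of_nonneg_left (hb σ x) (abs_nonneg _)
    have e : c * ∫ x, V (corr k (u σ) x) * u σ x * deriv ψ x
        = (∫ x, V (corr k (u σ) x) * (c * u σ x + d) * deriv ψ x)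
          + ∫ x, -d * V (corr k (u σ) x) * deriv ψ x := by
      rw [← integral_const_mul, ← integral_add i1 i2]
      congr 1; ext x; ring
    linarith

/-- For `d = 0` the comparison has no source, so tests with values in `[-1, 1]` see no growth of the
`L¹` norm. -/
theorem BddSol.integrable_and_integral_abs_le (hu : BddSol T M V k u) (hV : Vel A₁ A₂ V v)
    (hk : Kern CΓ k) (h0 : Integrable (u 0)) {t : ℝ} (ht : t ∈ Icc 0 T) :
    Integrable (u t) ∧ ∫ x, |u t x| ≤ ∫ x, |u 0 x| := by
  refine integrable_abs_of_smooth (hu.meas t) (hu.bdd t) fun φ hφ hc h1 => ?_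
  have := hu.affine_bound hV hk (c := 1) (d := 0) (κ := 1) (C := 0) (I₀ := ∫ x, |u 0 x|)
    (β := fun _ => 0) le_rfl continuous_const (fun φ _ _ σ _ => by simp)
    (fun ψ hψ hb => by
      simp only [one_mul, add_zero]
      exact abs_integral_le_integral_of_le h0.abs fun x => by
        rw [abs_mul]; exact mul_le_of_le_one_right (abs_nonneg _) (abs_le.2 (hb x)))
    (TestFn.of_contDiff hφ hc) (fun x => abs_le.1 (h1 x)) ht
  simpa using this

/-- Without source the mass of the negative part cannot grow from zero; it is detected by applying
tests with values in `[0, 1]` to `-u`. -/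
theorem BddSol.ae_nonneg (hu : BddSol T M V k u) (hV : Vel A₁ A₂ V v)
    (hk : Kern CΓ k) (h0 : ∀ᵐ x, 0 ≤ u 0 x) {t : ℝ} (ht : t ∈ Icc 0 T) : ∀ᵐ x, 0 ≤ u t x := by
  have h := integrable_posPart_of_smooth (w := fun x => - u t x) (hu.meas t).neg (M := M)
    (fun x => by simpa using hu.bdd t x) (B := 0) fun φ hφ hc h1 => by
      have := hu.affine_bound hV hk (c := -1) (d := 0) (κ := 0) (C := 0) (I₀ := 0)
        (β := fun _ => 0) le_rfl continuous_const (fun φ _ _ σ _ => by simp)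
        (fun ψ hψ hb => by
          refine integral_nonpos_of_ae ?_
          filter_upwards [h0] with x hx
          have := mul_nonneg hx (by simpa using (hb x).1)
          simp only [Pi.zero_apply]; linarith)
        (TestFn.of_contDiff hφ hc) (fun x => by simpa using h1 x) ht
      simpa using this
  have h2 : ∫ x, max (-u t x) 0 = 0 :=
    le_antisymm h.2 (integral_nonneg fun x => le_max_right _ _)
  rw [integral_eq_zero_iff_of_nonneg
    (show 0 ≤ fun x => max (-u t x) 0 from fun x => le_max_right _ _) h.1] at h2
  filter_upwards [h2] with x hx
  have : -u t x ≤ 0 := (le_max_left _ _).trans hx.le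
  linarith

/-- `u - m` satisfies a transport equation with source `-m ∂ₓ V(W)`, which `max_source_le` controls
by the positive part of `u - m` and a damping term. Grönwall's inequality with zero datum and zero
forcing then makes this positive part vanish. -/
theorem BddSol.ae_le (hu : BddSol T M V k u) (hV : Vel A₁ A₂ V v)
    (hk : Kern CΓ k) {m : ℝ} (hm : 0 ≤ m) (hi : Integrable (u 0)) (h0 : ∀ᵐ x, u 0 x ≤ m) {t : ℝ}
    (ht : t ∈ Icc 0 T) : ∀ᵐ x, u t x ≤ m := by
  have hC : 0 ≤ m * A₁ * CΓ := mul_nonneg (mul_nonneg hm hV.A₁_nonneg) hk.bound_nonneg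
  have hle : ∀ s x, max (u s x - m) 0 ≤ |u s x| := fun s x =>
    max_le (by linarith [le_abs_self (u s x)]) (abs_nonneg _)
  have hpi : ∀ s ∈ Icc 0 T, Integrable fun x => max (u s x - m) 0 := fun s hs =>
    (hu.integrable_and_integral_abs_le hV hk hi hs).1.abs.mono'
      (((hu.meas s).sub_const m).max measurable_const).aestronglyMeasurable
      (Eventually.of_forall fun x => by
        rw [Real.norm_of_nonneg (le_max_right _ _)]; exact hle s x)
  have key := gronwall_family (ι := Unit) (f := fun _ s => ∫ x, max (u s x - m) 0) (T := T)
    (I₀ := 0) (K := m * A₁ * CΓ) (C := m * A₁ * CΓ) (B₀ := ∫ x, |u 0 x|) (β := fun _ => 0)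
    hC hC le_rfl continuous_const (fun _ => le_rfl) (fun _ s hs => by
      have h1 := hu.integrable_and_integral_abs_le hV hk hi hs
      exact (integral_mono (hpi s hs) h1.1.abs (hle s)).trans h1.2) ?_ () ht
  · have h2 : ∫ x, max (u t x - m) 0 = 0 := by
      refine le_antisymm (key.trans (by simp)) (integral_nonneg fun x => le_max_right _ _)
    rw [integral_eq_zero_iff_of_nonneg
      (show 0 ≤ fun x => max (u t x - m) 0 from fun x => le_max_right _ _) (hpi t ht)] at h2
    filter_upwards [h2] with x hx
    have : u t x - m ≤ 0 := (le_max_left _ _).trans hx.le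
    linarith
  · intro z hz hfz t ht _
    have hE := Real.exp_pos (m * A₁ * CΓ * t)
    have h := integrable_posPart_of_smooth (w := fun x => u t x - m) ((hu.meas t).sub_const m)
      (M := M + |m|) (fun x => (abs_sub _ _).trans (add_le_add (hu.bdd t x) le_rfl))
      (B := (Real.exp (m * A₁ * CΓ * t))⁻¹ * (0 + ∫ s in (0 : ℝ)..t, Real.exp (m * A₁ * CΓ * s)
        * (0 + (m * A₁ * CΓ + m * A₁ * CΓ) * z s))) fun φ hφ hc h1 => by
      have := hu.affine_bound hV hk (c := 1) (d := -m) (κ := 0) (C := m * A₁ * CΓ) (I₀ := 0)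
        (β := fun s => 0 + (m * A₁ * CΓ + m * A₁ * CΓ) * z s) hC (by fun_prop)
        (fun ψ hψ hb σ hσ => by
          have h3 := max_source_le hV hk hm (hu.meas σ) (hu.bdd σ) (hpi σ hσ) hψ
            (fun x => by simpa using hb x)
          have h4 := mul_le_mul_of_nonneg_left (hfz σ hσ ()) hC
          simp only [one_mul, neg_neg, ← sub_eq_add_neg]
          linarith)
        (fun ψ hψ hb => by
          refine integral_nonpos_of_ae ?_
          filter_upwards [h0] with x hx
          have := mul_nonneg (sub_nonneg.2 hx) (by simpa using (hb x).1)
          simp only [Pi.zero_apply]; linarith)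
        (TestFn.of_contDiff hφ hc) (fun x => by simpa using h1 x) ht
      simp only [one_mul, ← sub_eq_add_neg] at this
      rw [inv_mul_eq_div, le_div_iff₀ hE, mul_comm]
      exact this
    have h5 := h.2
    rw [inv_mul_eq_div, le_div_iff₀ hE, mul_comm] at h5
    exact h5

theorem corr_congr_ae {κ f g : ℝ → ℝ} (h : f =ᵐ[volume] g) (x : ℝ) : corr κ f x = corr κ g x := by
  have h' : ∀ᵐ z, f (x + z) = g (x + z) :=
    (measurePreserving_add_left volume x).quasiMeasurePreserving.ae h
  exact integral_congr_ae (h'.mono fun z hz => by simp only [hz])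

/-- A bounded solution with initial datum in `[0, m]` has a representative with values there. -/
theorem BddSol.exists_sol (hu : BddSol T M V k u) (hV : Vel A₁ A₂ V v)
    (hk : Kern CΓ k) {m C₁ : ℝ} (hm : 0 ≤ m) (hi : Integrable (u 0))
    (h0 : ∀ᵐ x, 0 ≤ u 0 x ∧ u 0 x ≤ m) (hC₁ : ∫ x, |u 0 x| ≤ C₁) :
    ∃ q, Sol T m C₁ V k q ∧ ∀ t ∈ Icc 0 T, q t =ᵐ[volume] u t := by
  classical
  -- Values are clamped, and set to zero outside `[0, T]`, because `Sol` asks for its bounds at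
  -- every time and every point.
  set q : ℝ → ℝ → ℝ := fun t x => if t ∈ Icc 0 T then max 0 (min m (u t x)) else 0 with hq
  have hb : ∀ t x, 0 ≤ q t x ∧ q t x ≤ m := fun t x => by
    simp only [hq]; split_ifs
    · exact ⟨le_max_left _ _, max_le hm (min_le_left _ _)⟩
    · exact ⟨le_rfl, hm⟩
  have hae : ∀ t ∈ Icc 0 T, q t =ᵐ[volume] u t := fun t ht => by
    filter_upwards [hu.ae_nonneg hV hk (h0.mono fun x h => h.1) ht,
      hu.ae_le hV hk hm hi (h0.mono fun x h => h.2) ht] with x h1 h2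
    simp only [hq, if_pos ht]
    rw [min_eq_right h2, max_eq_right h1]
  have hmeas : ∀ t, Measurable (q t) := fun t => by
    by_cases ht : t ∈ Icc 0 T
    · simp only [hq, if_pos ht]
      exact measurable_const.max (measurable_const.min (hu.meas t))
    · simp only [hq, if_neg ht]; exact measurable_const
  have hint : ∀ t, Integrable (q t) ∧ ∫ x, q t x ≤ C₁ := fun t => by
    by_cases ht : t ∈ Icc 0 T
    · have h1 := hu.integrable_and_integral_abs_le hV hk hi ht
      refine ⟨h1.1.congr (hae t ht).symm, ?_⟩
      rw [integral_congr_ae (hae t ht)]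
      exact (integral_mono h1.1 h1.1.abs fun x => le_abs_self _).trans (h1.2.trans hC₁)
    · have : q t = fun _ => 0 := by ext x; simp only [hq, if_neg ht]
      rw [this]
      exact ⟨integrable_zero _ _ _, by simpa using (integral_nonneg fun x => abs_nonneg _).trans hC₁⟩
  refine ⟨q, ⟨⟨hmeas, fun t x => ?_, fun ε hε => ?_, fun φ hφ s t hs hst ht => ?_⟩, hb,
    fun t => (hint t).1, fun t => (hint t).2⟩, hae⟩
  · rw [abs_of_nonneg (hb t x).1]; exact (hb t x).2
  · obtain ⟨η, hη, H⟩ := hu.cont ε hε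
    refine ⟨η, hη, fun s hs t ht hst => ?_⟩
    have e : (fun x => (q s x - q t x) ^ 2) =ᵐ[volume] fun x => (u s x - u t x) ^ 2 := by
      filter_upwards [hae s hs, hae t ht] with x h1 h2
      rw [h1, h2]
    rw [integral_congr_ae e]
    exact ⟨(H s hs t ht hst).1.congr e.symm, (H s hs t ht hst).2⟩
  · have e1 : ∀ t ∈ Icc 0 T, ∫ x, q t x * φ x = ∫ x, u t x * φ x := fun t ht =>
      integral_congr_ae ((hae t ht).mono fun x hx => by simp only [hx])
    rw [e1 t ⟨hs.trans hst, ht⟩, e1 s ⟨hs, hst.trans ht⟩, hu.eq φ hφ s t hs hst ht]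
    refine intervalIntegral.integral_congr fun σ hσ => ?_
    rw [uIcc_of_le hst] at hσ
    have hσT : σ ∈ Icc 0 T := ⟨hs.trans hσ.1, hσ.2.trans ht⟩
    refine integral_congr_ae ((hae σ hσT).mono fun x hx => ?_)
    simp only [hx, corr_congr_ae (hae σ hσT)]

theorem TestFn.comp_add {φ : ℝ → ℝ} (hφ : TestFn φ) (h : ℝ) :
    TestFn fun x => φ (x + h) where
  contDiff := hφ.contDiff.comp (contDiff_id.add contDiff_const)
  hasCompactSupport := hφ.hasCompactSupport.comp_homeomorph (Homeomorph.addRight h)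
  lipschitz_deriv := by
    obtain ⟨K, hK⟩ := hφ.lipschitz_deriv
    refine ⟨K, fun x y => ?_⟩
    rw [deriv_comp_add_const, deriv_comp_add_const]
    simpa using hK (x + h) (y + h)

theorem TestFn.neg {φ : ℝ → ℝ} (hφ : TestFn φ) : TestFn fun x => -φ x where
  contDiff := hφ.contDiff.neg
  hasCompactSupport := hφ.hasCompactSupport.neg
  lipschitz_deriv := by
    obtain ⟨K, hK⟩ := hφ.lipschitz_deriv
    refine ⟨K, fun x y => ?_⟩
    rw [deriv.fun_neg, deriv.fun_neg, ← abs_neg]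
    convert hK x y using 2; ring

/-- The nonlocal operator commutes with translations, so the equation is translation invariant. -/
theorem Sol.comp_add {m C₁ : ℝ} (hu : Sol T m C₁ V k u) (h : ℝ) :
    Sol T m C₁ V k fun t x => u t (x + h) where
  meas := fun t => (hu.meas t).comp (measurable_id.add_const h)
  bdd := fun t x => hu.bdd t (x + h)
  cont := hu.cont.comp_add h
  eq := fun φ hφ s t hs hst ht => by
    have e := hu.eq _ (hφ.comp_add (-h)) s t hs hst ht
    have e1 : ∀ t, ∫ x, u t (x + h) * φ x = ∫ x, u t x * φ (x + -h) := fun t => by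
      rw [← integral_add_right_eq_self (fun x => u t x * φ (x + -h)) h]
      simp only [add_neg_cancel_right]
    rw [e1, e1, e]
    congr 1; ext σ
    rw [← integral_add_right_eq_self _ h]
    simp only [deriv_comp_add_const, add_neg_cancel_right, corr_comp_add]
  bounds := fun t x => hu.bounds t (x + h)
  integrable := fun t => (hu.integrable t).comp_add_right h
  integral_le := fun t => by
    rw [integral_add_right_eq_self (u t) h]; exact hu.integral_le t

end Velocity

/-! ### Differences of solutions and the total variation -/

/-- Comparison of two solutions. -/
theorem Sol.diff_bound {T m C₁ C₁' A₁ A₂ A₁' A₂' CΓ CΓ' Λ I₀ C : ℝ} {V v V' v' k k' : ℝ → ℝ}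
    {q q' : ℝ → ℝ → ℝ} {β : ℝ → ℝ} (hq : Sol T m C₁ V k q) (hq' : Sol T m C₁' V' k' q')
    (hV : Vel A₁ A₂ V v) (hV' : Vel A₁' A₂' V' v') (hk : Kern CΓ k) (hk' : Kern CΓ' k')
    (hΛ : 0 ≤ Λ) (hC : 0 ≤ C) (hβ : Continuous β)
    (H : ∀ φ, TestFn φ → (∀ x, |φ x| ≤ 1) →
      (∀ x, |deriv φ x| ≤ Λ * Real.exp (A₁' * (2 * m * CΓ') * T)) → ∀ σ ∈ Icc 0 T,
      ∫ x, (V (corr k (q σ) x) - V' (corr k' (q' σ) x)) * q σ x * deriv φ x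
        ≤ β σ - C * ∫ x, (q σ x - q' σ x) * φ x)
    (H₀ : ∀ φ, TestFn φ → (∀ x, |φ x| ≤ 1) → ∫ x, (q 0 x - q' 0 x) * φ x ≤ I₀)
    {φ : ℝ → ℝ} (hφ : TestFn φ) (hφb : ∀ x, |φ x| ≤ 1)
    (hφΛ : ∀ x, |deriv φ x| ≤ Λ) {t : ℝ} (ht : t ∈ Icc 0 T) :
    Real.exp (C * t) * ∫ x, (q t x - q' t x) * φ x
      ≤ I₀ + ∫ σ in (0 : ℝ)..t, Real.exp (C * σ) * β σ := by
  have hm0 := hq.nonneg_bound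
  have hA := hV'.A₁_nonneg
  have hCΓ := hk'.bound_nonneg
  have hm : ∀ s, Measurable fun x => V (corr k (q s) x) := fun s =>
    measurable_vel_corr hV hk (hq.meas s)
  have hb : ∀ s x, |V (corr k (q s) x)| ≤ A₁ * m + |V 0| := fun s =>
    hV.abs_comp_corr_le hk (hq.bdd s)
  have hm' : ∀ s, Measurable fun x => V' (corr k' (q' s) x) := fun s =>
    measurable_vel_corr hV' hk' (hq'.meas s)
  have hb' : ∀ s x, |V' (corr k' (q' s) x)| ≤ A₁' * m + |V' 0| := fun s =>
    hV'.abs_comp_corr_le hk' (hq'.bdd s)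
  have hwm : ∀ s, Measurable fun x => q s x - q' s x := fun s => (hq.meas s).sub (hq'.meas s)
  have hwb : ∀ s x, |q s x - q' s x| ≤ m := fun s x =>
    abs_sub_le_of_nonneg_of_le (hq.bounds s x).1 (hq.bounds s x).2 (hq'.bounds s x).1
      (hq'.bounds s x).2
  have hwl : LocCont T fun s x => q s x - q' s x :=
    (hq.cont.sub hq'.cont hq.meas hq'.meas).locCont hwm hwb
  refine transport_bound (L := A₁' * (2 * m * CΓ')) (κ := 1) (by positivity) hΛ hC
    (a := fun s x => V' (corr k' (q' s) x))
    (fun s => hV'.comp_corr_lip hk' (hq'.meas s) (hq'.bdd s)) hb'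
    hwm hwb (hq'.unifCont_vel hV' hk') hwl hβ
    (fun ψ σ => (∫ x, V (corr k (q σ) x) * q σ x * deriv ψ x)
      - ∫ x, V' (corr k' (q' σ) x) * q' σ x * deriv ψ x)
    (fun ψ hψ => (hq.continuousOn_flux hV hk hψ).sub (hq'.continuousOn_flux hV' hk' hψ))
    (fun ψ hψ s t hs hst ht => ?_)
    (fun ψ hψ hψb hψΛ σ hσ => ?_) (fun ψ hψ hψb => H₀ ψ hψ fun x => abs_le.2 (hψb x))
    hφ (fun x => abs_le.1 (hφb x)) hφΛ ht
  · have e : ∀ s, ∫ x, (q s x - q' s x) * ψ x = (∫ x, q s x * ψ x) - ∫ x, q' s x * ψ x :=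
      fun s => by
        simp_rw [sub_mul]
        exact integral_sub (hψ.integrable_mul (hq.meas s) (hq.bdd s))
          (hψ.integrable_mul (hq'.meas s) (hq'.bdd s))
    have hsub : uIcc s t ⊆ Icc 0 T := by rw [uIcc_of_le hst]; exact Icc_subset_Icc hs ht
    rw [e, e, intervalIntegral.integral_sub
      ((hq.continuousOn_flux hV hk hψ).mono hsub).intervalIntegrable
      ((hq'.continuousOn_flux hV' hk' hψ).mono hsub).intervalIntegrable,
      ← hq.eq ψ hψ s t hs hst ht, ← hq'.eq ψ hψ s t hs hst ht]
    ring
  · have h1 := H ψ hψ (fun x => abs_le.2 (hψb x)) hψΛ σ hσ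
    have i : ∀ a w : ℝ → ℝ, Measurable a → Measurable w → ∀ A B : ℝ, (∀ x, |a x| ≤ A) →
        (∀ x, |w x| ≤ B) → Integrable fun x => a x * w x * deriv ψ x := fun a w ha hw A B hA hB => by
      refine hψ.integrable_mul_deriv (ha.mul hw) (M := A * B) fun x => ?_
      rw [abs_mul]
      exact mul_le_mul (hA x) (hB x) (abs_nonneg _) ((abs_nonneg _).trans (hA x))
    have i1 := i _ _ (hm σ) (hq.meas σ) _ _ (hb σ) (hq.bdd σ)
    have i2 := i _ _ (hm' σ) (hq'.meas σ) _ _ (hb' σ) (hq'.bdd σ)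
    have i3 := i _ _ (hm' σ) (hwm σ) _ _ (hb' σ) (hwb σ)
    have i4 : Integrable fun x =>
        (V (corr k (q σ) x) - V' (corr k' (q' σ) x)) * q σ x * deriv ψ x :=
      i _ _ ((hm σ).sub (hm' σ)) (hq.meas σ) _ _
        (fun x => (abs_sub _ _).trans (add_le_add (hb σ x) (hb' σ x))) (hq.bdd σ)
    -- The split is asymmetric: the difference is transported by the second velocity, and the
    -- difference of the velocities multiplies the first solution. Hence the final constants involve
    -- only the variation of `q`.
    have e : (∫ x, V (corr k (q σ) x) * q σ x * deriv ψ x)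
          - ∫ x, V' (corr k' (q' σ) x) * q' σ x * deriv ψ x
        = (∫ x, V' (corr k' (q' σ) x) * (q σ x - q' σ x) * deriv ψ x)
          + ∫ x, (V (corr k (q σ) x) - V' (corr k' (q' σ) x)) * q σ x * deriv ψ x := by
      rw [← integral_sub i1 i2, ← integral_add i3 i4]
      congr 1; ext x; ring
    rw [e]; linarith

section TotalVariation

variable {T m C₁ A₁ A₂ CΓ : ℝ} {V v k : ℝ → ℝ} {u : ℝ → ℝ → ℝ}

theorem Sol.nonneg_bound (hu : Sol T m C₁ V k u) : 0 ≤ m :=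
  (hu.bounds 0 0).1.trans (hu.bounds 0 0).2

theorem Sol.nonneg_mass (hu : Sol T m C₁ V k u) : 0 ≤ C₁ :=
  (integral_nonneg fun x => (hu.bounds 0 x).1).trans (hu.integral_le 0)

theorem Sol.integral_shift_mul_le (hu : Sol T m C₁ V k u) {K : ℝ} (h0 : ShiftBd (u 0) K)
    {h : ℝ} (hh : 0 < h) {φ : ℝ → ℝ} (hφ : ∀ x, |φ x| ≤ 1) :
    ∫ x, (u 0 (x + h) - u 0 x) * φ x ≤ h * K := by
  have := h0 h
  rw [abs_of_pos hh, mul_comm] at this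
  refine le_trans (abs_integral_le_integral_of_le
    ((((hu.integrable 0).comp_add_right h).sub (hu.integrable 0)).abs) fun x => ?_) this
  rw [abs_mul]
  exact mul_le_of_le_one_right (abs_nonneg _) (hφ x)

/-- Solutions with initial data of bounded variation have bounded variation, at each scale. -/
theorem Sol.scaleBd (hu : Sol T m C₁ V k u) (hV : Vel A₁ A₂ V v) (hk : Kern CΓ k) {K₀ : ℝ}
    (h0 : ShiftBd (u 0) K₀) {Λ : ℝ} (hΛ : 0 < Λ) {t : ℝ} (ht : t ∈ Icc 0 T) :
    ScaleBd Λ (u t) ((K₀ + ∫ _s in (0 : ℝ)..t, 2 * A₂ * m ^ 2 * CΓ ^ 2 * C₁)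
      * Real.exp ((12 * A₁ * m * CΓ + 4 * A₂ * m ^ 2 * CΓ)
        * Real.exp (A₁ * (2 * m * CΓ) * T) * t)) := by
  have hm := hu.nonneg_bound
  have hC₁ := hu.nonneg_mass
  have hA₁ := hV.A₁_nonneg
  have hA₂ := hV.A₂_nonneg
  have hCΓ := hk.bound_nonneg
  have hT : 0 ≤ T := ht.1.trans ht.2
  set c := Real.exp (A₁ * (2 * m * CΓ) * T) with hc
  have hc1 : 1 ≤ c := Real.one_le_exp (by positivity)
  set P := 12 * A₁ * m * CΓ + 4 * A₂ * m ^ 2 * CΓ with hP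
  have hP0 : 0 ≤ P := by positivity
  intro φ hφ hφ1 hφΛ
  -- The a priori bound `Λ C₁` depends on `Λ`, but Grönwall's inequality only needs it to be finite;
  -- the rate `P c` does not depend on `Λ`.
  refine gronwall_family
    (ι := {φ : ℝ → ℝ // TestFn φ ∧ (∀ x, |φ x| ≤ 1) ∧ ∀ x, |deriv φ x| ≤ Λ})
    (f := fun φ s => ∫ x, u s x * deriv φ.1 x) (T := T) (I₀ := K₀) (K := P * c) (C := 0)
    (B₀ := Λ * C₁) (β := fun _ => 2 * A₂ * m ^ 2 * CΓ ^ 2 * C₁) (by positivity) le_rfl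
    h0.nonneg continuous_const (fun _ => by positivity) (fun i s _ => ?_) ?_ ⟨φ, hφ, hφ1, hφΛ⟩ ht
  · have h1 : ∫ x, u s x * deriv i.1 x ≤ ∫ x, Λ * u s x :=
      abs_integral_le_integral_of_le ((hu.integrable s).const_mul Λ) fun x => by
        rw [abs_mul, abs_of_nonneg (hu.bounds s x).1, mul_comm]
        exact mul_le_mul_of_nonneg_right (i.2.2.2 x) (hu.bounds s x).1
    rw [integral_const_mul] at h1
    exact h1.trans (mul_le_mul_of_nonneg_left (hu.integral_le s) hΛ.le)
  · rintro z hz hfz t ht ⟨φ, hφ, hφ1, hφΛ⟩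
    simp only [zero_mul, Real.exp_zero, one_mul, add_zero]
    refine integral_mul_deriv_le_of_shift (hu.meas t) (hu.bdd t) hφ.contDiff
      hφ.hasCompactSupport (B' := 0) fun h hh _ => ?_
    -- The translate is another solution of the same equation. The test `-φ (· + h)` turns the
    -- backward difference of `u` into the forward one.
    have key := Sol.diff_bound (hu.comp_add h) hu hV hV hk hk hΛ.le le_rfl
      (β := fun s => h * (P * (z s * c) + 2 * A₂ * m ^ 2 * CΓ ^ 2 * C₁)) (I₀ := h * K₀) (C := 0)
      (by fun_prop) (fun ψ hψ hψ1 hψΛ σ hσ => ?_)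
      (fun ψ _ hψ1 => hu.integral_shift_mul_le h0 hh hψ1)
      (φ := fun x => -φ (x + h)) (hφ.comp_add h).neg (fun x => by simpa using hφ1 (x + h))
      (fun x => by
        rw [deriv.fun_neg, deriv_comp_add_const, abs_neg]; exact hφΛ (x + h)) ht
    · simp only [zero_mul, Real.exp_zero, one_mul] at key
      have e : ∫ x, (u t (x - h) - u t x) * φ x
          = ∫ x, (u t (x + h) - u t x) * -φ (x + h) := by
        rw [← integral_add_right_eq_self (fun x => (u t (x - h) - u t x) * φ x) h]
        congr 1; ext x; rw [add_sub_cancel_right]; ring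
      rw [e]
      refine key.trans (le_of_eq ?_)
      rw [intervalIntegral.integral_const_mul, mul_add]
      simp only [mul_zero, add_zero]
      congr 2
      refine intervalIntegral.integral_congr fun s _ => ?_
      ring
    · simp only [corr_comp_add, zero_mul, sub_zero]
      refine scale_source_le hV hk (hu.meas σ) (hu.bounds σ) (hu.integrable σ) (hu.integral_le σ)
        (Λ := Λ * c) (by positivity) ?_ hh hψ hψ1 hψΛ
      -- Transport enlarges slopes of tests by the factor `c`; the bound `z σ` for slopes up to `Λ`
      -- becomes `z σ * c` for slopes up to `Λ c`.
      exact ScaleBd.scale (fun χ h1 h2 h3 => hfz σ hσ ⟨χ, h1, h2, h3⟩) hc1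

/-- The constant of `Sol.scaleBd` is independent of `Λ`, so the restriction on the slope can be
dropped. The bound is not sharp; it only provides the finiteness that the later estimates
presuppose. -/
theorem Sol.exists_shiftBd (hu : Sol T m C₁ V k u) (hV : Vel A₁ A₂ V v) (hk : Kern CΓ k) {K₀ : ℝ}
    (h0 : ShiftBd (u 0) K₀) : ∃ K, ∀ t ∈ Icc 0 T, ShiftBd (u t) K := by
  have hm := hu.nonneg_bound
  have hC₁ := hu.nonneg_mass
  have hA₁ := hV.A₁_nonneg
  have hA₂ := hV.A₂_nonneg
  have hCΓ := hk.bound_nonneg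
  refine ⟨_, fun t ht => ScaleBd.shiftBd (K := (K₀ + T * (2 * A₂ * m ^ 2 * CΓ ^ 2 * C₁))
      * Real.exp ((12 * A₁ * m * CΓ + 4 * A₂ * m ^ 2 * CΓ)
        * Real.exp (A₁ * (2 * m * CΓ) * T) * T)) (fun Λ φ hφ h1 h2 => ?_) (hu.meas t) (hu.bdd t)⟩
  have h3 := hu.scaleBd hV hk h0 (Λ := max Λ 1) (by positivity) ht φ hφ h1
    fun x => (h2 x).trans (le_max_left _ _)
  refine h3.trans ?_
  have hK₀ := h0.nonneg
  have hT := ht.2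
  have ht0 := ht.1
  have : 0 ≤ K₀ + T * (2 * A₂ * m ^ 2 * CΓ ^ 2 * C₁) := by
    have := ht0.trans hT
    positivity
  rw [intervalIntegral.integral_const, smul_eq_mul, sub_zero]
  gcongr

/-- The total variation estimate. -/
theorem Sol.shiftBd_tvConst (hu : Sol T m C₁ V k u) (hV : Vel A₁ A₂ V v) (hk : Kern CΓ k) {K₀ : ℝ}
    (h0 : ShiftBd (u 0) K₀) {t : ℝ} (ht : t ∈ Icc 0 T) :
    ShiftBd (u t) (tvConst K₀ C₁ m CΓ A₁ A₂ t) := by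
  have hm := hu.nonneg_bound
  have hC₁ := hu.nonneg_mass
  have hA₁ := hV.A₁_nonneg
  have hA₂ := hV.A₂_nonneg
  have hCΓ := hk.bound_nonneg
  obtain ⟨B₀, hB₀⟩ := hu.exists_shiftBd hV hk h0
  set C := A₁ * m * CΓ with hC
  have hC0 : 0 ≤ C := by positivity
  refine ShiftBd.of_pos fun h hh => ?_
  -- The family consists of all difference quotients. Per unit of `h`, the source yields `C z` from
  -- the sup norm of the velocity difference and `2 C z` from the nonlocal term, so `K + C = 3 C`.
  -- The weight gives back one `C`, which leaves the rate `2 C`.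
  have key := gronwall_family (ι := {h : ℝ // 0 < h})
    (f := fun h s => (∫ x, |u s (x + h.1) - u s x|) / h.1) (T := T) (I₀ := K₀) (K := 2 * C)
    (C := C) (B₀ := B₀) (β := fun _ => A₂ * C₁ * m ^ 2 * CΓ ^ 2) (by positivity) hC0
    h0.nonneg continuous_const (fun _ => by positivity) (fun i s hs => ?_) ?_ ⟨h, hh⟩ ht
  · rw [intervalIntegral.integral_const, smul_eq_mul, sub_zero, div_le_iff₀ hh] at key
    refine key.trans (le_of_eq ?_)
    rw [tvConst, hC]
    congr 2
    · ring
    · congr 1; ring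
  · have := hB₀ s hs i.1
    rwa [abs_of_pos i.2, ← div_le_iff₀ i.2] at this
  · rintro z hz hfz t ht ⟨h, hh⟩
    have hE := Real.exp_pos (C * t)
    have hzs : ∀ s ∈ Icc 0 T, ShiftBd (u s) (z s) := fun s hs => ShiftBd.of_pos fun η hη =>
      (div_le_iff₀ hη).1 (hfz s hs ⟨η, hη⟩)
    set J := ∫ s in (0 : ℝ)..t, Real.exp (C * s)
      * (A₂ * C₁ * m ^ 2 * CΓ ^ 2 + (2 * C + C) * z s) with hJ
    have hbd := integrable_abs_of_smooth (w := fun x => u t (x + h) - u t x)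
      (((hu.meas t).comp (measurable_id.add_const h)).sub (hu.meas t)) (M := 2 * m)
      (fun x => abs_sub_le_two_mul (hu.bdd t) _ _)
      (B := (Real.exp (C * t))⁻¹ * (h * (K₀ + J))) fun φ hφ hc hφ1 => by
        have hφt := TestFn.of_contDiff hφ hc
        obtain ⟨Λ, hΛ, hφΛ⟩ := hφt.exists_abs_deriv_le
        have key := Sol.diff_bound (hu.comp_add h) hu hV hV hk hk hΛ.le hC0
          (β := fun s => h * (A₂ * C₁ * m ^ 2 * CΓ ^ 2 + (2 * C + C) * z s)) (I₀ := h * K₀)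
          (C := C) (by fun_prop) (fun ψ hψ hψ1 _ σ hσ => ?_)
          (fun ψ _ hψ1 => hu.integral_shift_mul_le h0 hh hψ1) hφt hφ1 hφΛ ht
        · rw [inv_mul_eq_div, le_div_iff₀ hE, mul_comm]
          refine key.trans (le_of_eq ?_)
          rw [mul_add, hJ, ← intervalIntegral.integral_const_mul]
          congr 2; ext s; ring
        · have hD : ∀ x, |corr k (fun y => u σ (y + h)) x - corr k (u σ) x| ≤ m * CΓ * h :=
            fun x => by
              rw [corr_comp_add]
              simpa [abs_of_pos hh] using hk.abs_corr_sub_le (hu.meas σ) (hu.bounds σ) (x + h) x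
          have hi := (hu.integrable σ).comp_add_right h
          have hD₁ : ∫ x, u σ (x + h) * |corr k (fun y => u σ (y + h)) x - corr k (u σ) x|
              ≤ m * CΓ * h * C₁ := by
            refine (abs_integral_le_integral_of_le (hi.const_mul (m * CΓ * h)) fun x => ?_).trans
              (b := ∫ x, m * CΓ * h * u σ (x + h)) ?_
            · rw [abs_mul, abs_abs, abs_of_nonneg (hu.bounds σ _).1, mul_comm]
              exact mul_le_mul_of_nonneg_right (hD x) (hu.bounds σ _).1
            · rw [integral_const_mul, integral_add_right_eq_self (u σ) h]
              exact mul_le_mul_of_nonneg_left (hu.integral_le σ) (by positivity)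
          have h1 := stability_source_le hV hV hk hk (N₀ := 0) (N₁ := 0) (G := 0)
            (fun s _ => by simp) (fun s _ => by simp) ((hu.comp_add h).meas σ) (hu.meas σ)
            ((hu.comp_add h).bounds σ) (hu.bounds σ) hi (hu.integrable σ)
            ((hzs σ hσ).comp_add h) (hzs σ hσ) hD hD₁ (by simp) ((hu.comp_add h).integral_le σ)
            hψ hψ1
          have h2 := hzs σ hσ h
          rw [abs_of_pos hh] at h2
          have h3 := mul_le_mul_of_nonneg_left h2 hC0
          simp only [hC] at h3 ⊢
          linarith
    have h5 := hbd.2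
    rw [inv_mul_eq_div, le_div_iff₀ hE] at h5
    change Real.exp (C * t) * ((∫ x, |u t (x + h) - u t x|) / h) ≤ K₀ + J
    rw [mul_div_assoc', div_le_iff₀ hh]
    linarith

end TotalVariation

/-! ### Stability in datum, velocity and kernel -/

theorem continuous_tvConst (K₀ C₁ m CΓ A₁ A₂ : ℝ) : Continuous (tvConst K₀ C₁ m CΓ A₁ A₂) := by
  unfold tvConst; fun_prop

theorem tvConst_mono {K₀ C₁ m CΓ A₁ A₂ B₁ B₂ s t : ℝ} (hK : 0 ≤ K₀) (hC : 0 ≤ C₁) (hm : 0 ≤ m)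
    (hΓ : 0 ≤ CΓ) (h1 : 0 ≤ A₁) (h2 : 0 ≤ A₂) (hs : 0 ≤ s) (hst : s ≤ t) (h1' : A₁ ≤ B₁)
    (h2' : A₂ ≤ B₂) : tvConst K₀ C₁ m CΓ A₁ A₂ s ≤ tvConst K₀ C₁ m CΓ B₁ B₂ t := by
  have := hs.trans hst
  have := h1.trans h1'
  have := h2.trans h2'
  unfold tvConst
  gcongr

theorem tvConst_nonneg {K₀ C₁ m CΓ A₁ A₂ s : ℝ} (hK : 0 ≤ K₀) (hC : 0 ≤ C₁)
    (h2 : 0 ≤ A₂) (hs : 0 ≤ s) : 0 ≤ tvConst K₀ C₁ m CΓ A₁ A₂ s := by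
  unfold tvConst; positivity

/-- The comparison passes through `corr k' q`. The term with `q - q'` is left explicit, since it is
needed both in the sup norm and in `L¹`. -/
theorem abs_corr_sub_corr_le {k k' q q' : ℝ → ℝ} (hk : Integrable k) (hk' : Integrable k')
    (hq : Measurable q) (hq' : Measurable q') {m : ℝ} (hm : ∀ x, |q x| ≤ m)
    (hm' : ∀ x, |q' x| ≤ m) {G : ℝ} (hG : ∫ z, |k z - k' z| ≤ G) (x : ℝ) :
    |corr k q x - corr k' q' x| ≤ m * G + |corr k' (fun y => q y - q' y) x| := by
  have h1 := abs_corr_le (hk.sub hk') hm x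
  have h2 := corr_sub_left hk hk' hq hm x
  have h3 := corr_sub_right hk' hq hq' hm hm' x
  have hm0 : 0 ≤ m := (abs_nonneg _).trans (hm 0)
  have e : corr k q x - corr k' q' x
      = corr (fun z => k z - k' z) q x + corr k' (fun y => q y - q' y) x := by
    rw [h2, h3]; ring
  rw [e]
  refine (abs_add_le _ _).trans (add_le_add (h1.trans ?_) le_rfl)
  rw [mul_comm]
  exact mul_le_mul_of_nonneg_left hG hm0

/-- Stability of solutions with respect to initial datum, velocity and kernel. -/
theorem Sol.stability {T m C₁ A₁ A₂ A₁' A₂' CΓ K₀ K₀' N₀ N₁ G I₀ : ℝ} {V v V' v' k k' : ℝ → ℝ}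
    {q q' : ℝ → ℝ → ℝ} (hq : Sol T m C₁ V k q) (hq' : Sol T m C₁ V' k' q')
    (hV : Vel A₁ A₂ V v) (hV' : Vel A₁' A₂' V' v') (hk : Kern CΓ k) (hk' : Kern CΓ k')
    (h0 : ShiftBd (q 0) K₀) (h0' : ShiftBd (q' 0) K₀')
    (hN₀ : ∀ s ∈ Icc 0 m, |V s - V' s| ≤ N₀) (hN₁ : ∀ s ∈ Icc 0 m, |v s - v' s| ≤ N₁)
    (hG : ∫ z, |k z - k' z| ≤ G) (hI₀ : ∫ x, |q 0 x - q' 0 x| ≤ I₀) {t : ℝ} (ht : t ∈ Icc 0 T) :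
    ∫ x, |q t x - q' t x| ≤ (I₀ + ∫ s in (0 : ℝ)..t,
        ((N₀ + (A₁ + A₁') * m * G) * max 0 (tvConst K₀ C₁ m CΓ A₁ A₂ s)
          + m * CΓ * C₁ * (N₁ + A₂ * m * G)))
      * Real.exp ((A₁ * CΓ * tvConst K₀ C₁ m CΓ A₁ A₂ T + m ^ 2 * CΓ * A₂ + A₁' * m * CΓ) * t) := by
  have hm := hq.nonneg_bound
  have hC₁ := hq.nonneg_mass
  have hA₁ := hV.A₁_nonneg
  have hA₂ := hV.A₂_nonneg
  have hA₁' := hV'.A₁_nonneg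
  have hCΓ := hk.bound_nonneg
  have hK₀ := h0.nonneg
  have hT : 0 ≤ T := ht.1.trans ht.2
  have hN₀0 : 0 ≤ N₀ := (abs_nonneg _).trans (hN₀ 0 ⟨le_rfl, hm⟩)
  have hN₁0 : 0 ≤ N₁ := (abs_nonneg _).trans (hN₁ 0 ⟨le_rfl, hm⟩)
  have hG0 : 0 ≤ G := (integral_nonneg fun _ => abs_nonneg _).trans hG
  set τ := tvConst K₀ C₁ m CΓ A₁ A₂ with hτ
  have hτ0 : ∀ s, 0 ≤ s → 0 ≤ τ s := fun s hs => tvConst_nonneg hK₀ hC₁ hA₂ hs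
  have hτc : Continuous τ := continuous_tvConst ..
  set C := A₁' * m * CΓ with hC
  have hC0 : 0 ≤ C := by positivity
  have hτT := hτ0 T hT
  set K := A₁ * CΓ * τ T + m ^ 2 * CΓ * A₂ + C with hK
  have hi : ∀ s, Integrable fun x => q s x - q' s x := fun s =>
    (hq.integrable s).sub (hq'.integrable s)
  -- In `K + C` the part `2 C` comes from the nonlocal term, `A₁ CΓ τ T` from the sup norm of the
  -- velocity difference, and `m² CΓ A₂` from the difference of the slopes. The maximum with `0`
  -- keeps the forcing nonnegative at negative times, where `τ` may change sign.
  refine gronwall_family (ι := Unit) (f := fun _ s => ∫ x, |q s x - q' s x|) (T := T) (I₀ := I₀)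
    (K := K) (C := C) (B₀ := C₁ + C₁) (by positivity) hC0
    ((integral_nonneg fun _ => abs_nonneg _).trans hI₀)
    (β := fun s => (N₀ + (A₁ + A₁') * m * G) * max 0 (τ s) + m * CΓ * C₁ * (N₁ + A₂ * m * G))
    (by fun_prop) (fun s => by positivity) (fun _ s _ => ?_) ?_ () ht
  · refine le_trans ?_ (add_le_add (hq.integral_le s) (hq'.integral_le s))
    rw [← integral_add (hq.integrable s) (hq'.integrable s)]
    refine integral_mono (hi s).abs ((hq.integrable s).add (hq'.integrable s)) fun x => ?_
    have h1 := (hq.bounds s x).1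
    have h2 := (hq'.bounds s x).1
    exact abs_le.2 ⟨by beta_reduce; linarith, by beta_reduce; linarith⟩
  · rintro z hz hfz t ht -
    have hE := Real.exp_pos (C * t)
    set J := ∫ s in (0 : ℝ)..t, Real.exp (C * s)
      * ((N₀ + (A₁ + A₁') * m * G) * max 0 (τ s) + m * CΓ * C₁ * (N₁ + A₂ * m * G)
        + (K + C) * z s) with hJ
    -- For `q'` any finite variation suffices: it enters the source estimate only at second order in
    -- the shift.
    obtain ⟨B', hB'⟩ := hq'.exists_shiftBd hV' hk' h0'
    have hbd := integrable_abs_of_smooth (w := fun x => q t x - q' t x)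
      ((hq.meas t).sub (hq'.meas t)) (M := m + m)
      (fun x => (abs_sub _ _).trans (add_le_add (hq.bdd t x) (hq'.bdd t x)))
      (B := (Real.exp (C * t))⁻¹ * (I₀ + J)) fun φ hφ hc hφ1 => by
        have hφt := TestFn.of_contDiff hφ hc
        obtain ⟨Λ, hΛ, hφΛ⟩ := hφt.exists_abs_deriv_le
        have key := Sol.diff_bound hq hq' hV hV' hk hk' hΛ.le hC0
          (β := fun s => (N₀ + (A₁ + A₁') * m * G) * max 0 (τ s)
            + m * CΓ * C₁ * (N₁ + A₂ * m * G) + (K + C) * z s) (I₀ := I₀)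
          (C := C) (by fun_prop) (fun ψ hψ hψ1 _ σ hσ => ?_)
          (fun ψ _ hψ1 => (abs_integral_le_integral_of_le (hi 0).abs fun x => by
            rw [abs_mul]; exact mul_le_of_le_one_right (abs_nonneg _) (hψ1 x)).trans hI₀)
          hφt hφ1 hφΛ ht
        · rw [inv_mul_eq_div, le_div_iff₀ hE, mul_comm]
          exact key
        · have hz0 : ∫ x, |q σ x - q' σ x| ≤ z σ := hfz σ hσ ()
          have hz1 : 0 ≤ z σ := (integral_nonneg fun _ => abs_nonneg _).trans hz0
          have hsub := abs_corr_sub_corr_le hk.integrable hk'.integrable (hq.meas σ) (hq'.meas σ)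
            (hq.bdd σ) (hq'.bdd σ) hG
          have hD : ∀ x, |corr k (q σ) x - corr k' (q' σ) x| ≤ m * G + CΓ * z σ := fun x =>
            (hsub x).trans (add_le_add le_rfl ((abs_corr_le_of_bdd hk'.abs_le (hi σ) x).trans
              (mul_le_mul_of_nonneg_left hz0 hCΓ)))
          have hci := integrable_corr hk'.integrable (hi σ)
          have hD₁ : ∫ x, q σ x * |corr k (q σ) x - corr k' (q' σ) x| ≤ m * G * C₁ + m * z σ := by
            refine (abs_integral_le_integral_of_le (((hq.integrable σ).const_mul (m * G)).add
              (hci.abs.const_mul m)) fun x => ?_).trans (b := ∫ x, (m * G * q σ x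
                + m * |corr k' (fun y => q σ y - q' σ y) x|)) ?_
            · have h1 := mul_le_mul_of_nonneg_left (hsub x) (hq.bounds σ x).1
              have h2 := mul_le_mul_of_nonneg_right (hq.bounds σ x).2
                (abs_nonneg (corr k' (fun y => q σ y - q' σ y) x))
              rw [abs_mul, abs_abs, abs_of_nonneg (hq.bounds σ _).1]
              simp only [Pi.add_apply]
              linarith
            · rw [integral_add ((hq.integrable σ).const_mul (m * G)) (hci.abs.const_mul m),
                integral_const_mul, integral_const_mul]
              have h1 := integral_abs_corr_le hk'.integrable (hi σ)
              rw [hk'.integral_abs, one_mul] at h1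
              exact add_le_add (mul_le_mul_of_nonneg_left (hq.integral_le σ) (by positivity))
                (mul_le_mul_of_nonneg_left (h1.trans hz0) hm)
          have h1 := stability_source_le hV hV' hk hk' hN₀ hN₁ (hq.meas σ) (hq'.meas σ)
            (hq.bounds σ) (hq'.bounds σ) (hq.integrable σ) (hq'.integrable σ)
            (hq.shiftBd_tvConst hV hk h0 hσ) (hB' σ hσ) hD hD₁ hG (hq.integral_le σ) hψ hψ1
          have h2 := mul_le_mul_of_nonneg_left hz0 hC0
          have h3 : τ σ ≤ τ T := tvConst_mono hK₀ hC₁ hm hCΓ hA₁ hA₂ hσ.1 hσ.2 le_rfl le_rfl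
          have h4 := mul_le_mul_of_nonneg_right h3 (show 0 ≤ A₁ * CΓ * z σ by positivity)
          rw [max_eq_right (hτ0 σ hσ.1)]
          simp only [hK, hC] at h2 ⊢
          rw [← hτ] at h1
          linarith
    have h5 := hbd.2
    rw [inv_mul_eq_div, le_div_iff₀ hE] at h5
    change Real.exp (C * t) * (∫ x, |q t x - q' t x|) ≤ I₀ + J
    linarith

/-! ### Weak derivatives and the time-integrated form of the equation -/

theorem integrable_mul_of_continuous {μ : Measure ℝ} {D g : ℝ → ℝ} (hD : Integrable D μ)
    (hg : Continuous g) (hc : HasCompactSupport g) : Integrable (fun x => D x * g x) μ := by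
  obtain ⟨C, -, hC⟩ := exists_abs_le hg hc
  exact hD.mul_bdd hg.aestronglyMeasurable (c := C) (Eventually.of_forall hC)

theorem setIntegral_mul_eq {a b : ℝ} {g : ℝ → ℝ} (h : tsupport g ⊆ Ioo a b) (f : ℝ → ℝ) :
    ∫ x in Ioo a b, f x * g x = ∫ x, f x * g x :=
  setIntegral_eq_integral_of_forall_compl_eq_zero fun x hx => by
    rw [image_eq_zero_of_notMem_tsupport fun h' => hx (h h'), mul_zero]

/-- A smooth function of zero mean, compactly supported in an interval, is the derivative of such
a function. -/
theorem exists_primitive_of_integral_eq_zero {a b : ℝ} {ψ : ℝ → ℝ} (hψ : ContDiff ℝ ∞ ψ)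
    (hc : HasCompactSupport ψ) (hs : tsupport ψ ⊆ Ioo a b) (h0 : ∫ x, ψ x = 0) :
    ∃ φ : ℝ → ℝ, ContDiff ℝ ∞ φ ∧ HasCompactSupport φ ∧ tsupport φ ⊆ Ioo a b ∧ deriv φ = ψ := by
  rcases (tsupport ψ).eq_empty_or_nonempty with he | hne
  · refine ⟨fun _ => 0, contDiff_const, HasCompactSupport.zero, by simp [tsupport], ?_⟩
    rw [tsupport_eq_empty_iff.1 he]; ext x; simp
  obtain ⟨a', ha', hmin⟩ := hc.isCompact.exists_isLeast hne
  obtain ⟨b', hb', hmax⟩ := hc.isCompact.exists_isGreatest hne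
  have hz : ∀ x, x ∉ Icc a' b' → ψ x = 0 := fun x hx =>
    image_eq_zero_of_notMem_tsupport fun h' => hx ⟨hmin h', hmax h'⟩
  have hd : ∀ x, HasDerivAt (fun x => ∫ y in a..x, ψ y) (ψ x) x := fun x =>
    intervalIntegral.integral_hasDerivAt_right (hψ.continuous.intervalIntegrable _ _)
      (hψ.continuous.stronglyMeasurableAtFilter _ _) hψ.continuous.continuousAt
  have hde : deriv (fun x => ∫ y in a..x, ψ y) = ψ := funext fun x => (hd x).deriv
  have hsupp : Function.support (fun x => ∫ y in a..x, ψ y) ⊆ Icc a' b' := by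
    intro x hx
    by_contra hxn
    refine hx ?_
    rcases lt_or_ge x a' with h | h
    · refine (intervalIntegral.integral_congr (g := fun _ => 0) fun y hy => hz y fun hy' => ?_).trans
        (by simp)
      have : y ≤ max a x := hy.2
      exact absurd (hy'.1.trans this) (not_le.2 (max_lt (hs ha').1 h))
    · have hxb : b' < x := by
        by_contra h'; exact hxn ⟨h, not_lt.1 h'⟩
      change ∫ y in a..x, ψ y = 0
      rw [intervalIntegral.integral_eq_integral_of_support_subset, h0]
      intro y hy
      have h1 := subset_tsupport _ hy
      exact ⟨(hs h1).1, (hmax h1).trans hxb.le⟩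
  refine ⟨fun x => ∫ y in a..x, ψ y, ?_, ?_, ?_, hde⟩
  · rw [contDiff_infty_iff_deriv, hde]
    exact ⟨fun x => (hd x).differentiableAt, hψ⟩
  · exact HasCompactSupport.of_support_subset_isCompact isCompact_Icc hsupp
  · exact (closure_minimal hsupp isClosed_Icc).trans (Icc_subset_Ioo (hs ha').1 (hs hb').2)

/-- The lemma of du Bois-Reymond. -/
theorem exists_const_of_integral_mul_deriv_eq_zero {a b : ℝ} (hab : a < b) {D : ℝ → ℝ}
    (hD : IntegrableOn D (Ioo a b))
    (H : ∀ φ : ℝ → ℝ, ContDiff ℝ ∞ φ → HasCompactSupport φ → tsupport φ ⊆ Ioo a b →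
      ∫ x in Ioo a b, D x * deriv φ x = 0) :
    ∃ c, ∀ᵐ x ∂(volume.restrict (Ioo a b)), D x = c := by
  let B : ContDiffBump ((a + b) / 2) := ⟨(b - a) / 8, (b - a) / 4, by linarith, by linarith⟩
  set ρ := B.normed volume with hρ
  have hρs : ContDiff ℝ ∞ ρ := B.contDiff_normed
  have hρc : HasCompactSupport ρ := B.hasCompactSupport_normed
  have hρt : tsupport ρ ⊆ Ioo a b := by
    rw [hρ, B.tsupport_normed_eq, Real.closedBall_eq_Icc]
    refine Icc_subset_Ioo ?_ ?_ <;> simp only [B] <;> linarith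
  have hρi : ∫ x, ρ x = 1 := B.integral_normed
  set c := ∫ x in Ioo a b, D x * ρ x with hcdef
  refine ⟨c, ?_⟩
  have hloc : LocallyIntegrableOn (fun x => D x - c) (Ioo a b) :=
    (hD.sub (integrableOn_const (by simp))).locallyIntegrableOn
  have key := isOpen_Ioo.ae_eq_zero_of_integral_contDiff_smul_eq_zero hloc fun g hg hgc hgs => by
    -- Subtracting `I ρ` from `g` gives mean zero, hence the derivative of an admissible test
    -- function; the constant is therefore the mean of `D` against `ρ`.
    set I := ∫ x, g x with hI
    have hgi : Integrable g := hg.continuous.integrable_of_hasCompactSupport hgc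
    have hρint : Integrable ρ := hρs.continuous.integrable_of_hasCompactSupport hρc
    have hts : tsupport (fun x => g x - I * ρ x) ⊆ Ioo a b :=
      (tsupport_sub g fun x => I * ρ x).trans (union_subset hgs
        ((closure_mono (Function.support_mul_subset_right _ _)).trans hρt))
    obtain ⟨φ, hφ, hφc, hφs, hφd⟩ := exists_primitive_of_integral_eq_zero (a := a) (b := b)
      (ψ := fun x => g x - I * ρ x) (hg.sub (contDiff_const.mul hρs)) (hgc.sub hρc.mul_left) hts
      (by rw [integral_sub hgi (hρint.const_mul I), integral_const_mul, hρi]; ring)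
    have h1 := H φ hφ hφc hφs
    have j1 : Integrable (fun x => D x * g x) (volume.restrict (Ioo a b)) :=
      integrable_mul_of_continuous hD hg.continuous hgc
    have j2 : Integrable (fun x => D x * ρ x) (volume.restrict (Ioo a b)) :=
      integrable_mul_of_continuous hD hρs.continuous hρc
    have e : ∫ x in Ioo a b, D x * deriv φ x = (∫ x in Ioo a b, D x * g x) - I * c := by
      rw [hφd, hcdef, ← integral_const_mul, ← integral_sub j1 (j2.const_mul I)]
      congr 1; ext x; ring
    have e2 : ∫ x, g x • (D x - c) = ∫ x in Ioo a b, (D x - c) * g x := by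
      rw [setIntegral_mul_eq hgs]; simp [mul_comm]
    have e3 : ∫ x in Ioo a b, (D x - c) * g x = (∫ x in Ioo a b, D x * g x) - c * I := by
      rw [hI, ← integral_const_mul, ← setIntegral_mul_eq hgs (fun _ => c),
        ← integral_sub j1 (hgi.const_mul c).integrableOn]
      congr 1; ext x; ring
    rw [e2, e3]; linarith
  rw [ae_restrict_iff' measurableSet_Ioo]
  filter_upwards [key] with x hx hxm
  exact sub_eq_zero.1 (hx hxm)

/-- The primitive of `g` is absolutely continuous and can be integrated by parts, so `f` minus this
primitive has zero weak derivative and is constant by du Bois-Reymond. -/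
theorem HasWeakDerivOn.exists_primitive {a b : ℝ} (hab : a < b) {f g : ℝ → ℝ}
    (h : HasWeakDerivOn a b f g) (hf : IntegrableOn f (Ioo a b)) (hg : IntegrableOn g (Ioo a b)) :
    ∃ c, ∀ᵐ x ∂(volume.restrict (Ioo a b)), f x = c + ∫ y in a..x, g y := by
  have hgi : IntervalIntegrable g volume a b := by
    rwa [intervalIntegrable_iff_integrableOn_Ioo_of_le hab.le]
  have hac := hgi.absolutelyContinuousOnInterval_intervalIntegral (c := a) left_mem_uIcc
  have hGi : IntegrableOn (fun x => ∫ y in a..x, g y) (Ioo a b) := by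
    have := hac.continuousOn
    rw [uIcc_of_le hab.le] at this
    exact this.integrableOn_Icc.mono_set Ioo_subset_Icc_self
  obtain ⟨c, hc⟩ := exists_const_of_integral_mul_deriv_eq_zero hab (hf.sub hGi)
    fun φ hφ hφc hφs => by
      have hφ1 : ContDiff ℝ 1 φ := hφ.of_le (by exact_mod_cast le_top)
      have hφac : AbsolutelyContinuousOnInterval φ a b :=
        hφ1.contDiffOn.absolutelyContinuousOnInterval
      have hz : ∀ x, x ∉ Ioo a b → φ x = 0 := fun x hx =>
        image_eq_zero_of_notMem_tsupport fun h' => hx (hφs h')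
      have h1 := hφac.integral_mul_deriv_eq_deriv_mul hac
      rw [hz a (by simp), hz b (by simp)] at h1
      have h2 : ∫ x in a..b, φ x * deriv (fun x => ∫ y in a..x, g y) x
          = ∫ x in Ioo a b, g x * φ x := by
        rw [intervalIntegral.integral_of_le hab.le, integral_Ioc_eq_integral_Ioo]
        refine setIntegral_congr_ae measurableSet_Ioo ?_
        filter_upwards [hgi.ae_hasDerivAt_integral] with x hx hxm
        rw [(hx (by rw [uIcc_of_le hab.le]; exact Ioo_subset_Icc_self hxm) a left_mem_uIcc).deriv,
          mul_comm]
      have h4 : ∫ x in a..b, deriv φ x * ∫ y in a..x, g y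
          = ∫ x in Ioo a b, deriv φ x * ∫ y in a..x, g y := by
        rw [intervalIntegral.integral_of_le hab.le, integral_Ioc_eq_integral_Ioo]
      rw [h2, h4] at h1
      simp only [zero_mul, sub_zero, zero_sub] at h1
      have h3 := h φ hφ hφc hφs
      have hd : Continuous (deriv φ) := hφ1.continuous_deriv le_rfl
      have e : ∫ x in Ioo a b, (f x - ∫ y in a..x, g y) * deriv φ x
          = (∫ x in Ioo a b, f x * deriv φ x)
            - ∫ x in Ioo a b, deriv φ x * ∫ y in a..x, g y := by
        rw [← integral_sub (integrable_mul_of_continuous hf hd hφc.deriv)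
          ((integrable_mul_of_continuous hGi hd hφc.deriv).congr
            (Eventually.of_forall fun x => mul_comm _ _))]
        congr 1; ext x; ring
      exact e.trans (by linarith)
  refine ⟨c, hc.mono fun x hx => ?_⟩
  have : f x - ∫ y in a..x, g y = c := hx
  linarith

/-- A weak balance law in time, with initial datum, holds in integrated form. -/
theorem balance_of_weak {T c₀ : ℝ} (hT : 0 < T) {F G : ℝ → ℝ} (hF : ContinuousOn F (Icc 0 T))
    (hG : ContinuousOn G (Icc 0 T))
    (H : ∀ θ : ℝ → ℝ, ContDiff ℝ ∞ θ → HasCompactSupport θ → tsupport θ ⊆ Iio T →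
      (∫ t in (0 : ℝ)..T, (deriv θ t * F t + θ t * G t)) + θ 0 * c₀ = 0) :
    F 0 = c₀ ∧ ∀ s t, 0 ≤ s → s ≤ t → t ≤ T → F t - F s = ∫ σ in s..t, G σ := by
  have hIoo : ∀ f : ℝ → ℝ, ∫ t in (0 : ℝ)..T, f t = ∫ t in Ioo 0 T, f t := fun f => by
    rw [intervalIntegral.integral_of_le hT.le, integral_Ioc_eq_integral_Ioo]
  have hFi : IntegrableOn F (Ioo 0 T) := hF.integrableOn_Icc.mono_set Ioo_subset_Icc_self
  have hGi : IntegrableOn G (Ioo 0 T) := hG.integrableOn_Icc.mono_set Ioo_subset_Icc_self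
  have hGI : ∀ s t, 0 ≤ s → s ≤ t → t ≤ T → IntervalIntegrable G volume s t := fun s t hs hst ht =>
    (hG.mono (by rw [uIcc_of_le hst]; exact Icc_subset_Icc hs ht)).intervalIntegrable
  have hw : HasWeakDerivOn 0 T F G := fun θ hθ hc hs => by
    have h1 := H θ hθ hc (hs.trans Ioo_subset_Iio_self)
    have h0 : θ 0 = 0 := image_eq_zero_of_notMem_tsupport fun h' => lt_irrefl _ (hs h').1
    have hd : Continuous (deriv θ) := hθ.continuous_deriv (by exact_mod_cast le_top)
    rw [h0, zero_mul, add_zero, hIoo, integral_add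
      ((integrable_mul_of_continuous hFi hd hc.deriv).congr
        (Eventually.of_forall fun x => mul_comm _ _))
      ((integrable_mul_of_continuous hGi hθ.continuous hc).congr
        (Eventually.of_forall fun x => mul_comm _ _))] at h1
    simp only [mul_comm (F _), mul_comm (G _)]
    linarith
  obtain ⟨c, hc⟩ := hw.exists_primitive hT hFi hGi
  have hprim : ContinuousOn (fun x => ∫ y in (0 : ℝ)..x, G y) (Icc 0 T) := by
    have := intervalIntegral.continuousOn_primitive_interval (a := 0) (b := T) (μ := volume)
      (f := G) (by rw [uIcc_of_le hT.le]; exact hG.integrableOn_Icc)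
    rwa [uIcc_of_le hT.le] at this
  have heq : EqOn F (fun x => c + ∫ y in (0 : ℝ)..x, G y) (Icc 0 T) := by
    refine Measure.eqOn_Icc_of_ae_eq volume hT.ne ?_ hF (continuousOn_const.add hprim)
    rwa [← restrict_Ioo_eq_restrict_Icc]
  have hbal : ∀ s t, 0 ≤ s → s ≤ t → t ≤ T → F t - F s = ∫ σ in s..t, G σ := by
    intro s t hs hst ht
    rw [heq ⟨hs.trans hst, ht⟩, heq ⟨hs, hst.trans ht⟩]
    change c + _ - (c + _) = _
    rw [add_sub_add_left_eq_sub,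
      intervalIntegral.integral_interval_sub_left (hGI 0 t le_rfl (hs.trans hst) ht)
        (hGI 0 s le_rfl hs (hst.trans ht))]
  refine ⟨?_, hbal⟩
  -- A test equal to `1` at time `0` and vanishing near `T` isolates the initial value.
  let B : ContDiffBump (0 : ℝ) := ⟨T / 4, T / 2, by linarith, by linarith⟩
  have hBs : tsupport B ⊆ Iio T := by
    rw [B.tsupport_eq, Real.closedBall_eq_Icc]
    exact fun x hx => (hx.2.trans_lt (by simp only [B]; linarith) : x < T)
  have h1 := H B B.contDiff B.hasCompactSupport hBs
  have hB0 : B 0 = 1 := B.one_of_mem_closedBall (by simp [B.rIn_pos.le])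
  have hBT : B T = 0 := image_eq_zero_of_notMem_tsupport fun h' => lt_irrefl T (hBs h')
  have h2 := intervalIntegral.integral_deriv_mul_eq_sub_of_hasDerivAt (a := 0) (b := T)
    (u := B) (v := F) (u' := deriv B) (v' := G) B.continuous.continuousOn
    (by rwa [uIcc_of_le hT.le])
    (fun x _ => ((B.contDiff (n := 1)).differentiable one_ne_zero x).hasDerivAt)
    (fun x hx => ?_) (((B.contDiff (n := 1)).continuous_deriv le_rfl).intervalIntegrable _ _)
    (hGI 0 T le_rfl hT.le le_rfl)
  · rw [h2, hB0, hBT] at h1; linarith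
  · rw [min_eq_left hT.le, max_eq_right hT.le] at hx
    have h3 : HasDerivAt (fun x => c + ∫ σ in (0 : ℝ)..x, G σ) (G x) x := by
      refine HasDerivAt.const_add _ (intervalIntegral.integral_hasDerivAt_right
        (hGI 0 x le_rfl hx.1.le hx.2.le) ?_ (hG.continuousAt (Icc_mem_nhds hx.1 hx.2)))
      exact ContinuousOn.stronglyMeasurableAtFilter isOpen_Ioo (hG.mono Ioo_subset_Icc_self) x hx
    refine h3.congr_of_eventuallyEq ?_
    filter_upwards [Icc_mem_nhds hx.1 hx.2] with y hy using heq hy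

theorem integral_sq_sub_eq (f g : Lp ℝ 2 (volume : Measure ℝ)) :
    Integrable (fun x => (f x - g x) ^ 2) ∧ ∫ x, (f x - g x) ^ 2 = ‖f - g‖ ^ 2 := by
  have h : (fun x => (f - g) x ^ 2) =ᵐ[volume] fun x => (f x - g x) ^ 2 := by
    filter_upwards [Lp.coeFn_sub f g] with x hx
    rw [hx, Pi.sub_apply]
  refine ⟨(Lp.memLp (f - g)).integrable_sq.congr h, ?_⟩
  rw [← integral_congr_ae h, ← real_inner_self_eq_norm_sq, L2.inner_def]
  congr 1; ext x
  rw [real_inner_self_eq_norm_sq, Real.norm_eq_abs, sq_abs]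

theorem hasCompactSupport_mul_prod {θ φ : ℝ → ℝ} (hθ : HasCompactSupport θ)
    (hφ : HasCompactSupport φ) {U : Set ℝ} (hU : tsupport θ ⊆ U) :
    HasCompactSupport (fun p : ℝ × ℝ => θ p.1 * φ p.2) ∧
      tsupport (fun p : ℝ × ℝ => θ p.1 * φ p.2) ⊆ U ×ˢ univ := by
  have hs : Function.support (fun p : ℝ × ℝ => θ p.1 * φ p.2) ⊆ tsupport θ ×ˢ tsupport φ :=
    fun p hp => ⟨subset_tsupport _ (left_ne_zero_of_mul hp),
      subset_tsupport _ (right_ne_zero_of_mul hp)⟩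
  refine ⟨HasCompactSupport.of_support_subset_isCompact (hθ.isCompact.prod hφ.isCompact) hs, ?_⟩
  exact (closure_minimal hs ((isClosed_tsupport _).prod (isClosed_tsupport _))).trans
    (prod_mono hU (subset_univ _))

/-- Weak solutions are bounded solutions in time-integrated form. -/
theorem IsWeakSolution.exists_bddSol {T m A₁ A₂ CΓ : ℝ} {V γ q₀ W v k : ℝ → ℝ}
    {q : ℝ → Lp ℝ 2 (volume : Measure ℝ)} (h : IsWeakSolution T m V γ q₀ q) (hT : 0 < T)
    (hV : Vel A₁ A₂ W v) (hVW : ∀ s ∈ Icc 0 m, W s = V s) (hk : Kern CΓ k)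
    (hγ : ∀ f x, nonlocalTerm γ f x = corr k f x) (hq₀ : Integrable q₀) :
    ∃ M u, BddSol T M W k u ∧ (∀ t ∈ Icc 0 T, u t =ᵐ[volume] q t) ∧ u 0 =ᵐ[volume] q₀ := by
  classical
  obtain ⟨M₀, hM₀⟩ := h.bounded
  set M := max M₀ 0 with hM
  have hM0 : 0 ≤ M := le_max_right _ _
  set u : ℝ → ℝ → ℝ := fun t x => if t ∈ Icc 0 T then max (-M) (min M (q t x)) else 0 with hu
  have hum : ∀ t, Measurable (u t) := fun t => by
    by_cases ht : t ∈ Icc 0 T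
    · simp only [hu, if_pos ht]
      exact measurable_const.max (measurable_const.min (Lp.stronglyMeasurable (q t)).measurable)
    · simp only [hu, if_neg ht]; exact measurable_const
  have hub : ∀ t x, |u t x| ≤ M := fun t x => by
    simp only [hu]; split_ifs
    · exact abs_le.2 ⟨le_max_left _ _, max_le (by linarith) (min_le_left _ _)⟩
    · simpa using hM0
  have huq : ∀ t ∈ Icc 0 T, u t =ᵐ[volume] q t := fun t ht => by
    filter_upwards [hM₀ t ht] with x hx
    have h1 := abs_le.1 (hx.trans (le_max_left M₀ 0))
    simp only [hu, if_pos ht]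
    rw [min_eq_right h1.2, max_eq_right h1.1]
  have hcont : L2Cont T u := fun ε hε => by
    have huc := isCompact_Icc.uniformContinuousOn_of_continuous h.continuousOn
    obtain ⟨δ, hδ, hd⟩ := Metric.uniformContinuousOn_iff.1 huc (Real.sqrt ε) (Real.sqrt_pos.2 hε)
    refine ⟨δ / 2, by positivity, fun s hs t ht hst => ?_⟩
    have h1 := hd s hs t ht (by rw [Real.dist_eq]; linarith)
    have h2 := integral_sq_sub_eq (q s) (q t)
    have e : (fun x => (q s x - q t x) ^ 2) =ᵐ[volume] fun x => (u s x - u t x) ^ 2 := by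
      filter_upwards [huq s hs, huq t ht] with x h1 h2
      rw [h1, h2]
    rw [← integral_congr_ae e, h2.2]
    refine ⟨h2.1.congr e, ?_⟩
    rw [dist_eq_norm] at h1
    calc ‖q s - q t‖ ^ 2 ≤ Real.sqrt ε ^ 2 := by gcongr
      _ = ε := Real.sq_sqrt hε.le
  have hloc := hcont.locCont hum hub
  have hvm : ∀ s, Measurable fun x => W (corr k (u s) x) := fun s =>
    measurable_vel_corr hV hk (hum s)
  have hvb : ∀ s x, |W (corr k (u s) x)| ≤ A₁ * M + |W 0| := fun s =>
    hV.abs_comp_corr_le hk (hub s)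
  have hfb : ∀ s x, |W (corr k (u s) x) * u s x| ≤ (A₁ * M + |W 0|) * M := fun s x => by
    rw [abs_mul]
    exact mul_le_mul (hvb s x) (hub s x) (abs_nonneg _) ((abs_nonneg _).trans (hvb s x))
  have hfl : LocCont T fun s x => W (corr k (u s) x) * u s x :=
    LocCont.mul ((hcont.unifCont_corr hk hum hub).comp_vel hV) hloc hvm hum hvb hub
  have key : ∀ φ, TestFn φ → (∫ x, u 0 x * φ x) = (∫ x, q₀ x * φ x) ∧
      ∀ s t, 0 ≤ s → s ≤ t → t ≤ T → (∫ x, u t x * φ x) - ∫ x, u s x * φ x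
        = ∫ σ in s..t, ∫ x, W (corr k (u σ) x) * u σ x * deriv φ x := fun φ hφ => by
    -- Tests of product form `θ(t) φ(x)` reduce the weak formulation to a scalar balance law in time
    -- for each fixed `φ`.
    refine balance_of_weak hT (F := fun t => ∫ x, u t x * φ x)
      (G := fun t => ∫ x, W (corr k (u t) x) * u t x * deriv φ x)
      (hloc.continuousOn_mul_testFn hum hub hφ)
      (hfl.continuousOn_mul_deriv (fun s => (hvm s).mul (hum s)) hfb hφ) fun θ hθ hθc hθs => ?_
    have hΦ := hasCompactSupport_mul_prod hθc hφ.hasCompactSupport hθs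
    have hθ1 : ContDiff ℝ 1 θ := hθ.of_le (by exact_mod_cast le_top)
    have hw := h.weak_form (fun p => θ p.1 * φ p.2)
      ((hθ1.comp contDiff_fst).mul (hφ.contDiff.comp contDiff_snd)) hΦ.1 hΦ.2
    refine Eq.trans ?_ hw
    congr 1
    · refine intervalIntegral.integral_congr fun t ht => ?_
      rw [uIcc_of_le hT.le] at ht
      have i1 := hφ.integrable_mul (hum t) (hub t)
      have i2 : Integrable fun x => W (corr k (u t) x) * u t x * deriv φ x :=
        hφ.integrable_mul_deriv ((hvm t).mul (hum t)) (hfb t)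
      change deriv θ t * (∫ x, u t x * φ x)
        + θ t * (∫ x, W (corr k (u t) x) * u t x * deriv φ x) = _
      rw [← integral_const_mul, ← integral_const_mul,
        ← integral_add (i1.const_mul _) (i2.const_mul _)]
      refine integral_congr_ae ((huq t ht).mono fun x hx => ?_)
      -- The velocity and its extension agree on `[0, m]` only; `range_nonlocal` places the argument
      -- there.
      have e : V (nonlocalTerm γ (q t) x) = W (corr k (u t) x) := by
        rw [← hVW _ (h.range_nonlocal t ht x), hγ, corr_congr_ae (huq t ht)]
      simp only [e, ← hx]
      rw [deriv_mul_const (hθ1.differentiable one_ne_zero t),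
        deriv_const_mul _ (hφ.contDiff.differentiable one_ne_zero x)]
      ring
    · rw [mul_comm, ← integral_mul_const]
      congr 1; ext x; ring
  refine ⟨M, u, ⟨hum, hub, hcont, fun φ hφ => (key φ hφ).2⟩, huq, ?_⟩
  refine ae_eq_of_integral_contDiff_smul_eq ?_ hq₀.locallyIntegrable fun g hg hgc => ?_
  · exact (((Lp.memLp (q 0)).locallyIntegrable (by norm_num)).congr
      (huq 0 ⟨le_rfl, hT.le⟩).symm)
  · simpa only [smul_eq_mul, mul_comm] using (key g (TestFn.of_contDiff hg hgc)).1

/-! ### Pointwise representatives of velocities and kernels -/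

theorem ae_abs_le_linftyNorm {m : ℝ} {f : ℝ → ℝ} (hf : MemLp f ∞ (volume.restrict (Ioo 0 m))) :
    ∀ᵐ x ∂(volume.restrict (Ioo 0 m)), |f x| ≤ linftyNorm m f := by
  have h1 := hf.2.ne
  filter_upwards [ae_le_eLpNormEssSup (f := f) (μ := volume.restrict (Ioo 0 m))] with x hx
  rw [← eLpNorm_exponent_top] at hx
  have := ENNReal.toReal_mono h1 hx
  simpa [linftyNorm] using this

theorem le_of_ae_le_of_continuousOn {a b : ℝ} (hab : a < b) {f : ℝ → ℝ} {c : ℝ}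
    (hf : ContinuousOn f (Icc a b)) (h : ∀ᵐ x ∂(volume.restrict (Ioo a b)), f x ≤ c) {x : ℝ}
    (hx : x ∈ Icc a b) : f x ≤ c := by
  have h1 : EqOn (fun x => max (f x) c) (fun _ => c) (Icc a b) := by
    refine Measure.eqOn_Icc_of_ae_eq volume hab.ne ?_ (hf.sup continuousOn_const)
      continuousOn_const
    rw [← restrict_Ioo_eq_restrict_Icc]
    exact h.mono fun x hx => max_eq_right hx
  exact max_eq_right_iff.1 (h1 hx)

theorem abs_clamp_sub_le (m x y : ℝ) :
    |max 0 (min m x) - max 0 (min m y)| ≤ |x - y| := by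
  have h1 := abs_max_sub_max_le_max (0 : ℝ) (min m x) 0 (min m y)
  have h2 := abs_min_sub_min_le_max m x m y
  rw [sub_self, abs_zero, max_eq_right (abs_nonneg (_ : ℝ))] at h1 h2
  exact h1.trans h2

/-- Velocities extend to continuously differentiable functions on the line. -/
theorem IsVelocity.exists_vel {m CV : ℝ} {V V₁ V₂ : ℝ → ℝ} (h : IsVelocity m CV V V₁ V₂)
    (hm : 0 < m) :
    ∃ W v, Vel (linftyNorm m V₁) (linftyNorm m V₂) W v ∧ (∀ s ∈ Icc 0 m, W s = V s) ∧
      V₁ =ᵐ[volume.restrict (Ioo 0 m)] v := by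
  have hi : ∀ f : ℝ → ℝ, MemLp f ∞ (volume.restrict (Ioo 0 m)) → IntegrableOn f (Ioo 0 m) :=
    fun f hf => memLp_one_iff_integrable.1 (hf.mono_exponent le_top)
  have hII : ∀ f : ℝ → ℝ, IntegrableOn f (Ioo 0 m) → ∀ s t, s ∈ Icc 0 m → t ∈ Icc 0 m →
      IntervalIntegrable f volume s t := fun f hf s t hs ht => by
    have h1 : IntervalIntegrable f volume 0 m := by
      rwa [intervalIntegrable_iff_integrableOn_Ioo_of_le hm.le]
    exact h1.mono_set (by rw [uIcc_of_le hm.le]; exact uIcc_subset_Icc hs ht)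
  have hp : ∀ x, max 0 (min m x) ∈ Icc 0 m := fun x =>
    ⟨le_max_left _ _, max_le hm.le (min_le_left _ _)⟩
  have hpe : ∀ x ∈ Icc 0 m, max 0 (min m x) = x := fun x hx => by
    rw [min_eq_right hx.2, max_eq_right hx.1]
  have hi2 := hi _ h.memLp_two
  obtain ⟨c, hc⟩ := h.weakDeriv_two.exists_primitive hm (hi _ h.memLp_one) hi2
  obtain ⟨c', hc'⟩ := h.weakDeriv_one.exists_primitive hm (hi _ h.memLp) (hi _ h.memLp_one)
  -- Clamping the argument makes the derivative constant outside `[0, m]`, so that its sign, bound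
  -- and Lipschitz constant carry over to the whole line.
  set v : ℝ → ℝ := fun x => c + ∫ y in (0 : ℝ)..max 0 (min m x), V₂ y with hv
  have hvp : ∀ x, v x = v (max 0 (min m x)) := fun x => by simp only [hv, hpe _ (hp x)]
  have hb2 : ∀ᵐ x, x ∈ Ioo 0 m → |V₂ x| ≤ linftyNorm m V₂ :=
    (ae_restrict_iff' measurableSet_Ioo).1 (ae_abs_le_linftyNorm h.memLp_two)
  -- The essential bound holds on the open interval, whereas interval integrals include the right
  -- endpoint.
  have hbm : ∀ᵐ x : ℝ, x ≠ m := by simp [ae_iff]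
  have hlip : ∀ x y, |v x - v y| ≤ linftyNorm m V₂ * |x - y| := fun x y => by
    have e : v x - v y = ∫ z in max 0 (min m y)..max 0 (min m x), V₂ z := by
      simp only [hv]
      rw [add_sub_add_left_eq_sub, intervalIntegral.integral_interval_sub_left
        (hII _ hi2 _ _ ⟨le_rfl, hm.le⟩ (hp x)) (hII _ hi2 _ _ ⟨le_rfl, hm.le⟩ (hp y))]
    rw [e, ← Real.norm_eq_abs]
    refine (intervalIntegral.norm_integral_le_of_norm_le_const_ae
      (C := linftyNorm m V₂) ?_).trans (mul_le_mul_of_nonneg_left (abs_clamp_sub_le m x y)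
        ENNReal.toReal_nonneg)
    filter_upwards [hb2, hbm] with z hz hzm hzI
    have h1 : z ≤ m := hzI.2.trans (max_le (hp y).2 (hp x).2)
    have h2 : 0 < z := (le_min (hp y).1 (hp x).1).trans_lt hzI.1
    exact hz ⟨h2, lt_of_le_of_ne h1 hzm⟩
  have hvc : Continuous v := continuous_of_abs_sub_le hlip
  have hV₁ : V₁ =ᵐ[volume.restrict (Ioo 0 m)] v := by
    filter_upwards [hc, ae_restrict_mem measurableSet_Ioo] with x hx hxm
    simp only [hv, hpe x (Ioo_subset_Icc_self hxm), hx]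
  set W : ℝ → ℝ := fun x => c' + ∫ y in (0 : ℝ)..x, v y with hW
  have hWd : ∀ x, HasDerivAt W (v x) x := fun x => HasDerivAt.const_add _
    (intervalIntegral.integral_hasDerivAt_right (hvc.intervalIntegrable _ _)
      (hvc.stronglyMeasurableAtFilter _ _) hvc.continuousAt)
  refine ⟨W, v, ⟨hWd, fun x => ?_, fun x => ?_, hlip⟩, ?_, hV₁⟩
  · rw [hvp]
    refine le_of_ae_le_of_continuousOn hm hvc.continuousOn ?_ (hp x)
    filter_upwards [h.nonpos, hV₁] with y h1 h2
    rwa [← h2]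
  · rw [hvp, neg_le]
    refine le_of_ae_le_of_continuousOn (f := fun x => -v x) hm hvc.neg.continuousOn ?_ (hp x)
    filter_upwards [ae_abs_le_linftyNorm h.memLp_one, hV₁] with y h1 h2
    rw [← h2]
    exact (neg_le_abs _).trans h1
  · refine Measure.eqOn_Icc_of_ae_eq volume hm.ne ?_
      (continuous_iff_continuousAt.2 fun x => (hWd x).continuousAt).continuousOn h.continuousOn
    rw [← restrict_Ioo_eq_restrict_Icc]
    filter_upwards [hc', ae_restrict_mem measurableSet_Ioo] with x hx hxm
    rw [hx]
    simp only [hW]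
    congr 1
    refine intervalIntegral.integral_congr_ae ?_
    filter_upwards [(ae_restrict_iff' measurableSet_Ioo).1 hV₁] with y hy hyI
    rw [uIoc_of_le hxm.1.le] at hyI
    exact (hy ⟨hyI.1, hyI.2.trans_lt hxm.2⟩).symm

theorem exists_mem_Ioo_of_ae {P : ℝ → Prop} (h : ∀ᵐ x ∂(volume.restrict (Ici (0 : ℝ))), P x)
    {a b : ℝ} (ha : 0 ≤ a) (hab : a < b) : ∃ x, a < x ∧ x < b ∧ P x := by
  rw [ae_restrict_iff' measurableSet_Ici] at h
  obtain ⟨x, hx, h1, h2⟩ := (Measure.dense_of_ae h).exists_between hab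
  exact ⟨x, h1, h2, hx (ha.trans h1.le)⟩

/-- Kernels have pointwise representatives. -/
theorem IsKernel.exists_kern {CΓ R ε : ℝ} {γ : ℝ → ℝ} (h : IsKernel CΓ R ε γ) :
    ∃ k, Kern CΓ k ∧ ∀ᵐ z, k z = (Ioi 0).indicator γ z := by
  classical
  obtain ⟨g, hg, hγg⟩ := h.antitone
  -- Almost everywhere bounds become pointwise ones by monotonicity: the upper bound is taken from a
  -- point to the left of `z`, and the lower bound below from a point to its right.
  have hle : ∀ z, 0 < z → g z ≤ CΓ := fun z hz => by
    obtain ⟨y, h1, h2, h3, h4⟩ := exists_mem_Ioo_of_ae (h.le_bound.and hγg) le_rfl hz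
    rw [h4] at h3
    exact (hg h1.le hz.le h2.le).trans h3
  have hnn : ∀ z, 0 < z → 0 ≤ g z := fun z hz => by
    obtain ⟨y, h1, h2, h3, h4⟩ := exists_mem_Ioo_of_ae (h.nonneg.and hγg) hz.le (lt_add_one z)
    rw [h4] at h3
    exact h3.trans (hg hz.le (hz.trans h1).le h1.le)
  -- The value `CΓ` on the nonpositive half-line makes `g'` antitone on the whole line and hence
  -- measurable; the half-line is cut off afterwards.
  set g' : ℝ → ℝ := fun z => if 0 < z then g z else CΓ with hg'
  have hanti : Antitone g' := fun x y hxy => by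
    simp only [hg']
    by_cases hx : 0 < x
    · rw [if_pos hx, if_pos (hx.trans_le hxy)]
      exact hg hx.le (hx.trans_le hxy).le hxy
    · rw [if_neg hx]; split_ifs with hy
      · exact hle y hy
      · exact le_rfl
  have hCΓ : 0 ≤ CΓ := (hnn 1 one_pos).trans (hle 1 one_pos)
  have hpos : ∀ z, 0 < z → (Ioi 0).indicator g' z = g z := fun z hz => by
    rw [indicator_of_mem (show z ∈ Ioi 0 from hz), hg']; simp only [if_pos hz]
  have hneg : ∀ z ≤ 0, (Ioi 0).indicator g' z = 0 := fun z hz =>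
    indicator_of_notMem (not_lt.2 hz) _
  have hae : ∀ᵐ z, (Ioi 0).indicator g' z = (Ioi 0).indicator γ z := by
    filter_upwards [(ae_restrict_iff' measurableSet_Ici).1 hγg] with z hz
    by_cases h0 : 0 < z
    · rw [hpos z h0, indicator_of_mem (show z ∈ Ioi 0 from h0), hz h0.le]
    · rw [hneg z (not_lt.1 h0), indicator_of_notMem (show z ∉ Ioi 0 from h0)]
  refine ⟨(Ioi 0).indicator g', ⟨hanti.measurable.indicator measurableSet_Ioi, hneg, fun z => ?_,
    fun z => ?_, fun x y hx hxy => ?_, ?_, ?_⟩, hae⟩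
  · rcases lt_or_ge 0 z with hz | hz
    · rw [hpos z hz]; exact hnn z hz
    · rw [hneg z hz]
  · rcases lt_or_ge 0 z with hz | hz
    · rw [hpos z hz]; exact hle z hz
    · rw [hneg z hz]; exact hCΓ
  · rw [hpos x hx, hpos y (hx.trans_le hxy)]
    exact hg hx.le (hx.trans_le hxy).le hxy
  · refine Integrable.congr ?_ (EventuallyEq.symm hae)
    exact (integrable_indicator_iff measurableSet_Ioi).2 (h.integrableOn.mono_set Ioi_subset_Ici_self)
  · rw [integral_congr_ae hae, integral_indicator measurableSet_Ioi, ← integral_Ici_eq_integral_Ioi,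
      h.integral_eq_one]

theorem nonlocalTerm_eq_corr {γ k : ℝ → ℝ} (h : ∀ᵐ z, k z = (Ioi 0).indicator γ z)
    (f : ℝ → ℝ) (x : ℝ) : nonlocalTerm γ f x = corr k f x := by
  have h' : ∀ᵐ y, k (y - x) = (Ioi 0).indicator γ (y - x) :=
    (measurePreserving_sub_right volume x).quasiMeasurePreserving.ae h
  rw [nonlocalTerm, corr, ← integral_indicator measurableSet_Ioi,
    ← integral_sub_right_eq_self (fun z => k z * f (x + z)) x]
  refine integral_congr_ae (h'.mono fun y hy => ?_)
  simp only [hy, add_sub_cancel]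
  by_cases hyx : x < y
  · rw [indicator_of_mem (show y ∈ Ioi x from hyx),
      indicator_of_mem (show y - x ∈ Ioi 0 from sub_pos.2 hyx)]
  · rw [indicator_of_notMem (show y ∉ Ioi x from hyx),
      indicator_of_notMem (show y - x ∉ Ioi 0 from fun h => hyx (sub_pos.1 h)), zero_mul]

theorem integral_abs_kern_sub {γ γ' k k' : ℝ → ℝ} (h : ∀ᵐ z, k z = (Ioi 0).indicator γ z)
    (h' : ∀ᵐ z, k' z = (Ioi 0).indicator γ' z) :
    ∫ z, |k z - k' z| = ∫ x in Ici (0 : ℝ), |γ x - γ' x| := by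
  rw [integral_Ici_eq_integral_Ioi, ← integral_indicator measurableSet_Ioi]
  refine integral_congr_ae ?_
  filter_upwards [h, h'] with z h1 h2
  rw [h1, h2]
  by_cases hz : z ∈ Ioi (0 : ℝ)
  · simp only [indicator_of_mem hz]
  · simp only [indicator_of_notMem hz, sub_zero, abs_zero]

/-! ### Assembly: from weak solutions to the two estimates -/

theorem totalVariation_congr_ae {u w : ℝ → ℝ} (h : u =ᵐ[volume] w) :
    totalVariation u = totalVariation w := by
  unfold totalVariation
  refine iSup_congr fun φ => iSup_congr fun _ => ?_
  have e : ∫ x, u x * deriv φ x = ∫ x, w x * deriv φ x :=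
    integral_congr_ae (h.mono fun x hx => by simp only [hx])
  rw [e]

/-- Compactness bounds the set of norms, so that `sSup` is a genuine supremum and not a default
value. -/
theorem IsDataSet.norm_le_supL1 {m CQ : ℝ} {Q : Set (Lp ℝ 1 (volume : Measure ℝ))}
    (hQ : IsDataSet m CQ Q) {u : Lp ℝ 1 (volume : Measure ℝ)} (hu : u ∈ Q) : ‖u‖ ≤ supL1 Q :=
  le_csSup (hQ.isCompact.image continuous_norm).bddAbove (mem_image_of_mem _ hu)

theorem IsVelocity.linftyNorm_le {m CV : ℝ} {V V₁ V₂ : ℝ → ℝ} (h : IsVelocity m CV V V₁ V₂) :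
    linftyNorm m V₁ ≤ CV ∧ linftyNorm m V₂ ≤ CV :=
  ⟨(le_max_left _ _).trans ((le_max_right _ _).trans h.norm_le),
    (le_max_right _ _).trans ((le_max_right _ _).trans h.norm_le)⟩

/-- Weak solutions with admissible data have good representatives. -/
theorem IsWeakSolution.exists_sol {T m CQ A₁ A₂ CΓ : ℝ} {V γ W v k : ℝ → ℝ}
    {Q : Set (Lp ℝ 1 (volume : Measure ℝ))} (hQ : IsDataSet m CQ Q)
    {q₀ : Lp ℝ 1 (volume : Measure ℝ)} (hq₀ : q₀ ∈ Q) {q : ℝ → Lp ℝ 2 (volume : Measure ℝ)}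
    (h : IsWeakSolution T m V γ q₀ q) (hT : 0 < T) (hm : 0 < m) (hCQ : 0 < CQ)
    (hV : Vel A₁ A₂ W v) (hVW : ∀ s ∈ Icc 0 m, W s = V s) (hk : Kern CΓ k)
    (hγ : ∀ᵐ z, k z = (Ioi 0).indicator γ z) :
    ∃ u, Sol T m (supL1 Q) W k u ∧ (∀ t ∈ Icc 0 T, u t =ᵐ[volume] q t) ∧
      u 0 =ᵐ[volume] q₀ ∧ ShiftBd (u 0) CQ := by
  have hi : Integrable q₀ := L1.integrable_coeFn q₀
  obtain ⟨M, w, hw, hwq, hw0⟩ := h.exists_bddSol hT hV hVW hk (nonlocalTerm_eq_corr hγ) hi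
  have hC : ∫ x, |w 0 x| ≤ supL1 Q := by
    rw [integral_congr_ae (hw0.mono fun x hx => show |w 0 x| = ‖q₀ x‖ by rw [hx, Real.norm_eq_abs]),
      ← L1.norm_eq_integral_norm]
    exact hQ.norm_le_supL1 hq₀
  obtain ⟨u, hu, huw⟩ := hw.exists_sol hV hk hm.le (hi.congr hw0.symm)
    (by filter_upwards [hw0, hQ.bounds q₀ hq₀] with x h1 h2; rwa [h1]) hC
  have h0 := (huw 0 ⟨le_rfl, hT.le⟩).trans hw0
  refine ⟨u, hu, fun t ht => (huw t ht).trans (hwq t ht), h0, ?_⟩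
  refine ScaleBd.shiftBd (fun Λ => scaleBd_of_totalVariation_le hCQ.le ?_ Λ) (hu.meas 0) (hu.bdd 0)
  rw [totalVariation_congr_ae h0]
  exact hQ.totalVariation_le q₀ hq₀

theorem abs_sub_le_linftyNorm {m : ℝ} (hm : 0 < m) {f f' g g' : ℝ → ℝ}
    (hf : MemLp f ∞ (volume.restrict (Ioo 0 m))) (hf' : MemLp f' ∞ (volume.restrict (Ioo 0 m)))
    (hg : Continuous g) (hg' : Continuous g') (h : f =ᵐ[volume.restrict (Ioo 0 m)] g)
    (h' : f' =ᵐ[volume.restrict (Ioo 0 m)] g') {s : ℝ} (hs : s ∈ Icc 0 m) :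
    |g s - g' s| ≤ linftyNorm m fun s => f s - f' s := by
  refine le_of_ae_le_of_continuousOn (f := fun s => |g s - g' s|) hm
    (hg.sub hg').abs.continuousOn ?_ hs
  filter_upwards [ae_abs_le_linftyNorm (hf.sub hf'), h, h'] with x h1 h2 h3
  rw [← h2, ← h3]; exact h1

theorem totalVariation_weakSolution_le {T m CQ CV CΓ R ε : ℝ} (hT : 0 < T) (hm : 0 < m)
    (hCQ : 0 < CQ) {Q : Set (Lp ℝ 1 (volume : Measure ℝ))} (hQ : IsDataSet m CQ Q)
    {q₀ : Lp ℝ 1 (volume : Measure ℝ)} (hq₀ : q₀ ∈ Q) {V V₁ V₂ γ : ℝ → ℝ}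
    (hV : IsVelocity m CV V V₁ V₂) (hγ : IsKernel CΓ R ε γ)
    {q : ℝ → Lp ℝ 2 (volume : Measure ℝ)} (hq : IsWeakSolution T m V γ q₀ q) {t : ℝ}
    (ht : t ∈ Icc 0 T) :
    totalVariation (q t) ≤ ENNReal.ofReal
        (tvConst CQ (supL1 Q) m CΓ (linftyNorm m V₁) (linftyNorm m V₂) t) ∧
      totalVariation (q t) ≤ ENNReal.ofReal (tvConst CQ (supL1 Q) m CΓ CV CV t) := by
  obtain ⟨W, v, hW, hVW, -⟩ := hV.exists_vel hm
  obtain ⟨k, hk, hkγ⟩ := hγ.exists_kern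
  obtain ⟨u, hu, huq, -, h0⟩ := hq.exists_sol hQ hq₀ hT hm hCQ hW (fun s hs => hVW s hs) hk hkγ
  have h1 := (hu.shiftBd_tvConst hW hk h0 ht).totalVariation_le (hu.meas t) (hu.bdd t)
    (hu.integrable t)
  rw [totalVariation_congr_ae (huq t ht)] at h1
  exact ⟨h1, h1.trans (ENNReal.ofReal_le_ofReal (tvConst_mono hCQ.le hu.nonneg_mass hm.le
    hk.bound_nonneg hW.A₁_nonneg hW.A₂_nonneg ht.1 le_rfl hV.linftyNorm_le.1
    hV.linftyNorm_le.2))⟩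

theorem eLpNorm_weakSolution_sub_le {T m CQ CV CΓ R ε : ℝ} (hT : 0 < T) (hm : 0 < m)
    (hCV : 0 < CV) (hCQ : 0 < CQ) {Q : Set (Lp ℝ 1 (volume : Measure ℝ))}
    (hQ : IsDataSet m CQ Q) {q₀ q₀' : Lp ℝ 1 (volume : Measure ℝ)} (hq₀ : q₀ ∈ Q)
    (hq₀' : q₀' ∈ Q) {V V₁ V₂ V' V₁' V₂' γ γ' : ℝ → ℝ}
    (hV : IsVelocity m CV V V₁ V₂) (hV' : IsVelocity m CV V' V₁' V₂')
    (hγ : IsKernel CΓ R ε γ) (hγ' : IsKernel CΓ R ε γ')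
    {q q' : ℝ → Lp ℝ 2 (volume : Measure ℝ)} (hq : IsWeakSolution T m V γ q₀ q)
    (hq' : IsWeakSolution T m V' γ' q₀' q') {C : ℝ → ℝ}
    (hC : C = tvConst CQ (supL1 Q) m CΓ (linftyNorm m V₁) (linftyNorm m V₂)) {t : ℝ}
    (ht : t ∈ Icc 0 T) :
    eLpNorm (fun x => q t x - q' t x) 1 volume ≤ ENNReal.ofReal
      ((‖q₀ - q₀'‖
        + (t * m * CΓ * supL1 Q + ∫ s in (0 : ℝ)..t, C s)
          * max (linftyNorm m (fun s => V s - V' s)) (linftyNorm m (fun s => V₁ s - V₁' s))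
        + (2 * (∫ s in (0 : ℝ)..t, C s) * CV * m + t * CV * supL1 Q * CΓ * m ^ 2)
          * ∫ x in Ici (0 : ℝ), |γ x - γ' x|)
        * Real.exp (CV * CΓ * t * (C T + m * (1 + m)))) := by
  obtain ⟨W, v, hW, hVW, hv⟩ := hV.exists_vel hm
  obtain ⟨W', v', hW', hVW', hv'⟩ := hV'.exists_vel hm
  obtain ⟨k, hk, hkγ⟩ := hγ.exists_kern
  obtain ⟨k', hk', hkγ'⟩ := hγ'.exists_kern
  obtain ⟨u, hu, huq, hu0, h0⟩ := hq.exists_sol hQ hq₀ hT hm hCQ hW hVW hk hkγ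
  obtain ⟨u', hu', huq', hu0', h0'⟩ := hq'.exists_sol hQ hq₀' hT hm hCQ hW' hVW' hk' hkγ'
  have hae : ∀ {f g : ℝ → ℝ}, (∀ s ∈ Icc 0 m, f s = g s) → g =ᵐ[volume.restrict (Ioo 0 m)] f :=
    fun h => by
      filter_upwards [ae_restrict_mem measurableSet_Ioo] with x hx
      exact (h x (Ioo_subset_Icc_self hx)).symm
  set N := max (linftyNorm m (fun s => V s - V' s)) (linftyNorm m (fun s => V₁ s - V₁' s)) with hN
  set G := ∫ x in Ici (0 : ℝ), |γ x - γ' x| with hG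
  set A₁ := linftyNorm m V₁ with hA₁
  set A₂ := linftyNorm m V₂ with hA₂
  set A₁' := linftyNorm m V₁' with hA₁'
  have hN₀ : ∀ s ∈ Icc 0 m, |W s - W' s| ≤ N := fun s hs =>
    (abs_sub_le_linftyNorm hm hV.memLp hV'.memLp hW.continuous hW'.continuous (hae hVW)
      (hae hVW') hs).trans (le_max_left _ _)
  have hN₁ : ∀ s ∈ Icc 0 m, |v s - v' s| ≤ N := fun s hs =>
    (abs_sub_le_linftyNorm hm hV.memLp_one hV'.memLp_one hW.continuous_deriv
      hW'.continuous_deriv hv hv' hs).trans (le_max_right _ _)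
  have hI₀ : ∫ x, |u 0 x - u' 0 x| = ‖q₀ - q₀'‖ := by
    rw [L1.norm_eq_integral_norm]
    refine integral_congr_ae ?_
    filter_upwards [hu0, hu0', Lp.coeFn_sub q₀ q₀'] with x h1 h2 h3
    rw [h1, h2, h3, Pi.sub_apply, Real.norm_eq_abs]
  have key := hu.stability hu' hW hW' hk hk' h0 h0' hN₀ hN₁ (integral_abs_kern_sub hkγ hkγ').le
    hI₀.le ht
  have hL : eLpNorm (fun x => q t x - q' t x) 1 volume
      = ENNReal.ofReal (∫ x, |u t x - u' t x|) := by
    have e : (fun x => q t x - q' t x) =ᵐ[volume] fun x => u t x - u' t x := by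
      filter_upwards [huq t ht, huq' t ht] with x h1 h2
      rw [h1, h2]
    rw [eLpNorm_congr_ae e, eLpNorm_one_eq_lintegral_enorm]
    exact (ofReal_integral_norm_eq_lintegral_enorm
      ((hu.integrable t).sub (hu'.integrable t))).symm
  rw [hL]
  refine ENNReal.ofReal_le_ofReal (key.trans ?_)
  rw [← hG, ← hC]
  have hS := hu.nonneg_mass
  have hA₁0 : 0 ≤ A₁ := hW.A₁_nonneg
  have hA₂0 : 0 ≤ A₂ := hW.A₂_nonneg
  have hA₁0' : 0 ≤ A₁' := hW'.A₁_nonneg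
  have hA₁le : A₁ ≤ CV := hV.linftyNorm_le.1
  have hA₂le : A₂ ≤ CV := hV.linftyNorm_le.2
  have hA₁le' : A₁' ≤ CV := hV'.linftyNorm_le.1
  have hΓ := hk.bound_nonneg
  have ht0 := ht.1
  have hm0 := hm.le
  have hN0 : 0 ≤ N := (abs_nonneg _).trans (hN₀ 0 ⟨le_rfl, hm.le⟩)
  have hG0 : 0 ≤ G := integral_nonneg fun _ => abs_nonneg _
  have hCn : ∀ s, 0 ≤ s → 0 ≤ C s := fun s hs => by
    rw [hC]; exact tvConst_nonneg hCQ.le hS hA₂0 hs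
  have hCc : Continuous C := by rw [hC]; exact continuous_tvConst ..
  have hCT := hCn T hT.le
  have hJ0 : 0 ≤ ∫ s in (0 : ℝ)..t, C s :=
    intervalIntegral.integral_nonneg ht.1 fun s hs => hCn s hs.1
  have hint : ∫ s in (0 : ℝ)..t, ((N + (A₁ + A₁') * m * G) * max 0 (C s)
        + m * CΓ * supL1 Q * (N + A₂ * m * G))
      = (N + (A₁ + A₁') * m * G) * (∫ s in (0 : ℝ)..t, C s)
        + t * (m * CΓ * supL1 Q * (N + A₂ * m * G)) := by
    rw [intervalIntegral.integral_add
      (Continuous.intervalIntegrable (by fun_prop) _ _) intervalIntegrable_const,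
      intervalIntegral.integral_const_mul, intervalIntegral.integral_const, sub_zero, smul_eq_mul]
    congr 2
    refine intervalIntegral.integral_congr fun s hs => ?_
    rw [uIcc_of_le ht.1] at hs
    exact max_eq_right (hCn s hs.1)
  rw [hint]
  set J := ∫ s in (0 : ℝ)..t, C s
  -- Outside `C` all norms of the velocities are replaced by `CV`: `A₁ + A₁' ≤ 2 CV` gives the
  -- factor `2` of the kernel term, and `m² CΓ CV + CV m CΓ = CV CΓ m (1 + m)` gives the exponent.
  refine mul_le_mul ?_ (Real.exp_le_exp.2 ?_) (Real.exp_pos _).le (by positivity)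
  · have h1 : (N + (A₁ + A₁') * m * G) * J ≤ (N + (CV + CV) * m * G) * J := by gcongr
    have h2 : t * (m * CΓ * supL1 Q * (N + A₂ * m * G))
        ≤ t * (m * CΓ * supL1 Q * (N + CV * m * G)) := by gcongr
    linarith
  · have h1 : (A₁ * CΓ * C T + m ^ 2 * CΓ * A₂ + A₁' * m * CΓ) * t
        ≤ (CV * CΓ * C T + m ^ 2 * CΓ * CV + CV * m * CΓ) * t := by gcongr
    linarith

end NonlocalCL

end

theorem mainTheorem4 (T qmax CΓ CV CQ R ε : ℝ)
    (hT : 0 < T) (hqmax : 0 < qmax) (hCΓ : 0 < CΓ) (hCV : 0 < CV) (hCQ : 0 < CQ)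
    (hR : 0 < R) (hε : 0 < ε)
    (Q : Set (Lp ℝ 1 (volume : Measure ℝ))) (hQ : NonlocalCL.IsDataSet qmax CQ Q) :
    -- total variation bound, for each velocity and uniformly in all data
    (∀ q₀ ∈ Q, ∀ V V₁ V₂ γ : ℝ → ℝ,
      NonlocalCL.IsVelocity qmax CV V V₁ V₂ → NonlocalCL.IsKernel CΓ R ε γ →
      ∀ q : ℝ → Lp ℝ 2 (volume : Measure ℝ), NonlocalCL.IsWeakSolution T qmax V γ q₀ q →
      ∀ t ∈ Icc 0 T,
        NonlocalCL.totalVariation (q t) ≤ ENNReal.ofReal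
          (NonlocalCL.tvConst CQ (NonlocalCL.supL1 Q) qmax CΓ
            (NonlocalCL.linftyNorm qmax V₁) (NonlocalCL.linftyNorm qmax V₂) t) ∧
        NonlocalCL.totalVariation (q t) ≤ ENNReal.ofReal
          (NonlocalCL.tvConst CQ (NonlocalCL.supL1 Q) qmax CΓ CV CV t)) ∧
    -- stability in `L¹` with respect to initial datum, velocity and kernel
    (∀ q₀ ∈ Q, ∀ q₀' ∈ Q, ∀ V V₁ V₂ V' V₁' V₂' γ γ' : ℝ → ℝ,
      NonlocalCL.IsVelocity qmax CV V V₁ V₂ → NonlocalCL.IsVelocity qmax CV V' V₁' V₂' →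
      NonlocalCL.IsKernel CΓ R ε γ → NonlocalCL.IsKernel CΓ R ε γ' →
      ∀ q q' : ℝ → Lp ℝ 2 (volume : Measure ℝ),
      NonlocalCL.IsWeakSolution T qmax V γ q₀ q →
      NonlocalCL.IsWeakSolution T qmax V' γ' q₀' q' →
      ∀ C : ℝ → ℝ,
      C = NonlocalCL.tvConst CQ (NonlocalCL.supL1 Q) qmax CΓ
            (NonlocalCL.linftyNorm qmax V₁) (NonlocalCL.linftyNorm qmax V₂) →
      ∀ t ∈ Icc 0 T,
        eLpNorm (fun x => q t x - q' t x) 1 volume ≤ ENNReal.ofReal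
          ((‖q₀ - q₀'‖
            + (t * qmax * CΓ * NonlocalCL.supL1 Q + ∫ s in (0 : ℝ)..t, C s)
              * max (NonlocalCL.linftyNorm qmax (fun s => V s - V' s))
                  (NonlocalCL.linftyNorm qmax (fun s => V₁ s - V₁' s))
            + (2 * (∫ s in (0 : ℝ)..t, C s) * CV * qmax
                + t * CV * NonlocalCL.supL1 Q * CΓ * qmax ^ 2)
              * ∫ x in Ici (0 : ℝ), |γ x - γ' x|)
            * Real.exp (CV * CΓ * t * (C T + qmax * (1 + qmax))))) := by
  refine ⟨fun q₀ hq₀ V V₁ V₂ γ hV hγ q hq t ht =>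
    NonlocalCL.totalVariation_weakSolution_le hT hqmax hCQ hQ hq₀ hV hγ hq ht, ?_⟩
  intro q₀ hq₀ q₀' hq₀' V V₁ V₂ V' V₁' V₂' γ γ' hV hV' hγ hγ' q q' hq hq' C hC t ht
  exact NonlocalCL.eLpNorm_weakSolution_sub_le hT hqmax hCV hCQ hQ hq₀ hq₀' hV hV' hγ hγ' hq hq'
    hC ht
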